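/- **Setting.** For each $n\ge 1$ and $p$, consider a linear model $y=X\beta^*+\varepsilon$ with $y,\varepsilon\in\mathbb R^n$, $\beta^*\in\mathbb R^p$ and a random $X\in\mathbb R^{n\times p}$ with rows $x_1,\dots,x_n$. Let $$\hat\beta(y,X)=\operatorname*{argmin}_{b\in\mathbb R^p}\ \frac1n\sum_{i=1}^n\rho(y_i-x_i^\top b)+g(b),\qquad r_i=y_i-x_i^\top\hat\beta,\qquad \psi=\rho'.$$ **Assumption 1** (constants $\gamma,\mu>0$): $p/n\le\gamma$; $\rho:\mathbb R\to\mathbb R$ is convex with unique minimizer $0$, continuously differentiable, and $\psi$ is $1$-Lipschitz; the rows $x_i$ are i.i.d. $N(0,\Sigma)$ with $\Sigma$ invertible; $\varepsilon$ is independent of $X$ and its law on $\mathbb R^n$ is absolutely continuous with respect to Lebesgue measure; $g:\mathbb R^p\to\mathbb R$ is such that $b\mapsto g(b)-\frac\mu2 b^\top\Sigma b$ is convex. The objects $p,\rho,g,\Sigma,\beta^*$ and the law of $\varepsilon$ may depend on $n$. **Assumption 2** (constant $M$): $g(0)=\min g$, $|\psi|\le M$ and $\|\Sigma^{1/2}\beta^*\|^2\le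 M$. **The matrix $\hat A$.** $\hat A=\hat A(y,X)\in\mathbb R^{p\times p}$ is a matrix with $\|\Sigma^{1/2}\hat A\Sigma^{1/2}\|_{op}\le (n\mu)^{-1}$ such that, for all $i,j$, $$\frac{\partial\hat\beta}{\partial y_i}=\hat AX^\top e_i\,\psi'(r_i),\qquad \frac{\partial\hat\beta}{\partial x_{ij}}=\hat Ae_j\,\psi(r_i)-\hat AX^\top e_i\,\psi'(r_i)\,\hat\beta_j .$$ $O_P(a_n)$ denotes random variables $W_n$ such that for every $\delta>0$ there is $K$, depending only on $(\delta,\gamma,\mu)$ (and on $M$ in part 3), with $\mathbb P(|W_n|\ge Ka_n)\le\delta$ for all $n$. The variables whose existence is asserted live on the probability space of $(X,\varepsilon)$ enlarged by one independent standard normal variable. **Theorem.** Let Assumption 1 hold. Then, almost surely, $\hat\beta$ is differentiable at $(y,X)$, the derivatives $\psi'(r_i)$ exist, and a matrix $\hat A$ as above exists. Moreover: 1. For every $i=1,\dots,n$ there is $Z_i\sim N(0,1)$ such that, almost surely, $$\Big|\big(r_i+\operatorname{tr}[\Sigma\hat A]\psi(r_i)\big)-\big(\varepsilon_i+\|\Sigma^{1/2}(\hat\beta-\beta^*)\|Z_i\big)\Big|\le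 O_P(n^{-1/4})\big(|\psi(\varepsilon_i)|+\|\Sigma^{1/2}(\hat\beta-\beta^*)\|\big),$$ where the constants in $O_P$ do not depend on $i$. 2. For a sequence of such problems with $n\to\infty$ (and fixed $\gamma,\mu$) and indices $i=i_n\in\{1,\dots,n\}$ such that $\varepsilon_i$ has a fixed law $F$, there are random pairs $(\tilde\varepsilon_i^n,\tilde Z_i^n)$ converging in distribution to $F\otimes N(0,1)$ such that, almost surely, $$r_i+\operatorname{tr}[\Sigma\hat A]\psi(r_i)=\tilde\varepsilon_i^n+\|\Sigma^{1/2}(\hat\beta-\beta^*)\|\tilde Z_i^n .$$ 3. If Assumption 2 also holds, then $|\psi(\varepsilon_i)|+\|\Sigma^{1/2}(\hat\beta-\beta^*)\|=O_P(1)$ for every $i$. -/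

import Mathlib

open MeasureTheory ProbabilityTheory Filter Topology
open scoped Matrix MatrixOrder

universe u

noncomputable section

/-- The objective `b ↦ n⁻¹ ∑ᵢ ρ(yᵢ - xᵢᵀ b) + g(b)` of the regularized M-estimation problem.
The observed data are `d = (y, X)`, where `X` is given by its rows `xᵢ = X i ∈ ℝᵖ`. -/
def mObjective {n p : ℕ} (ρ : ℝ → ℝ) (g : EuclideanSpace ℝ (Fin p) → ℝ)
    (d : (Fin n → ℝ) × (Fin n → EuclideanSpace ℝ (Fin p))) (b : EuclideanSpace ℝ (Fin p)) : ℝ :=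
  (1 / (n : ℝ)) * ∑ i, ρ (d.1 i - inner ℝ (d.2 i) b) + g b

/-- The regularized M-estimator `β̂(y, X)`: the minimizer of the objective. -/
def betaHat {n p : ℕ} (ρ : ℝ → ℝ) (g : EuclideanSpace ℝ (Fin p) → ℝ)
    (d : (Fin n → ℝ) × (Fin n → EuclideanSpace ℝ (Fin p))) : EuclideanSpace ℝ (Fin p) :=
  Classical.epsilon fun b => IsMinOn (mObjective ρ g d) Set.univ b

/-- The residuals `rᵢ = yᵢ - xᵢᵀ β̂(y, X)`. -/
def mResidual {n p : ℕ} (ρ : ℝ → ℝ) (g : EuclideanSpace ℝ (Fin p) → ℝ)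
    (d : (Fin n → ℝ) × (Fin n → EuclideanSpace ℝ (Fin p))) (i : Fin n) : ℝ :=
  d.1 i - inner ℝ (d.2 i) (betaHat ρ g d)

/-- `A` is a matrix describing the derivatives of the M-estimator at the data `d = (y, X)`:
the map `(y, X) ↦ β̂(y, X)` is differentiable at `d`, the derivatives `ψ'(rᵢ)` of `ψ = ρ'` exist,
`‖Σ^{1/2} A Σ^{1/2}‖_op ≤ (n μ)⁻¹`, and, for all `i`, `j`,
`∂β̂/∂yᵢ = A Xᵀ eᵢ ψ'(rᵢ)` and `∂β̂/∂xᵢⱼ = A eⱼ ψ(rᵢ) - A Xᵀ eᵢ ψ'(rᵢ) β̂ⱼ`.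
Here `Xᵀ eᵢ` is the row `d.2 i` of `X`. -/
structure IsDerivativeMatrix {n p : ℕ} (μ : ℝ) (ρ : ℝ → ℝ) (g : EuclideanSpace ℝ (Fin p) → ℝ)
    (S : Matrix (Fin p) (Fin p) ℝ) (d : (Fin n → ℝ) × (Fin n → EuclideanSpace ℝ (Fin p)))
    (A : Matrix (Fin p) (Fin p) ℝ) : Prop where
  differentiableAt : DifferentiableAt ℝ (betaHat (n := n) ρ g) d
  differentiableAt_psi : ∀ i, DifferentiableAt ℝ (deriv ρ) (mResidual ρ g d i)
  norm_le : ‖Matrix.toEuclideanCLM (𝕜 := ℝ) (CFC.sqrt S * A * CFC.sqrt S)‖ ≤ ((n : ℝ) * μ)⁻¹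
  deriv_y : ∀ i, fderiv ℝ (betaHat (n := n) ρ g) d (Pi.single i 1, 0) =
    deriv (deriv ρ) (mResidual ρ g d i) • Matrix.toEuclideanCLM (𝕜 := ℝ) A (d.2 i)
  deriv_x : ∀ i j,
    fderiv ℝ (betaHat (n := n) ρ g) d (0, Pi.single i (EuclideanSpace.single j 1)) =
      deriv ρ (mResidual ρ g d i) • Matrix.toEuclideanCLM (𝕜 := ℝ) A (EuclideanSpace.single j 1) -
      (deriv (deriv ρ) (mResidual ρ g d i) * betaHat ρ g d j) •
        Matrix.toEuclideanCLM (𝕜 := ℝ) A (d.2 i)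

/-- The matrix `Â = Â(y, X)`. -/
def Ahat {n p : ℕ} (μ : ℝ) (ρ : ℝ → ℝ) (g : EuclideanSpace ℝ (Fin p) → ℝ)
    (S : Matrix (Fin p) (Fin p) ℝ) (d : (Fin n → ℝ) × (Fin n → EuclideanSpace ℝ (Fin p))) :
    Matrix (Fin p) (Fin p) ℝ :=
  Classical.epsilon fun A => IsDerivativeMatrix μ ρ g S d A

/-- The data of one regression problem with `n` observations and `p` features: a probability space,
the random design `X` (given by its rows), the noise `ε`, the covariance `Σ` (written `S`),
the regression vector `β*`, the loss `ρ` and the penalty `g`. -/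
structure RegressionProblem (n p : ℕ) where
  Ω : Type u
  [measurableSpace : MeasurableSpace Ω]
  P : Measure Ω
  [isProbabilityMeasure : IsProbabilityMeasure P]
  X : Ω → Fin n → EuclideanSpace ℝ (Fin p)
  ε : Ω → Fin n → ℝ
  S : Matrix (Fin p) (Fin p) ℝ
  betaStar : EuclideanSpace ℝ (Fin p)
  ρ : ℝ → ℝ
  g : EuclideanSpace ℝ (Fin p) → ℝ

attribute [instance] RegressionProblem.measurableSpace RegressionProblem.isProbabilityMeasure

namespace RegressionProblem

variable {n p : ℕ}

/-- The main assumption, with constants `γ` and `μ`. -/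
structure MainAssumption (R : RegressionProblem.{u} n p) (γ μ : ℝ) : Prop where
  n_pos : 0 < n
  p_le : (p : ℝ) / n ≤ γ
  convexOn_loss : ConvexOn ℝ Set.univ R.ρ
  loss_minimizer : ∀ t, t ≠ 0 → R.ρ 0 < R.ρ t
  contDiff_loss : ContDiff ℝ 1 R.ρ
  lipschitzWith_psi : LipschitzWith 1 (deriv R.ρ)
  posDef : R.S.PosDef
  measurable_X : Measurable R.X
  measurable_ε : Measurable R.ε
  law_row : ∀ i, R.P.map (fun ω => R.X ω i) = multivariateGaussian 0 R.S
  iIndepFun_rows : iIndepFun (fun i ω => R.X ω i) R.P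
  indepFun_noise : IndepFun R.ε R.X R.P
  noise_absolutelyContinuous : R.P.map R.ε ≪ volume
  stronglyConvex : ConvexOn ℝ Set.univ
    (fun b : EuclideanSpace ℝ (Fin p) => R.g b - μ / 2 * (b ⬝ᵥ R.S *ᵥ b))

/-- The observed data `(y, X)` with `y = X β* + ε`. -/
def data (R : RegressionProblem.{u} n p) (ω : R.Ω) :
    (Fin n → ℝ) × (Fin n → EuclideanSpace ℝ (Fin p)) :=
  (fun i => inner ℝ (R.X ω i) R.betaStar + R.ε ω i, R.X ω)

/-- `ψ = ρ'`. -/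
def psi (R : RegressionProblem.{u} n p) : ℝ → ℝ := deriv R.ρ

/-- `‖Σ^{1/2} v‖`. -/
def normS (R : RegressionProblem.{u} n p) (v : EuclideanSpace ℝ (Fin p)) : ℝ :=
  ‖Matrix.toEuclideanCLM (𝕜 := ℝ) (CFC.sqrt R.S) v‖

/-- The estimation error `‖Σ^{1/2} (β̂ - β*)‖`. -/
def err (R : RegressionProblem.{u} n p) (ω : R.Ω) : ℝ :=
  R.normS (betaHat R.ρ R.g (R.data ω) - R.betaStar)

/-- The matrix `Â` at the observed data. -/
def A (R : RegressionProblem.{u} n p) (μ : ℝ) (ω : R.Ω) : Matrix (Fin p) (Fin p) ℝ :=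
  Ahat μ R.ρ R.g R.S (R.data ω)

/-- The adjusted residual `rᵢ + tr[Σ Â] ψ(rᵢ)`. -/
def adjustedResidual (R : RegressionProblem.{u} n p) (μ : ℝ) (i : Fin n) (ω : R.Ω) : ℝ :=
  mResidual R.ρ R.g (R.data ω) i +
    (R.S * R.A μ ω).trace * R.psi (mResidual R.ρ R.g (R.data ω) i)

/-- The additional assumption, with constant `M`. -/
structure AdditionalAssumption (R : RegressionProblem.{u} n p) (M : ℝ) : Prop where
  penalty_minimizer : ∀ b, R.g 0 ≤ R.g b
  abs_psi_le : ∀ t, |R.psi t| ≤ M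
  signal_le : R.normS R.betaStar ^ 2 ≤ M

/-- The law of the enlargement `Ω × ℝ` of the probability space by an independent standard normal
variable, namely the second coordinate. Random variables on `Ω` are read on `Ω × ℝ` through the
first coordinate. -/
abbrev extP (R : RegressionProblem.{u} n p) : Measure (R.Ω × ℝ) :=
  R.P.prod (gaussianReal 0 1)

end RegressionProblem

/-- `W` is bounded by a multiple of `a` in probability with constants `K δ`:
`P(|W| ≥ K δ · a) ≤ δ` for every `δ > 0`. If `K` is the same for all members `W_n`, `a_n` of
a family, then `W_n = O_P(a_n)`, with constants depending only on what `K` depends on. -/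
def BoundedInProbability {Ω : Type u} [MeasurableSpace Ω] (P : Measure Ω) (W : Ω → ℝ)
    (a : ℝ) (K : ℝ → ℝ) : Prop :=
  ∀ δ : ℝ, 0 < δ → P {ω | K δ * a ≤ |W ω|} ≤ ENNReal.ofReal δ

end

/-!
Put `θ = Σ^{1/2} (b - β*)`. In this coordinate the rows are standard Gaussian vectors `zᵢ`, the
signal vanishes, and the penalty `G` is `μ`-strongly convex for the Euclidean norm, so everything
is proved for such a whitened problem and then transported back (`whiteAssumption`,
`map_whiteData`, `isDerivativeMatrix`, `adjustedResidual_eq`).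

*Differentiability.* Comparing the optimality conditions at two data points bounds the change of
the minimizer by the change of the score. Hence `β̂` is locally Lipschitz, and differentiable
almost everywhere by Rademacher's theorem. As `ψ` is Lipschitz and `yᵢ ↦ rᵢ` is strictly monotone
with inverse of controlled size, the residuals almost surely avoid any given null set, so that
`ψ'(rᵢ)` exists and `ψ(rᵢ) ≠ 0`. The infinitesimal form of the comparison says that the derivative
in the direction `w` has norm at most `(nμ)⁻¹` times the linearized score of `w`. Where some
`ψ(rᵢ) ≠ 0`, the linearized score is onto `ℝᵖ`, so the derivative factors through it; the factor
is `Â` (`ae_exists_isDerivativeOperator`), and it is unique (`IsDerivativeMatrix.unique`).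

*The approximation.* Fix `i`, let `θ₀` be the estimator computed with `zᵢ` replaced by `0`, which
does not depend on `zᵢ`, and consider the vector field `z ↦ θ̂(z) - θ₀`, where `θ̂(z)` is the
estimator with `zᵢ = z`. Its Gaussian divergence at `z = zᵢ` is `zᵀ(θ̂(z) - θ₀) - div θ̂(z)`. By the
formulas for the derivatives, this equals `εᵢ - zᵢᵀ θ₀ - (rᵢ + tr(A) ψ(rᵢ))` up to a term of order
`n^{-1/2} ‖θ̂‖`. The second-order Stein inequality `E[(zᵀF - div F)²] ≤ E[‖F‖² + ‖DF‖²]` bounds it: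
here `‖F‖` and the Hilbert-Schmidt norm of `DF` are of order `n^{-1/2}` times `|ψ(εᵢ)| + ‖θ₀‖`,
the Jacobian being a multiple of `A` plus a matrix of rank one. The inequality is proved for
Lipschitz fields with compact support by mollification (`integral_gaussianDivergence_sq_le`) and
applied after truncation (`measure_gaussianDivergence_rowIncrement_ge_le`).

As `θ₀` is independent of `zᵢ`, the variable `-zᵢᵀ θ₀ / ‖θ₀‖` is standard normal and independent
of `ε` (`map_rowNormal`); where `θ₀ = 0` it is replaced by the auxiliary normal variable.
Replacing `‖θ₀‖` by `‖θ̂‖` costs another term of order `n^{-1/2}`. Altogether the relative error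
is even of order `n^{-1/2}` in probability (`exists_relativeError_boundedInProbability`).

*The remaining claims.* The representation with the perturbed pair distributes the error between
the two variables in the proportion `|ψ(εᵢ)|` to `‖Σ^{1/2} (β̂ - β*)‖`, and the perturbation
vanishes in the limit because the law of `εᵢ` is tight. Boundedness of the estimation error
follows from comparing the objective at `β̂` and at `0`, where the score at the noise has second
moment of order `p / n` (`exists_norm_betaHat_boundedInProbability`).
-/

noncomputable section

/-! ### Whitened M-estimation problems and their losses -/

/-- The conditions on the loss and on the penalty under which the M-estimator is studied after
whitening. The covariance is then the identity, so that the penalty is `μ`-strongly convex for the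
Euclidean norm. -/
structure WhiteAssumption {p : ℕ} (n : ℕ) (μ : ℝ) (ρ : ℝ → ℝ)
    (g : EuclideanSpace ℝ (Fin p) → ℝ) : Prop where
  n_pos : 0 < n
  mu_pos : 0 < μ
  convexOn_loss : ConvexOn ℝ Set.univ ρ
  loss_minimizer : ∀ t, t ≠ 0 → ρ 0 < ρ t
  contDiff_loss : ContDiff ℝ 1 ρ
  lipschitzWith_psi : LipschitzWith 1 (deriv ρ)
  stronglyConvex : StrongConvexOn Set.univ μ g

namespace WhiteAssumption

variable {n p : ℕ} {μ : ℝ} {ρ : ℝ → ℝ} {g : EuclideanSpace ℝ (Fin p) → ℝ}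

theorem differentiable_loss (h : WhiteAssumption n μ ρ g) : Differentiable ℝ ρ :=
  h.contDiff_loss.differentiable one_ne_zero

theorem monotone_psi (h : WhiteAssumption n μ ρ g) : Monotone (deriv ρ) :=
  monotoneOn_univ.1 (h.convexOn_loss.monotoneOn_deriv fun x _ => h.differentiable_loss x)

theorem psi_zero (h : WhiteAssumption n μ ρ g) : deriv ρ 0 = 0 := by
  apply IsLocalMin.deriv_eq_zero
  refine Filter.Eventually.of_forall fun t => ?_
  rcases eq_or_ne t 0 with rfl | ht
  · exact le_rfl
  · exact (h.loss_minimizer t ht).le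

theorem psi_eq_zero_iff (h : WhiteAssumption n μ ρ g) {t : ℝ} : deriv ρ t = 0 ↔ t = 0 := by
  refine ⟨fun h0 => ?_, fun ht => ht ▸ h.psi_zero⟩
  by_contra ht
  have hmin := h.loss_minimizer t ht
  rcases lt_or_gt_of_ne ht with hlt | hgt
  · have := h.convexOn_loss.deriv_le_slope (Set.mem_univ t) (Set.mem_univ 0) hlt
      (h.differentiable_loss t)
    rw [h0, slope_def_field] at this
    have h1 := mul_le_mul_of_nonneg_right this (sub_nonneg.2 hlt.le)
    rw [div_mul_cancel₀ _ (by linarith)] at h1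
    linarith
  · have := h.convexOn_loss.slope_le_deriv (Set.mem_univ 0) (Set.mem_univ t) hgt
      (h.differentiable_loss t)
    rw [h0, slope_def_field] at this
    have h1 := mul_le_mul_of_nonneg_right this (sub_nonneg.2 hgt.le)
    rw [div_mul_cancel₀ _ (by linarith)] at h1
    linarith

theorem abs_psi_sub_le (h : WhiteAssumption n μ ρ g) (s t : ℝ) :
    |deriv ρ s - deriv ρ t| ≤ |s - t| := by
  have := h.lipschitzWith_psi.dist_le_mul s t
  simpa [Real.dist_eq] using this

theorem abs_psi_le (h : WhiteAssumption n μ ρ g) (t : ℝ) : |deriv ρ t| ≤ |t| := by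
  simpa [h.psi_zero] using h.abs_psi_sub_le t 0

theorem psi_sub_mul_nonpos (h : WhiteAssumption n μ ρ g) (a c : ℝ) :
    (deriv ρ (a - c) - deriv ρ a) * c ≤ 0 := by
  rcases le_total 0 c with hc | hc
  · exact mul_nonpos_of_nonpos_of_nonneg
      (sub_nonpos.2 (h.monotone_psi (by linarith))) hc
  · exact mul_nonpos_of_nonneg_of_nonpos
      (sub_nonneg.2 (h.monotone_psi (by linarith))) hc

theorem deriv_psi_nonneg (h : WhiteAssumption n μ ρ g) (t : ℝ) : 0 ≤ deriv (deriv ρ) t :=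
  h.monotone_psi.deriv_nonneg

theorem abs_deriv_psi_le (h : WhiteAssumption n μ ρ g) (t : ℝ) : |deriv (deriv ρ) t| ≤ 1 := by
  simpa using norm_deriv_le_of_lipschitz (x₀ := t) h.lipschitzWith_psi

/-! ### Existence of the M-estimator and its variational inequality -/

theorem continuous_penalty (h : WhiteAssumption n μ ρ g) : Continuous g := by
  have h1 := strongConvexOn_iff_convex.1 h.stronglyConvex
  have h2 : Continuous fun x => g x - μ / 2 * ‖x‖ ^ 2 := by
    rw [← continuousOn_univ]
    exact h1.continuousOn isOpen_univ
  have h3 : g = fun x => (g x - μ / 2 * ‖x‖ ^ 2) + μ / 2 * ‖x‖ ^ 2 := by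
    funext x; ring
  rw [h3]
  exact h2.add (by fun_prop)

theorem continuous_mObjective (h : WhiteAssumption n μ ρ g)
    (d : (Fin n → ℝ) × (Fin n → EuclideanSpace ℝ (Fin p))) : Continuous (mObjective ρ g d) := by
  have hρ : Continuous ρ := h.contDiff_loss.continuous
  have hg := h.continuous_penalty
  unfold mObjective
  fun_prop

/-- A finite convex function on a finite-dimensional space decays at most linearly. -/
theorem _root_.ConvexOn.exists_neg_mul_le {E : Type*} [NormedAddCommGroup E] [NormedSpace ℝ E]
    [FiniteDimensional ℝ E] {H : E → ℝ} (hH : ConvexOn ℝ Set.univ H) :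
    ∃ C : ℝ, ∀ v, -(C * (1 + ‖v‖)) ≤ H v := by
  have hc : Continuous H := by
    rw [← continuousOn_univ]
    exact hH.continuousOn isOpen_univ
  obtain ⟨C, hC⟩ := (isCompact_closedBall (0 : E) 1).exists_bound_of_continuousOn hc.continuousOn
  have hC0 : 0 ≤ C := (norm_nonneg _).trans (hC 0 (by simp))
  refine ⟨2 * C, fun v => ?_⟩
  rcases le_total ‖v‖ 1 with hv | hv
  · have h1 := hC v (by simpa using hv)
    have h2 := neg_le_of_abs_le (Real.norm_eq_abs _ ▸ h1)
    nlinarith [norm_nonneg v]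
  · have hv0 : 0 < ‖v‖ := by linarith
    have h1 : H ((1 - ‖v‖⁻¹) • 0 + ‖v‖⁻¹ • v) ≤ (1 - ‖v‖⁻¹) • H 0 + ‖v‖⁻¹ • H v :=
      hH.2 (Set.mem_univ 0) (Set.mem_univ v)
        (by simpa using inv_le_one_of_one_le₀ hv) (by positivity) (by ring)
    have h2 := hC (‖v‖⁻¹ • v) (by simp [norm_smul, inv_mul_cancel₀ hv0.ne'])
    have h3 := hC 0 (by simp)
    rw [Real.norm_eq_abs, abs_le] at h2 h3
    simp only [smul_zero, zero_add, smul_eq_mul] at h1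
    have h4 : -C ≤ (1 - ‖v‖⁻¹) * H 0 + ‖v‖⁻¹ * H v := h2.1.trans h1
    have h5 : ‖v‖ * -C ≤ ‖v‖ * ((1 - ‖v‖⁻¹) * H 0 + ‖v‖⁻¹ * H v) :=
      mul_le_mul_of_nonneg_left h4 hv0.le
    have h6 : ‖v‖ * ((1 - ‖v‖⁻¹) * H 0 + ‖v‖⁻¹ * H v) = (‖v‖ - 1) * H 0 + H v := by
      field_simp
    rw [h6] at h5
    nlinarith

theorem exists_isMinOn (h : WhiteAssumption n μ ρ g)
    (d : (Fin n → ℝ) × (Fin n → EuclideanSpace ℝ (Fin p))) :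
    ∃ b, IsMinOn (mObjective ρ g d) Set.univ b := by
  obtain ⟨C, hC⟩ := (strongConvexOn_iff_convex.1 h.stronglyConvex).exists_neg_mul_le
  have hρ0 : ∀ t, ρ 0 ≤ ρ t := fun t => by
    rcases eq_or_ne t 0 with rfl | ht
    · exact le_rfl
    · exact (h.loss_minimizer t ht).le
  have hμ := h.mu_pos
  have hlow : ∀ b, (μ / 2 * ‖b‖ - C) * ‖b‖ + (ρ 0 - C) ≤ mObjective ρ g d b := fun b => by
    have h1 : ρ 0 ≤ (1 / (n : ℝ)) * ∑ i, ρ (d.1 i - inner ℝ (d.2 i) b) := by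
      have h2 : ∑ _i : Fin n, ρ 0 ≤ ∑ i, ρ (d.1 i - inner ℝ (d.2 i) b) :=
        Finset.sum_le_sum fun i _ => hρ0 _
      have hn : (0 : ℝ) < n := by exact_mod_cast h.n_pos
      rw [one_div, le_inv_mul_iff₀ hn]
      simpa using h2
    have := hC b
    unfold mObjective
    nlinarith
  have htend : Tendsto (mObjective ρ g d) (cocompact _) atTop := by
    refine tendsto_atTop_mono hlow ?_
    have h1 : Tendsto (fun b : EuclideanSpace ℝ (Fin p) => ‖b‖) (cocompact _) atTop :=
      tendsto_norm_cocompact_atTop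
    refine tendsto_atTop_add_const_right _ _ (Tendsto.atTop_mul_atTop₀ ?_ h1)
    exact tendsto_atTop_add_const_right _ _ (h1.const_mul_atTop (by positivity))
  obtain ⟨b, hb⟩ := (h.continuous_mObjective d).exists_forall_le htend
  exact ⟨b, fun x _ => hb x⟩

theorem isMinOn_betaHat (h : WhiteAssumption n μ ρ g)
    (d : (Fin n → ℝ) × (Fin n → EuclideanSpace ℝ (Fin p))) :
    IsMinOn (mObjective ρ g d) Set.univ (betaHat ρ g d) :=
  Classical.epsilon_spec (h.exists_isMinOn d)

/-- The first-order optimality condition: `n⁻¹ ∑ ψ(rₗ) xₗ` is a subgradient of the penalty at a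
minimizer, with the quadratic gain given by strong convexity. -/
theorem penalty_ge_of_isMinOn (h : WhiteAssumption n μ ρ g)
    {d : (Fin n → ℝ) × (Fin n → EuclideanSpace ℝ (Fin p))} {θ : EuclideanSpace ℝ (Fin p)}
    (hθ : IsMinOn (mObjective ρ g d) Set.univ θ) (b : EuclideanSpace ℝ (Fin p)) :
    (1 / (n : ℝ)) * ∑ l, deriv ρ (d.1 l - inner ℝ (d.2 l) θ) * inner ℝ (d.2 l) (b - θ) +
      μ / 2 * ‖b - θ‖ ^ 2 ≤ g b - g θ := by
  set v := b - θ with hv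
  set L : ℝ → ℝ := fun t => (1 / (n : ℝ)) *
    ∑ l, ρ (d.1 l - inner ℝ (d.2 l) θ - t * inner ℝ (d.2 l) v) with hL
  have hLd : HasDerivAt L (-((1 / (n : ℝ)) *
      ∑ l, deriv ρ (d.1 l - inner ℝ (d.2 l) θ) * inner ℝ (d.2 l) v)) 0 := by
    rw [← mul_neg, ← Finset.sum_neg_distrib]
    refine HasDerivAt.const_mul _ (HasDerivAt.fun_sum fun l _ => ?_)
    have h1 : HasDerivAt (fun t : ℝ => d.1 l - inner ℝ (d.2 l) θ - t * inner ℝ (d.2 l) v)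
        (-(1 * inner ℝ (d.2 l) v)) 0 :=
      ((hasDerivAt_id (0 : ℝ)).mul_const _).const_sub _
    have h2 : HasDerivAt ρ (deriv ρ (d.1 l - inner ℝ (d.2 l) θ))
        (d.1 l - inner ℝ (d.2 l) θ - 0 * inner ℝ (d.2 l) v) := by
      simpa using (h.differentiable_loss (d.1 l - inner ℝ (d.2 l) θ)).hasDerivAt
    exact (h2.comp (0 : ℝ) h1).congr_deriv (by ring)
  have hslope := hLd.tendsto_slope_zero_right
  have hlim : Tendsto (fun t : ℝ => -(g b - g θ) + μ / 2 * (1 - t) * ‖v‖ ^ 2) (𝓝[>] 0)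
      (𝓝 (-(g b - g θ) + μ / 2 * (1 - 0) * ‖v‖ ^ 2)) := by
    refine Tendsto.mono_left (Continuous.tendsto ?_ 0) nhdsWithin_le_nhds
    fun_prop
  have hev : ∀ᶠ t : ℝ in 𝓝[>] 0,
      -(g b - g θ) + μ / 2 * (1 - t) * ‖v‖ ^ 2 ≤ t⁻¹ • (L (0 + t) - L 0) := by
    filter_upwards [Ioo_mem_nhdsGT (zero_lt_one' ℝ)] with t ht
    have ht0 : 0 < t := ht.1
    have hconv := (h.stronglyConvex.2 (Set.mem_univ θ) (Set.mem_univ b) : ∀ ⦃s t : ℝ⦄, _)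
      (show 0 ≤ 1 - t by linarith [ht.2]) ht0.le (by ring)
    have hpt : (1 - t) • θ + t • b = θ + t • v := by rw [hv]; module
    rw [hpt, norm_sub_rev, ← hv] at hconv
    simp only [smul_eq_mul] at hconv
    have hmin : mObjective ρ g d θ ≤ mObjective ρ g d (θ + t • v) := hθ (Set.mem_univ _)
    have e1 : mObjective ρ g d (θ + t • v) = L t + g (θ + t • v) := by
      simp only [mObjective, hL, inner_add_right, inner_smul_right, sub_sub]
    have e0 : mObjective ρ g d θ = L 0 + g θ := by
      simp only [mObjective, hL, zero_mul, sub_zero]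
    rw [e1, e0] at hmin
    rw [zero_add, smul_eq_mul, le_inv_mul_iff₀ ht0]
    nlinarith
  have hle := le_of_tendsto_of_tendsto hlim hslope hev
  linarith

/-- Strong monotonicity of the optimality conditions, for two data sets `d` and `d'`. -/
theorem norm_sub_sq_le_of_isMinOn (h : WhiteAssumption n μ ρ g)
    {d d' : (Fin n → ℝ) × (Fin n → EuclideanSpace ℝ (Fin p))} {θ θ' : EuclideanSpace ℝ (Fin p)}
    (hθ : IsMinOn (mObjective ρ g d) Set.univ θ)
    (hθ' : IsMinOn (mObjective ρ g d') Set.univ θ') :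
    n * μ * ‖θ - θ'‖ ^ 2 ≤ ∑ l, (deriv ρ (d.1 l - inner ℝ (d.2 l) θ) * inner ℝ (d.2 l) (θ - θ') -
      deriv ρ (d'.1 l - inner ℝ (d'.2 l) θ') * inner ℝ (d'.2 l) (θ - θ')) := by
  have h1 := h.penalty_ge_of_isMinOn hθ θ'
  have h2 := h.penalty_ge_of_isMinOn hθ' θ
  have hn : (0 : ℝ) < n := by exact_mod_cast h.n_pos
  rw [norm_sub_rev] at h1
  have h3 : ∑ l, deriv ρ (d.1 l - inner ℝ (d.2 l) θ) * inner ℝ (d.2 l) (θ' - θ) =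
      -∑ l, deriv ρ (d.1 l - inner ℝ (d.2 l) θ) * inner ℝ (d.2 l) (θ - θ') := by
    rw [← Finset.sum_neg_distrib]
    refine Finset.sum_congr rfl fun l _ => ?_
    rw [← neg_sub θ θ', inner_neg_right, mul_neg]
  rw [h3] at h1
  rw [Finset.sum_sub_distrib]
  set A := ∑ l, deriv ρ (d.1 l - inner ℝ (d.2 l) θ) * inner ℝ (d.2 l) (θ - θ')
  set B := ∑ l, deriv ρ (d'.1 l - inner ℝ (d'.2 l) θ') * inner ℝ (d'.2 l) (θ - θ')
  have h4 : μ * ‖θ - θ'‖ ^ 2 ≤ (1 / (n : ℝ)) * (A - B) := by linarith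
  rw [one_div, le_inv_mul_iff₀ hn] at h4
  linarith

theorem norm_betaHat_sub_sq_le (h : WhiteAssumption n μ ρ g)
    (d d' : (Fin n → ℝ) × (Fin n → EuclideanSpace ℝ (Fin p))) :
    n * μ * ‖betaHat ρ g d - betaHat ρ g d'‖ ^ 2 ≤
      ∑ l, (deriv ρ (mResidual ρ g d l) * inner ℝ (d.2 l) (betaHat ρ g d - betaHat ρ g d') -
        deriv ρ (mResidual ρ g d' l) * inner ℝ (d'.2 l) (betaHat ρ g d - betaHat ρ g d')) :=
  h.norm_sub_sq_le_of_isMinOn (h.isMinOn_betaHat d) (h.isMinOn_betaHat d')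

theorem eq_betaHat_of_isMinOn (h : WhiteAssumption n μ ρ g)
    {d : (Fin n → ℝ) × (Fin n → EuclideanSpace ℝ (Fin p))} {θ : EuclideanSpace ℝ (Fin p)}
    (hθ : IsMinOn (mObjective ρ g d) Set.univ θ) : betaHat ρ g d = θ := by
  have h1 := h.norm_sub_sq_le_of_isMinOn (h.isMinOn_betaHat d) hθ
  have hn : (0 : ℝ) < n := by exact_mod_cast h.n_pos
  have h2 : ∑ l, (deriv ρ (d.1 l - inner ℝ (d.2 l) (betaHat ρ g d)) *
      inner ℝ (d.2 l) (betaHat ρ g d - θ) -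
      deriv ρ (d.1 l - inner ℝ (d.2 l) θ) * inner ℝ (d.2 l) (betaHat ρ g d - θ)) ≤ 0 := by
    refine Finset.sum_nonpos fun l _ => ?_
    have := h.psi_sub_mul_nonpos (d.1 l - inner ℝ (d.2 l) θ) (inner ℝ (d.2 l) (betaHat ρ g d - θ))
    rw [inner_sub_right] at this ⊢
    have e : d.1 l - inner ℝ (d.2 l) θ - (inner ℝ (d.2 l) (betaHat ρ g d) - inner ℝ (d.2 l) θ) =
        d.1 l - inner ℝ (d.2 l) (betaHat ρ g d) := by ring
    rw [e] at this
    linarith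
  have hμ := h.mu_pos
  have h3 : ‖betaHat ρ g d - θ‖ ^ 2 ≤ 0 := by
    by_contra hcon
    have : 0 < n * μ * ‖betaHat ρ g d - θ‖ ^ 2 := by
      rw [not_le] at hcon
      positivity
    linarith
  have h4 : ‖betaHat ρ g d - θ‖ = 0 := by
    have := sq_nonneg ‖betaHat ρ g d - θ‖
    exact pow_eq_zero_iff two_ne_zero |>.1 (le_antisymm h3 this)
  exact sub_eq_zero.1 (norm_eq_zero.1 h4)

/-! ### Regularity of the M-estimator as a function of the data -/

theorem norm_betaHat_sub_le (h : WhiteAssumption n μ ρ g)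
    (d d' : (Fin n → ℝ) × (Fin n → EuclideanSpace ℝ (Fin p))) :
    n * μ * ‖betaHat ρ g d - betaHat ρ g d'‖ ≤
      ∑ l, ((|d.1 l - d'.1 l| + ‖d.2 l - d'.2 l‖ * ‖betaHat ρ g d'‖) * ‖d.2 l‖ +
        |deriv ρ (mResidual ρ g d' l)| * ‖d.2 l - d'.2 l‖) := by
  have h1 := h.norm_betaHat_sub_sq_le d d'
  set θ := betaHat ρ g d with hθ
  set θ' := betaHat ρ g d' with hθ'
  set S := ∑ l, ((|d.1 l - d'.1 l| + ‖d.2 l - d'.2 l‖ * ‖θ'‖) * ‖d.2 l‖ +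
        |deriv ρ (mResidual ρ g d' l)| * ‖d.2 l - d'.2 l‖) with hS
  have h2 : n * μ * ‖θ - θ'‖ ^ 2 ≤ S * ‖θ - θ'‖ := by
    refine h1.trans ?_
    rw [hS, Finset.sum_mul]
    refine Finset.sum_le_sum fun l _ => ?_
    have ha := h.psi_sub_mul_nonpos (d.1 l - inner ℝ (d.2 l) θ') (inner ℝ (d.2 l) (θ - θ'))
    have e : d.1 l - inner ℝ (d.2 l) θ' - inner ℝ (d.2 l) (θ - θ') = mResidual ρ g d l := by
      rw [mResidual, inner_sub_right, ← hθ]; ring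
    rw [e] at ha
    have hb : |deriv ρ (d.1 l - inner ℝ (d.2 l) θ') - deriv ρ (mResidual ρ g d' l)| ≤
        |d.1 l - d'.1 l| + ‖d.2 l - d'.2 l‖ * ‖θ'‖ := by
      refine (h.abs_psi_sub_le _ _).trans ?_
      have e2 : d.1 l - inner ℝ (d.2 l) θ' - mResidual ρ g d' l =
          (d.1 l - d'.1 l) - inner ℝ (d.2 l - d'.2 l) θ' := by
        rw [mResidual, inner_sub_left, ← hθ']; ring
      rw [e2]
      exact (abs_sub _ _).trans (add_le_add le_rfl (abs_real_inner_le_norm _ _))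
    have hc := abs_real_inner_le_norm (d.2 l) (θ - θ')
    have hd := abs_real_inner_le_norm (d.2 l - d'.2 l) (θ - θ')
    have e3 : deriv ρ (mResidual ρ g d l) * inner ℝ (d.2 l) (θ - θ') -
        deriv ρ (mResidual ρ g d' l) * inner ℝ (d'.2 l) (θ - θ') =
        (deriv ρ (mResidual ρ g d l) - deriv ρ (d.1 l - inner ℝ (d.2 l) θ')) *
          inner ℝ (d.2 l) (θ - θ') +
        (deriv ρ (d.1 l - inner ℝ (d.2 l) θ') - deriv ρ (mResidual ρ g d' l)) *
          inner ℝ (d.2 l) (θ - θ') +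
        deriv ρ (mResidual ρ g d' l) * inner ℝ (d.2 l - d'.2 l) (θ - θ') := by
      rw [inner_sub_left (d.2 l)]; ring
    rw [e3]
    have he : (deriv ρ (d.1 l - inner ℝ (d.2 l) θ') - deriv ρ (mResidual ρ g d' l)) *
        inner ℝ (d.2 l) (θ - θ') ≤
        (|d.1 l - d'.1 l| + ‖d.2 l - d'.2 l‖ * ‖θ'‖) * (‖d.2 l‖ * ‖θ - θ'‖) := by
      refine (le_abs_self _).trans ?_
      rw [abs_mul]
      exact mul_le_mul hb hc (abs_nonneg _) (by positivity)
    have hf : deriv ρ (mResidual ρ g d' l) * inner ℝ (d.2 l - d'.2 l) (θ - θ') ≤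
        |deriv ρ (mResidual ρ g d' l)| * (‖d.2 l - d'.2 l‖ * ‖θ - θ'‖) := by
      refine (le_abs_self _).trans ?_
      rw [abs_mul]
      exact mul_le_mul_of_nonneg_left hd (abs_nonneg _)
    linarith
  have hS0 : 0 ≤ S := Finset.sum_nonneg fun l _ => by positivity
  rcases eq_or_lt_of_le (norm_nonneg (θ - θ')) with h0 | h0
  · rw [← h0]; simpa using hS0
  · refine le_of_mul_le_mul_right ?_ h0
    linarith

theorem exists_lipschitzOnWith_betaHat (h : WhiteAssumption n μ ρ g) (N : ℝ) :
    ∃ C, LipschitzOnWith C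
      (betaHat ρ g : (Fin n → ℝ) × (Fin n → EuclideanSpace ℝ (Fin p)) → _)
      (Metric.closedBall 0 N) := by
  have hn : (0 : ℝ) < n := by exact_mod_cast h.n_pos
  have hμ := h.mu_pos
  have hnμ : 0 < n * μ := by positivity
  rcases lt_or_ge N 0 with hN | hN
  · refine ⟨0, ?_⟩
    rw [Metric.closedBall_eq_empty.2 hN]
    exact fun x hx => hx.elim
  set θ₀ := betaHat ρ g (0 : (Fin n → ℝ) × (Fin n → EuclideanSpace ℝ (Fin p)))
  have hcoord : ∀ (d : (Fin n → ℝ) × (Fin n → EuclideanSpace ℝ (Fin p))) l,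
      |d.1 l| ≤ ‖d‖ ∧ ‖d.2 l‖ ≤ ‖d‖ := fun d l =>
    ⟨(norm_le_pi_norm d.1 l).trans (norm_fst_le d), (norm_le_pi_norm d.2 l).trans (norm_snd_le d)⟩
  have hr0 : ∀ l, deriv ρ (mResidual ρ g
      (0 : (Fin n → ℝ) × (Fin n → EuclideanSpace ℝ (Fin p))) l) = 0 := fun l => by
    simp [mResidual, h.psi_zero]
  obtain ⟨B, hB0, hB⟩ : ∃ B, 0 ≤ B ∧ ∀ d ∈ Metric.closedBall
      (0 : (Fin n → ℝ) × (Fin n → EuclideanSpace ℝ (Fin p))) N, ‖betaHat ρ g d‖ ≤ B := by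
    refine ⟨‖θ₀‖ + (n * μ)⁻¹ * (n * ((N + N * ‖θ₀‖) * N)), by positivity, fun d hd => ?_⟩
    have hdN : ‖d‖ ≤ N := by simpa using hd
    have h1 := h.norm_betaHat_sub_le d 0
    have h2 : ‖betaHat ρ g d - θ₀‖ ≤ (n * μ)⁻¹ * (n * ((N + N * ‖θ₀‖) * N)) := by
      rw [le_inv_mul_iff₀ hnμ]
      refine h1.trans ?_
      have h3 : ∀ l ∈ Finset.univ, (|d.1 l - (0 : (Fin n → ℝ) ×
          (Fin n → EuclideanSpace ℝ (Fin p))).1 l| + ‖d.2 l - (0 : (Fin n → ℝ) ×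
          (Fin n → EuclideanSpace ℝ (Fin p))).2 l‖ * ‖θ₀‖) * ‖d.2 l‖ +
          |deriv ρ (mResidual ρ g (0 : (Fin n → ℝ) × (Fin n → EuclideanSpace ℝ (Fin p))) l)| *
          ‖d.2 l - (0 : (Fin n → ℝ) × (Fin n → EuclideanSpace ℝ (Fin p))).2 l‖ ≤
          (N + N * ‖θ₀‖) * N := fun l _ => by
        rw [hr0]
        have h4 := (hcoord d l).1.trans hdN
        have h5 := (hcoord d l).2.trans hdN
        simp only [Prod.fst_zero, Prod.snd_zero, Pi.zero_apply, sub_zero, abs_zero, zero_mul,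
          add_zero]
        gcongr
      refine (Finset.sum_le_sum h3).trans ?_
      simp
    calc ‖betaHat ρ g d‖ = ‖θ₀ + (betaHat ρ g d - θ₀)‖ := by congr 1; abel
      _ ≤ ‖θ₀‖ + ‖betaHat ρ g d - θ₀‖ := norm_add_le _ _
      _ ≤ _ := by gcongr
  refine ⟨Real.toNNReal ((n * μ)⁻¹ * (n * ((1 + B) * N + (N + N * B)))),
    LipschitzOnWith.of_dist_le_mul fun d hd d' hd' => ?_⟩
  have hdN : ‖d‖ ≤ N := by simpa using hd
  have hdN' : ‖d'‖ ≤ N := by simpa using hd'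
  rw [Real.coe_toNNReal _ (by positivity), dist_eq_norm, dist_eq_norm, mul_assoc,
    le_inv_mul_iff₀ hnμ]
  refine (h.norm_betaHat_sub_le d d').trans ?_
  have h3 : ∀ l ∈ Finset.univ, (|d.1 l - d'.1 l| + ‖d.2 l - d'.2 l‖ * ‖betaHat ρ g d'‖) * ‖d.2 l‖ +
        |deriv ρ (mResidual ρ g d' l)| * ‖d.2 l - d'.2 l‖ ≤
      ((1 + B) * N + (N + N * B)) * ‖d - d'‖ := fun l _ => by
    have h4 : |d.1 l - d'.1 l| ≤ ‖d - d'‖ := (hcoord (d - d') l).1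
    have h5 : ‖d.2 l - d'.2 l‖ ≤ ‖d - d'‖ := (hcoord (d - d') l).2
    have h6 := (hcoord d l).2.trans hdN
    have h7 : |deriv ρ (mResidual ρ g d' l)| ≤ N + N * B := by
      refine (h.abs_psi_le _).trans ((abs_sub _ _).trans ?_)
      refine add_le_add ((hcoord d' l).1.trans hdN') ((abs_real_inner_le_norm _ _).trans ?_)
      exact mul_le_mul ((hcoord d' l).2.trans hdN') (hB d' hd') (norm_nonneg _) hN
    have h8 := hB d' hd'
    calc (|d.1 l - d'.1 l| + ‖d.2 l - d'.2 l‖ * ‖betaHat ρ g d'‖) * ‖d.2 l‖ +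
          |deriv ρ (mResidual ρ g d' l)| * ‖d.2 l - d'.2 l‖
        ≤ (‖d - d'‖ + ‖d - d'‖ * B) * N + (N + N * B) * ‖d - d'‖ := by gcongr
      _ = _ := by ring
  refine (Finset.sum_le_sum h3).trans ?_
  simp only [Finset.sum_const, Finset.card_univ, Fintype.card_fin, nsmul_eq_mul]
  rw [mul_assoc]

/-- Lebesgue measure on the space of data sets `(y, X)` is a Haar measure. -/
theorem isAddHaarMeasure_volume_data (n p : ℕ) :
    (volume : Measure ((Fin n → ℝ) × (Fin n → EuclideanSpace ℝ (Fin p)))).IsAddHaarMeasure := by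
  have h1 : (volume : Measure (Fin n → ℝ)).IsAddHaarMeasure :=
    inferInstance
  have h2 : (volume : Measure (Fin n → EuclideanSpace ℝ (Fin p))).IsAddHaarMeasure :=
    inferInstanceAs (Measure.pi fun _ : Fin n =>
      (volume : Measure (EuclideanSpace ℝ (Fin p)))).IsAddHaarMeasure
  exact Measure.prod.instIsAddHaarMeasure volume volume

theorem continuous_betaHat (h : WhiteAssumption n μ ρ g) :
    Continuous (betaHat ρ g : (Fin n → ℝ) × (Fin n → EuclideanSpace ℝ (Fin p)) → _) := by
  rw [continuous_iff_continuousAt]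
  intro d
  obtain ⟨C, hC⟩ := h.exists_lipschitzOnWith_betaHat (‖d‖ + 1)
  refine hC.continuousOn.continuousAt ?_
  refine Filter.mem_of_superset (Metric.closedBall_mem_nhds d one_pos) fun x hx => ?_
  rw [mem_closedBall_zero_iff]
  rw [mem_closedBall_iff_norm] at hx
  calc ‖x‖ = ‖d + (x - d)‖ := by congr 1; abel
    _ ≤ ‖d‖ + ‖x - d‖ := norm_add_le _ _
    _ ≤ _ := by gcongr

theorem continuous_mResidual (h : WhiteAssumption n μ ρ g) (i : Fin n) :
    Continuous fun d : (Fin n → ℝ) × (Fin n → EuclideanSpace ℝ (Fin p)) =>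
      mResidual ρ g d i := by
  have := h.continuous_betaHat
  unfold mResidual
  fun_prop

theorem ae_differentiableAt_betaHat (h : WhiteAssumption n μ ρ g) :
    ∀ᵐ d : (Fin n → ℝ) × (Fin n → EuclideanSpace ℝ (Fin p)),
      DifferentiableAt ℝ (betaHat ρ g) d := by
  have h1 : ∀ N : ℕ, ∀ᵐ d : (Fin n → ℝ) × (Fin n → EuclideanSpace ℝ (Fin p)),
      d ∈ Metric.closedBall 0 (N : ℝ) →
        DifferentiableWithinAt ℝ (betaHat ρ g) (Metric.closedBall 0 (N : ℝ)) d := fun N => by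
    obtain ⟨C, hC⟩ := h.exists_lipschitzOnWith_betaHat (N : ℝ)
    have := isAddHaarMeasure_volume_data n p
    exact hC.ae_differentiableWithinAt_of_mem
  filter_upwards [ae_all_iff.2 h1] with d hd
  obtain ⟨N, hN⟩ := exists_nat_gt ‖d‖
  have hball : Metric.ball (0 : (Fin n → ℝ) × (Fin n → EuclideanSpace ℝ (Fin p))) N ∈ 𝓝 d :=
    Metric.isOpen_ball.mem_nhds (by simpa using hN)
  exact (hd N (by simpa using hN.le)).differentiableAt
    (Filter.mem_of_superset hball Metric.ball_subset_closedBall)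

end WhiteAssumption

end

noncomputable section

namespace WhiteAssumption

variable {n p : ℕ} {μ : ℝ} {ρ : ℝ → ℝ} {g : EuclideanSpace ℝ (Fin p) → ℝ}

/-! ### Residuals avoid Lebesgue-null sets -/

/-- With all other data fixed, the response `yᵢ` is a Lipschitz function of the residual `rᵢ`:
the estimator depends on `yᵢ` only through `ψ(rᵢ)`. -/
theorem abs_response_sub_le (h : WhiteAssumption n μ ρ g) (i : Fin n)
    {d d' : (Fin n → ℝ) × (Fin n → EuclideanSpace ℝ (Fin p))}
    (hy : ∀ l, l ≠ i → d.1 l = d'.1 l) (hx : d.2 = d'.2) :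
    |d.1 i - d'.1 i| ≤ (1 + (n * μ)⁻¹ * ‖d.2 i‖ ^ 2) *
      |mResidual ρ g d i - mResidual ρ g d' i| := by
  have hn : (0 : ℝ) < n := by exact_mod_cast h.n_pos
  have hμ := h.mu_pos
  have hnμ : 0 < n * μ := by positivity
  have h1 := h.norm_betaHat_sub_sq_le d d'
  set Δ := betaHat ρ g d - betaHat ρ g d' with hΔ
  have h2 : n * μ * ‖Δ‖ ^ 2 ≤ (deriv ρ (mResidual ρ g d i) - deriv ρ (mResidual ρ g d' i)) *
      inner ℝ (d.2 i) Δ := by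
    refine h1.trans ?_
    rw [← Finset.add_sum_erase _ _ (Finset.mem_univ i), ← hx, sub_mul]
    refine add_le_of_nonpos_right (Finset.sum_nonpos fun l hl => ?_)
    have e : mResidual ρ g d l = mResidual ρ g d' l - inner ℝ (d.2 l) Δ := by
      rw [mResidual, mResidual, hy l (Finset.ne_of_mem_erase hl), hΔ, inner_sub_right, hx]; ring
    have := h.psi_sub_mul_nonpos (mResidual ρ g d' l) (inner ℝ (d.2 l) Δ)
    rw [← e] at this
    linarith
  set δ := |mResidual ρ g d i - mResidual ρ g d' i| with hδ
  have h3 : n * μ * ‖Δ‖ ^ 2 ≤ δ * ‖d.2 i‖ * ‖Δ‖ := by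
    refine h2.trans ((le_abs_self _).trans ?_)
    rw [abs_mul, mul_assoc]
    exact mul_le_mul (h.abs_psi_sub_le _ _) (abs_real_inner_le_norm _ _) (abs_nonneg _)
      (abs_nonneg _)
  have h4 : ‖Δ‖ ≤ (n * μ)⁻¹ * (δ * ‖d.2 i‖) := by
    rw [le_inv_mul_iff₀ hnμ]
    rcases eq_or_lt_of_le (norm_nonneg Δ) with h0 | h0
    · rw [← h0, mul_zero]; positivity
    · refine le_of_mul_le_mul_right ?_ h0
      linarith
  have e : d.1 i - d'.1 i = (mResidual ρ g d i - mResidual ρ g d' i) + inner ℝ (d.2 i) Δ := by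
    rw [mResidual, mResidual, hΔ, inner_sub_right, hx]; ring
  calc |d.1 i - d'.1 i| ≤ δ + ‖d.2 i‖ * ‖Δ‖ := by
        rw [e]
        exact (abs_add_le _ _).trans (add_le_add le_rfl (abs_real_inner_le_norm _ _))
    _ ≤ δ + ‖d.2 i‖ * ((n * μ)⁻¹ * (δ * ‖d.2 i‖)) := by gcongr
    _ = _ := by ring

theorem ae_mResidual_notMem (h : WhiteAssumption n μ ρ g) (i : Fin n) {N : Set ℝ}
    (hN : volume N = 0) :
    ∀ᵐ d : (Fin n → ℝ) × (Fin n → EuclideanSpace ℝ (Fin p)), mResidual ρ g d i ∉ N := by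
  have := isAddHaarMeasure_volume_data n p
  set N' := toMeasurable volume N
  have hN' : volume N' = 0 := by rw [measure_toMeasurable, hN]
  have hmeas : MeasurableSet
      {d : (Fin n → ℝ) × (Fin n → EuclideanSpace ℝ (Fin p)) | mResidual ρ g d i ∉ N'} :=
    (h.continuous_mResidual i).measurable (measurableSet_toMeasurable volume N).compl
  let L : ℝ →ₗ[ℝ] (Fin n → ℝ) × (Fin n → EuclideanSpace ℝ (Fin p)) :=
    (LinearMap.inl ℝ _ _).comp (LinearMap.single ℝ (fun _ : Fin n => ℝ) i)
  have hL : ∀ t, L t = (Pi.single i t, 0) := fun t => rfl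
  -- On each line parallel to the axis of `yᵢ`, the residual is antilipschitz, so that the preimage
  -- of a null set is null.
  have key := ae_mem_of_ae_add_linearMap_mem L volume volume hmeas fun d => by
    have hanti : AntilipschitzWith (Real.toNNReal (1 + (n * μ)⁻¹ * ‖d.2 i‖ ^ 2))
        fun t : ℝ => mResidual ρ g (d + L t) i := by
      refine AntilipschitzWith.of_le_mul_dist fun s t => ?_
      have hμ := h.mu_pos
      rw [Real.coe_toNNReal _ (by positivity), Real.dist_eq, Real.dist_eq]
      have := h.abs_response_sub_le i (d := d + L s) (d' := d + L t)
        (fun l hl => by simp [hL, hl]) (by simp [hL])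
      simpa [hL] using this
    have h1 := hanti.hausdorffMeasure_preimage_le zero_le_one N'
    rw [hausdorffMeasure_real, hN', mul_zero] at h1
    rw [ae_iff]
    simpa [Set.preimage] using h1
  filter_upwards [key] with d hd hmem
  exact hd (subset_toMeasurable volume N hmem)

theorem ae_differentiableAt_psi (h : WhiteAssumption n μ ρ g) :
    ∀ᵐ d : (Fin n → ℝ) × (Fin n → EuclideanSpace ℝ (Fin p)),
      ∀ i, DifferentiableAt ℝ (deriv ρ) (mResidual ρ g d i) := by
  rw [ae_all_iff]
  intro i
  have h1 : volume {t | ¬ DifferentiableAt ℝ (deriv ρ) t} = 0 :=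
    ae_iff.1 h.lipschitzWith_psi.ae_differentiableAt
  filter_upwards [h.ae_mResidual_notMem i h1] with d hd
  simpa using hd

theorem ae_psi_mResidual_ne_zero (h : WhiteAssumption n μ ρ g) :
    ∀ᵐ d : (Fin n → ℝ) × (Fin n → EuclideanSpace ℝ (Fin p)),
      ∀ i, deriv ρ (mResidual ρ g d i) ≠ 0 := by
  rw [ae_all_iff]
  intro i
  filter_upwards [h.ae_mResidual_notMem i (Real.volume_singleton (a := 0))] with d hd
  rw [Ne, h.psi_eq_zero_iff]
  simpa using hd

/-! ### The derivative of the M-estimator -/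

/-- The linearization at `d` of the data-dependent part `∑ ψ(yₗ - ⟪xₗ, θ⟫) xₗ` of the optimality
conditions, for `θ = betaHat ρ g d` held fixed. -/
def scoreDeriv (ρ : ℝ → ℝ) (g : EuclideanSpace ℝ (Fin p) → ℝ)
    (d w : (Fin n → ℝ) × (Fin n → EuclideanSpace ℝ (Fin p))) : EuclideanSpace ℝ (Fin p) :=
  ∑ l, ((deriv (deriv ρ) (mResidual ρ g d l) * (w.1 l - inner ℝ (w.2 l) (betaHat ρ g d))) •
    d.2 l + deriv ρ (mResidual ρ g d l) • w.2 l)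

theorem scoreDeriv_sub
    (d w w' : (Fin n → ℝ) × (Fin n → EuclideanSpace ℝ (Fin p))) :
    scoreDeriv ρ g d (w - w') = scoreDeriv ρ g d w - scoreDeriv ρ g d w' := by
  simp only [scoreDeriv, ← Finset.sum_sub_distrib]
  refine Finset.sum_congr rfl fun l _ => ?_
  simp only [Prod.fst_sub, Prod.snd_sub, Pi.sub_apply, inner_sub_left]
  module

/-- The infinitesimal form of the strong monotonicity of the optimality conditions. -/
theorem norm_fderiv_sq_le (h : WhiteAssumption n μ ρ g)
    {d : (Fin n → ℝ) × (Fin n → EuclideanSpace ℝ (Fin p))}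
    (hd : DifferentiableAt ℝ (betaHat ρ g) d)
    (hψ : ∀ i, DifferentiableAt ℝ (deriv ρ) (mResidual ρ g d i))
    (w : (Fin n → ℝ) × (Fin n → EuclideanSpace ℝ (Fin p))) :
    n * μ * ‖fderiv ℝ (betaHat ρ g) d w‖ ^ 2 ≤
      inner ℝ (scoreDeriv ρ g d w) (fderiv ℝ (betaHat ρ g) d w) := by
  set D := fderiv ℝ (betaHat ρ g) d w with hD
  have hline : HasDerivAt (fun t : ℝ => d + t • w) w 0 := by
    simpa using ((hasDerivAt_id (0 : ℝ)).smul_const w).const_add d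
  have hθ : HasDerivAt (fun t : ℝ => betaHat ρ g (d + t • w)) D 0 := by
    have h1 : HasFDerivAt (betaHat ρ g) (fderiv ℝ (betaHat ρ g) d) (d + (0 : ℝ) • w) := by
      simpa using hd.hasFDerivAt
    exact h1.comp_hasDerivAt (0 : ℝ) hline
  have hy : ∀ l, HasDerivAt (fun t : ℝ => (d + t • w).1 l) (w.1 l) 0 := fun l => by
    simpa using ((hasDerivAt_id (0 : ℝ)).mul_const (w.1 l)).const_add (d.1 l)
  have hx : ∀ l, HasDerivAt (fun t : ℝ => (d + t • w).2 l) (w.2 l) 0 := fun l => by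
    simpa using ((hasDerivAt_id (0 : ℝ)).smul_const (w.2 l)).const_add (d.2 l)
  have hr : ∀ l, HasDerivAt (fun t : ℝ => mResidual ρ g (d + t • w) l)
      (w.1 l - (inner ℝ (d.2 l) D + inner ℝ (w.2 l) (betaHat ρ g d))) 0 := fun l => by
    refine ((hy l).sub ((hx l).inner ℝ hθ)).congr_deriv ?_
    simp
  have hψr : ∀ l, HasDerivAt (fun t : ℝ => deriv ρ (mResidual ρ g (d + t • w) l))
      (deriv (deriv ρ) (mResidual ρ g d l) *
        (w.1 l - (inner ℝ (d.2 l) D + inner ℝ (w.2 l) (betaHat ρ g d)))) 0 := fun l => by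
    have h1 : HasDerivAt (deriv ρ) (deriv (deriv ρ) (mResidual ρ g d l))
        (mResidual ρ g (d + (0 : ℝ) • w) l) := by
      simpa using (hψ l).hasDerivAt
    exact h1.comp (0 : ℝ) (hr l)
  -- the data-dependent part of the optimality conditions, along the line `d + t w`
  have hS : HasDerivAt (fun t : ℝ => ∑ l, deriv ρ (mResidual ρ g (d + t • w) l) • (d + t • w).2 l)
      (scoreDeriv ρ g d w -
        ∑ l, (deriv (deriv ρ) (mResidual ρ g d l) * inner ℝ (d.2 l) D) • d.2 l) 0 := by
    have h1 := HasDerivAt.fun_sum fun l (_ : l ∈ Finset.univ) => (hψr l).smul (hx l)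
    refine h1.congr_deriv ?_
    rw [scoreDeriv, ← Finset.sum_sub_distrib]
    refine Finset.sum_congr rfl fun l _ => ?_
    simp only [zero_smul, add_zero]
    module
  have hlim := le_of_tendsto_of_tendsto
    ((hasDerivAt_iff_tendsto_slope_zero.1 hθ).norm.pow 2 |>.const_mul (n * μ))
    ((hasDerivAt_iff_tendsto_slope_zero.1 hS).inner (hasDerivAt_iff_tendsto_slope_zero.1 hθ)) (by
      filter_upwards with t
      simp only [zero_add, zero_smul, add_zero]
      have h1 := h.norm_betaHat_sub_sq_le (d + t • w) d
      have h2 := mul_le_mul_of_nonneg_left h1 (sq_nonneg t⁻¹)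
      rw [Finset.sum_sub_distrib] at h2
      rw [inner_smul_left, inner_smul_right, norm_smul, inner_sub_left, sum_inner, sum_inner,
        mul_pow, Real.norm_eq_abs, sq_abs]
      simp only [inner_smul_left, conj_trivial]
      linarith)
  refine hlim.trans ?_
  rw [inner_sub_left, sum_inner]
  refine sub_le_self _ (Finset.sum_nonneg fun l _ => ?_)
  rw [inner_smul_left]
  have := h.deriv_psi_nonneg (mResidual ρ g d l)
  simp only [conj_trivial]
  nlinarith [mul_nonneg this (mul_self_nonneg (inner ℝ (d.2 l) D))]

/-- `A` is the linear map that expresses the derivative of the M-estimator at `d` through the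
linearized optimality conditions. The scores `ψ(rᵢ)` are required not to vanish, which makes `A`
unique. -/
structure IsDerivativeOperator (μ : ℝ) (ρ : ℝ → ℝ) (g : EuclideanSpace ℝ (Fin p) → ℝ)
    (d : (Fin n → ℝ) × (Fin n → EuclideanSpace ℝ (Fin p)))
    (A : EuclideanSpace ℝ (Fin p) →L[ℝ] EuclideanSpace ℝ (Fin p)) : Prop where
  differentiableAt : DifferentiableAt ℝ (betaHat ρ g) d
  differentiableAt_psi : ∀ i, DifferentiableAt ℝ (deriv ρ) (mResidual ρ g d i)
  psi_ne_zero : ∀ i, deriv ρ (mResidual ρ g d i) ≠ 0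
  norm_le : ‖A‖ ≤ ((n : ℝ) * μ)⁻¹
  fderiv_eq : ∀ w, fderiv ℝ (betaHat ρ g) d w = A (scoreDeriv ρ g d w)

/-- The linearized score dominates the derivative and is onto `ℝᵖ`, since some score `ψ(rₖ)` does not
vanish; so the derivative factors through it. -/
theorem exists_isDerivativeOperator (h : WhiteAssumption n μ ρ g)
    {d : (Fin n → ℝ) × (Fin n → EuclideanSpace ℝ (Fin p))}
    (hd : DifferentiableAt ℝ (betaHat ρ g) d)
    (hψ : ∀ i, DifferentiableAt ℝ (deriv ρ) (mResidual ρ g d i))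
    (hne : ∀ i, deriv ρ (mResidual ρ g d i) ≠ 0) :
    ∃ A, IsDerivativeOperator μ ρ g d A := by
  have hn : (0 : ℝ) < n := by exact_mod_cast h.n_pos
  have hμ := h.mu_pos
  have hnμ : 0 < n * μ := by positivity
  let k : Fin n := ⟨0, h.n_pos⟩
  set D := fderiv ℝ (betaHat ρ g) d with hD
  have hbound : ∀ w, ‖D w‖ ≤ (n * μ)⁻¹ * ‖scoreDeriv ρ g d w‖ := fun w => by
    have h1 := (h.norm_fderiv_sq_le hd hψ w).trans (real_inner_le_norm _ _)
    rw [le_inv_mul_iff₀ hnμ]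
    rcases eq_or_lt_of_le (norm_nonneg (D w)) with h0 | h0
    · rw [← h0, mul_zero]; positivity
    · refine le_of_mul_le_mul_right ?_ h0
      linarith
  -- a right inverse of `scoreDeriv ρ g d`, moving the observation `k` only
  set c := (deriv ρ (mResidual ρ g d k))⁻¹ with hc
  let s : EuclideanSpace ℝ (Fin p) →ₗ[ℝ] (Fin n → ℝ) × (Fin n → EuclideanSpace ℝ (Fin p)) :=
    LinearMap.prod
      ((LinearMap.single ℝ (fun _ : Fin n => ℝ) k).comp
        (c • (innerₗ (EuclideanSpace ℝ (Fin p)) (betaHat ρ g d))))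
      (c • LinearMap.single ℝ (fun _ : Fin n => EuclideanSpace ℝ (Fin p)) k)
  have hs_apply : ∀ v, s v = (Pi.single k (c * inner ℝ (betaHat ρ g d) v), c • Pi.single k v) :=
    fun v => rfl
  have hs : ∀ v, scoreDeriv ρ g d (s v) = v := fun v => by
    rw [scoreDeriv, Finset.sum_eq_single k]
    · simp only [hs_apply, Pi.smul_apply, Pi.single_eq_same, inner_smul_left, conj_trivial,
        real_inner_comm v, sub_self, mul_zero, zero_smul, zero_add]
      rw [smul_smul, hc, mul_inv_cancel₀ (hne k), one_smul]
    · intro l _ hl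
      simp [hs_apply, hl]
    · simp
  refine ⟨(LinearMap.toContinuousLinearMap (D.toLinearMap.comp s)), hd, hψ, hne, ?_, fun w => ?_⟩
  · refine ContinuousLinearMap.opNorm_le_bound _ (by positivity) fun v => ?_
    have := hbound (s v)
    rwa [hs] at this
  · have h1 : D (w - s (scoreDeriv ρ g d w)) = 0 := by
      have h2 := hbound (w - s (scoreDeriv ρ g d w))
      rw [scoreDeriv_sub, hs, sub_self, norm_zero, mul_zero] at h2
      exact norm_le_zero_iff.1 h2
    rw [map_sub, sub_eq_zero] at h1
    exact h1

theorem ae_exists_isDerivativeOperator (h : WhiteAssumption n μ ρ g) :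
    ∀ᵐ d : (Fin n → ℝ) × (Fin n → EuclideanSpace ℝ (Fin p)),
      ∃ A, IsDerivativeOperator μ ρ g d A := by
  filter_upwards [h.ae_differentiableAt_betaHat, h.ae_differentiableAt_psi,
    h.ae_psi_mResidual_ne_zero] with d h1 h2 h3
  exact h.exists_isDerivativeOperator h1 h2 h3

theorem scoreDeriv_single_left (d : (Fin n → ℝ) × (Fin n → EuclideanSpace ℝ (Fin p)))
    (i : Fin n) (t : ℝ) :
    scoreDeriv ρ g d (Pi.single i t, 0) =
      (deriv (deriv ρ) (mResidual ρ g d i) * t) • d.2 i := by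
  rw [scoreDeriv, Finset.sum_eq_single i]
  · simp
  · intro l _ hl
    simp [hl]
  · simp

theorem scoreDeriv_single_right (d : (Fin n → ℝ) × (Fin n → EuclideanSpace ℝ (Fin p)))
    (i : Fin n) (v : EuclideanSpace ℝ (Fin p)) :
    scoreDeriv ρ g d (0, Pi.single i v) = deriv ρ (mResidual ρ g d i) • v -
      (deriv (deriv ρ) (mResidual ρ g d i) * inner ℝ v (betaHat ρ g d)) • d.2 i := by
  rw [scoreDeriv, Finset.sum_eq_single i]
  · simp
    module
  · intro l _ hl
    simp [hl]
  · simp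

/-! ### Leaving one observation out -/

/-- Replacing the row `xᵢ` by zero removes the observation `i` from the estimation of `β`. The
resulting change of the estimator has the direction of the score of observation `i`. -/
theorem norm_betaHat_sub_update_sq_le (h : WhiteAssumption n μ ρ g) (i : Fin n)
    (d : (Fin n → ℝ) × (Fin n → EuclideanSpace ℝ (Fin p))) :
    n * μ * ‖betaHat ρ g d - betaHat ρ g (d.1, Function.update d.2 i 0)‖ ^ 2 ≤
      deriv ρ (mResidual ρ g d i) *
        inner ℝ (d.2 i) (betaHat ρ g d - betaHat ρ g (d.1, Function.update d.2 i 0)) := by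
  refine (h.norm_betaHat_sub_sq_le d (d.1, Function.update d.2 i 0)).trans ?_
  set d' : (Fin n → ℝ) × (Fin n → EuclideanSpace ℝ (Fin p)) := (d.1, Function.update d.2 i 0)
    with hd'
  set Δ := betaHat ρ g d - betaHat ρ g d' with hΔ
  rw [← Finset.add_sum_erase _ _ (Finset.mem_univ i)]
  have hi : d'.2 i = 0 := by simp [hd']
  rw [hi, inner_zero_left, mul_zero, sub_zero]
  refine add_le_of_nonpos_right (Finset.sum_nonpos fun l hl => ?_)
  have hl' : d'.2 l = d.2 l := by simp [hd', Finset.ne_of_mem_erase hl]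
  have e : mResidual ρ g d l = mResidual ρ g d' l - inner ℝ (d.2 l) Δ := by
    rw [mResidual, mResidual, hl', hΔ, inner_sub_right]; ring
  have := h.psi_sub_mul_nonpos (mResidual ρ g d' l) (inner ℝ (d.2 l) Δ)
  rw [← e] at this
  rw [hl']
  linarith

theorem norm_betaHat_sub_update_le (h : WhiteAssumption n μ ρ g) (i : Fin n)
    (d : (Fin n → ℝ) × (Fin n → EuclideanSpace ℝ (Fin p))) :
    ‖betaHat ρ g d - betaHat ρ g (d.1, Function.update d.2 i 0)‖ ≤
      (n * μ)⁻¹ * (|deriv ρ (mResidual ρ g d i)| * ‖d.2 i‖) := by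
  have hn : (0 : ℝ) < n := by exact_mod_cast h.n_pos
  have hμ := h.mu_pos
  have hnμ : 0 < n * μ := by positivity
  have h1 := h.norm_betaHat_sub_update_sq_le i d
  set Δ := betaHat ρ g d - betaHat ρ g (d.1, Function.update d.2 i 0)
  have h2 : n * μ * ‖Δ‖ ^ 2 ≤ |deriv ρ (mResidual ρ g d i)| * (‖d.2 i‖ * ‖Δ‖) := by
    refine h1.trans ((le_abs_self _).trans ?_)
    rw [abs_mul]
    exact mul_le_mul_of_nonneg_left (abs_real_inner_le_norm _ _) (abs_nonneg _)
  rw [le_inv_mul_iff₀ hnμ]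
  rcases eq_or_lt_of_le (norm_nonneg Δ) with h0 | h0
  · rw [← h0, mul_zero]; positivity
  · refine le_of_mul_le_mul_right ?_ h0
    linarith

/-- The residual shrinks towards zero when its own observation enters the fit, so that its score
is controlled by the leave-one-out prediction. -/
theorem abs_psi_mResidual_le (h : WhiteAssumption n μ ρ g) (i : Fin n)
    (d : (Fin n → ℝ) × (Fin n → EuclideanSpace ℝ (Fin p))) :
    |deriv ρ (mResidual ρ g d i)| ≤ |deriv ρ (d.1 i)| +
      |inner ℝ (d.2 i) (betaHat ρ g (d.1, Function.update d.2 i 0))| := by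
  have hn : (0 : ℝ) < n := by exact_mod_cast h.n_pos
  have hμ := h.mu_pos
  have h1 := h.norm_betaHat_sub_update_sq_le i d
  set θ₀ := betaHat ρ g (d.1, Function.update d.2 i 0)
  set r := mResidual ρ g d i with hr
  set r₀ := d.1 i - inner ℝ (d.2 i) θ₀ with hr₀
  have h2 : 0 ≤ deriv ρ r * inner ℝ (d.2 i) (betaHat ρ g d - θ₀) := le_trans (by positivity) h1
  have e : inner ℝ (d.2 i) (betaHat ρ g d - θ₀) = r₀ - r := by
    rw [hr, mResidual, hr₀, inner_sub_right]; ring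
  rw [e] at h2
  have h3 : |deriv ρ r| ≤ |deriv ρ r₀| := by
    rcases lt_trichotomy (deriv ρ r) 0 with h0 | h0 | h0
    · have h4 : r₀ ≤ r := by nlinarith
      have h5 := h.monotone_psi h4
      rw [abs_of_neg h0, abs_of_neg (by linarith)]
      linarith
    · rw [h0, abs_zero]; exact abs_nonneg _
    · have h4 : r ≤ r₀ := by nlinarith
      have h5 := h.monotone_psi h4
      rw [abs_of_pos h0, abs_of_pos (by linarith)]
      exact h5
  refine h3.trans ?_
  have h4 := h.abs_psi_sub_le r₀ (d.1 i)
  have e2 : r₀ - d.1 i = -inner ℝ (d.2 i) θ₀ := by rw [hr₀]; ring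
  rw [e2, abs_neg] at h4
  calc |deriv ρ r₀| = |deriv ρ (d.1 i) + (deriv ρ r₀ - deriv ρ (d.1 i))| := by congr 1; ring
    _ ≤ _ := (abs_add_le _ _).trans (by gcongr)

theorem abs_psi_mResidual_le' (h : WhiteAssumption n μ ρ g) (i : Fin n)
    (d : (Fin n → ℝ) × (Fin n → EuclideanSpace ℝ (Fin p))) :
    |deriv ρ (mResidual ρ g d i)| ≤ |deriv ρ (d.1 i)| + ‖d.2 i‖ * ‖betaHat ρ g d‖ := by
  have h4 := h.abs_psi_sub_le (mResidual ρ g d i) (d.1 i)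
  have e2 : mResidual ρ g d i - d.1 i = -inner ℝ (d.2 i) (betaHat ρ g d) := by
    rw [mResidual]; ring
  rw [e2, abs_neg] at h4
  calc |deriv ρ (mResidual ρ g d i)|
      = |deriv ρ (d.1 i) + (deriv ρ (mResidual ρ g d i) - deriv ρ (d.1 i))| := by congr 1; ring
    _ ≤ |deriv ρ (d.1 i)| + |deriv ρ (mResidual ρ g d i) - deriv ρ (d.1 i)| := abs_add_le _ _
    _ ≤ _ := by
      gcongr
      exact h4.trans (abs_real_inner_le_norm _ _)

end WhiteAssumption

end

noncomputable section

/-! ### The standard Gaussian density and Gaussian integration by parts -/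

section Density

variable {E : Type*} [NormedAddCommGroup E] [InnerProductSpace ℝ E]

variable (E) in
/-- The normalizing constant `(2π)^{-dim E/2}` of the standard Gaussian density. -/
def gaussianNorm : ℝ := (2 * Real.pi) ^ (-(Module.finrank ℝ E : ℝ) / 2)

variable (E) in
/-- The density of the standard Gaussian distribution. -/
def gaussianDensity (z : E) : ℝ := gaussianNorm E * Real.exp (-‖z‖ ^ 2 / 2)

theorem gaussianNorm_pos : 0 < gaussianNorm E := by
  unfold gaussianNorm
  positivity

theorem gaussianDensity_pos (z : E) : 0 < gaussianDensity E z :=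
  mul_pos gaussianNorm_pos (Real.exp_pos _)

theorem contDiff_gaussianDensity {k : ℕ∞} : ContDiff ℝ k (gaussianDensity E) := by
  unfold gaussianDensity
  have : ContDiff ℝ k fun z : E => ‖z‖ ^ 2 := contDiff_norm_sq ℝ
  fun_prop

theorem fderiv_gaussianDensity (z v : E) :
    fderiv ℝ (gaussianDensity E) z v = -(inner ℝ z v * gaussianDensity E z) := by
  have h1 : HasFDerivAt (fun z : E => -‖z‖ ^ 2 / 2) (-(innerSL ℝ z : E →L[ℝ] ℝ)) z := by
    have h2 := (hasStrictFDerivAt_norm_sq z).hasFDerivAt.const_mul (-(1 / 2) : ℝ)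
    refine (h2.congr_of_eventuallyEq (Filter.Eventually.of_forall fun x => ?_)).congr_fderiv ?_
    · ring
    · ext x
      simp
  have h3 := (h1.exp).const_mul (gaussianNorm E)
  have h4 : gaussianDensity E = fun z => gaussianNorm E * Real.exp (-‖z‖ ^ 2 / 2) := rfl
  rw [h4, h3.fderiv]
  simp
  ring

variable [FiniteDimensional ℝ E] [MeasurableSpace E] [BorelSpace E]

theorem integral_cexp_mul_gaussianDensity (t : E) :
    ∫ z : E, Complex.exp ((inner ℝ z t : ℝ) * Complex.I) * (gaussianDensity E z : ℂ) =
      Complex.exp (-‖t‖ ^ 2 / 2) := by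
  have h := GaussianFourier.integral_cexp_neg_mul_sq_norm_add (V := E) (b := 1 / 2) (by norm_num)
    Complex.I t
  have e : ∀ z : E, Complex.exp ((inner ℝ z t : ℝ) * Complex.I) * (gaussianDensity E z : ℂ) =
      (gaussianNorm E : ℂ) *
        Complex.exp (-(1 / 2) * ‖z‖ ^ 2 + Complex.I * (inner ℝ t z : ℝ)) := fun z => by
    rw [gaussianDensity, Complex.ofReal_mul, Complex.ofReal_exp, mul_left_comm, ← Complex.exp_add,
      real_inner_comm z t]
    congr 2
    push_cast
    ring
  simp_rw [e]
  rw [integral_const_mul]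
  have h' : ∫ v : E, Complex.exp (-(1 / 2) * ‖v‖ ^ 2 + Complex.I * (inner ℝ t v : ℝ)) =
      (Real.pi / (1 / 2) : ℂ) ^ (Module.finrank ℝ E / 2 : ℂ) *
        Complex.exp (Complex.I ^ 2 * ‖t‖ ^ 2 / (4 * (1 / 2))) := by
    simpa using h
  rw [h', ← mul_assoc]
  have e1 : (gaussianNorm E : ℂ) * (Real.pi / (1 / 2) : ℂ) ^ (Module.finrank ℝ E / 2 : ℂ) = 1 := by
    have e2 : (Real.pi / (1 / 2) : ℂ) ^ (Module.finrank ℝ E / 2 : ℂ) =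
        (((2 * Real.pi) ^ ((Module.finrank ℝ E : ℝ) / 2) : ℝ) : ℂ) := by
      rw [Complex.ofReal_cpow (by positivity)]
      push_cast
      congr 1
      ring
    rw [e2, ← Complex.ofReal_mul, gaussianNorm, ← Real.rpow_add (by positivity)]
    have e3 : -(Module.finrank ℝ E : ℝ) / 2 + (Module.finrank ℝ E : ℝ) / 2 = 0 := by ring
    rw [e3, Real.rpow_zero, Complex.ofReal_one]
  rw [e1, one_mul, Complex.I_sq]
  congr 1
  ring

theorem integrable_gaussianDensity : Integrable (gaussianDensity E) := by
  have h := GaussianFourier.integrable_cexp_neg_mul_sq_norm_add (V := E) (b := 1 / 2)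
    (by norm_num) 0 0
  have h2 := h.norm.const_mul (gaussianNorm E)
  refine h2.congr (Filter.Eventually.of_forall fun z => ?_)
  simp only [gaussianDensity, Complex.norm_exp]
  congr 2
  simp [← Complex.ofReal_pow]
  ring

variable (E) in
theorem stdGaussian_eq_withDensity :
    stdGaussian E = volume.withDensity fun z => ENNReal.ofReal (gaussianDensity E z) := by
  have hfin : IsFiniteMeasure (volume.withDensity fun z => ENNReal.ofReal (gaussianDensity E z)) :=
    isFiniteMeasure_withDensity_ofReal integrable_gaussianDensity.2
  refine Measure.ext_of_charFun ?_
  ext t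
  rw [charFun_stdGaussian, charFun_apply, integral_withDensity_eq_integral_toReal_smul
    (contDiff_gaussianDensity (k := 0)).continuous.measurable.ennreal_ofReal
    (by simp), ← integral_cexp_mul_gaussianDensity]
  refine integral_congr_ae (Filter.Eventually.of_forall fun z => ?_)
  simp only [ENNReal.toReal_ofReal (gaussianDensity_pos z).le, Complex.real_smul]
  rw [mul_comm]

theorem stdGaussian_absolutelyContinuous : stdGaussian E ≪ volume := by
  rw [stdGaussian_eq_withDensity]
  exact withDensity_absolutelyContinuous _ _

theorem integral_stdGaussian (f : E → ℝ) :
    ∫ z, f z ∂(stdGaussian E) = ∫ z, gaussianDensity E z * f z := by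
  rw [stdGaussian_eq_withDensity, integral_withDensity_eq_integral_toReal_smul
    (contDiff_gaussianDensity (k := 0)).continuous.measurable.ennreal_ofReal (by simp)]
  simp [ENNReal.toReal_ofReal (gaussianDensity_pos _).le]

/-- Stein's identity: Gaussian integration by parts in the direction `v`. -/
theorem integral_inner_mul_stdGaussian {f : E → ℝ} (hf : ContDiff ℝ 1 f)
    (hc : HasCompactSupport f) (v : E) :
    ∫ z, inner ℝ z v * f z ∂(stdGaussian E) = ∫ z, fderiv ℝ f z v ∂(stdGaussian E) := by
  rw [integral_stdGaussian, integral_stdGaussian]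
  have hφ := contDiff_gaussianDensity (E := E) (k := 1)
  have hφc := hφ.continuous
  have hf' : Continuous fun z => fderiv ℝ f z v := (hf.continuous_fderiv one_ne_zero).clm_apply
    continuous_const
  have hφ' : Continuous fun z => fderiv ℝ (gaussianDensity E) z v :=
    (hφ.continuous_fderiv one_ne_zero).clm_apply continuous_const
  have hc' : HasCompactSupport fun z => fderiv ℝ f z v := hc.fderiv_apply (𝕜 := ℝ) v
  rw [integral_mul_fderiv_eq_neg_fderiv_mul_of_integrable]
  · rw [← integral_neg]
    refine integral_congr_ae (Filter.Eventually.of_forall fun z => ?_)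
    simp only [fderiv_gaussianDensity]
    ring
  · exact (hφ'.mul hf.continuous).integrable_of_hasCompactSupport hc.mul_left
  · exact (hφc.mul hf').integrable_of_hasCompactSupport hc'.mul_left
  · exact (hφc.mul hf.continuous).integrable_of_hasCompactSupport hc.mul_left
  · exact fun z _ => hφ.differentiable one_ne_zero z
  · exact fun z _ => hf.differentiable one_ne_zero z

end Density

end

noncomputable section

/-! ### The second-order Stein inequality -/

section SecondOrderStein

variable {p : ℕ}

/-- The partial derivative `∂ⱼ f`. -/
def partialDeriv (j : Fin p) (f : EuclideanSpace ℝ (Fin p) → ℝ) (z : EuclideanSpace ℝ (Fin p)) :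
    ℝ :=
  fderiv ℝ f z (EuclideanSpace.single j 1)

theorem partialDeriv_mul {f g : EuclideanSpace ℝ (Fin p) → ℝ} (hf : ContDiff ℝ 1 f)
    (hg : ContDiff ℝ 1 g) (j : Fin p) (z : EuclideanSpace ℝ (Fin p)) :
    partialDeriv j (fun x => f x * g x) z =
      partialDeriv j f z * g z + f z * partialDeriv j g z := by
  unfold partialDeriv
  rw [fderiv_fun_mul (hf.differentiable one_ne_zero z) (hg.differentiable one_ne_zero z)]
  simp
  ring

theorem contDiff_partialDeriv {f : EuclideanSpace ℝ (Fin p) → ℝ} (hf : ContDiff ℝ 2 f)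
    (j : Fin p) : ContDiff ℝ 1 (partialDeriv j f) :=
  (hf.fderiv_right (m := 1) (by norm_num)).clm_apply contDiff_const

theorem continuous_partialDeriv {f : EuclideanSpace ℝ (Fin p) → ℝ} (hf : ContDiff ℝ 1 f)
    (j : Fin p) : Continuous (partialDeriv j f) :=
  (hf.continuous_fderiv one_ne_zero).clm_apply continuous_const

theorem hasCompactSupport_partialDeriv {f : EuclideanSpace ℝ (Fin p) → ℝ}
    (hf : HasCompactSupport f) (j : Fin p) : HasCompactSupport (partialDeriv j f) :=
  hf.fderiv_apply (𝕜 := ℝ) _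

theorem partialDeriv_comm {f : EuclideanSpace ℝ (Fin p) → ℝ} (hf : ContDiff ℝ 2 f)
    (j k : Fin p) (z : EuclideanSpace ℝ (Fin p)) :
    partialDeriv j (partialDeriv k f) z = partialDeriv k (partialDeriv j f) z := by
  have hd : DifferentiableAt ℝ (fderiv ℝ f) z :=
    (hf.fderiv_right (m := 1) (by norm_num)).differentiable one_ne_zero z
  have e : ∀ v w : EuclideanSpace ℝ (Fin p),
      fderiv ℝ (fun x => fderiv ℝ f x v) z w = fderiv ℝ (fderiv ℝ f) z w v := fun v w => by
    rw [fderiv_clm_apply hd (differentiableAt_const _)]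
    simp
  have hs : IsSymmSndFDerivAt ℝ f z := hf.contDiffAt.isSymmSndFDerivAt (by simp)
  have h1 : partialDeriv j (partialDeriv k f) z =
      fderiv ℝ (fun x => fderiv ℝ f x (EuclideanSpace.single k 1)) z
        (EuclideanSpace.single j 1) := rfl
  have h2 : partialDeriv k (partialDeriv j f) z =
      fderiv ℝ (fun x => fderiv ℝ f x (EuclideanSpace.single j 1)) z
        (EuclideanSpace.single k 1) := rfl
  rw [h1, h2, e, e, hs.eq]

theorem integral_coord_mul_mul {f g : EuclideanSpace ℝ (Fin p) → ℝ} (hf : ContDiff ℝ 1 f)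
    (hg : ContDiff ℝ 1 g) (hc : HasCompactSupport f) (j : Fin p) :
    ∫ z, z j * (f z * g z) ∂(stdGaussian (EuclideanSpace ℝ (Fin p))) =
      ∫ z, (partialDeriv j f z * g z + f z * partialDeriv j g z)
        ∂(stdGaussian (EuclideanSpace ℝ (Fin p))) := by
  have h := integral_inner_mul_stdGaussian (hf.mul hg) (hc.mul_right (f' := g))
    (EuclideanSpace.single j (1 : ℝ))
  simp only [← partialDeriv_mul hf hg]
  simpa [EuclideanSpace.inner_single_right, partialDeriv] using h

/-- Second-order Stein identity for a smooth vector field with components `f j`. -/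
theorem integral_divergence_sq_eq {f : Fin p → EuclideanSpace ℝ (Fin p) → ℝ}
    (hf : ∀ j, ContDiff ℝ 2 (f j)) (hc : ∀ j, HasCompactSupport (f j)) :
    ∫ z, (∑ j, (z j * f j z - partialDeriv j (f j) z)) ^ 2
        ∂(stdGaussian (EuclideanSpace ℝ (Fin p))) =
      ∫ z, (∑ j, f j z ^ 2 + ∑ j, ∑ k, partialDeriv k (f j) z * partialDeriv j (f k) z)
        ∂(stdGaussian (EuclideanSpace ℝ (Fin p))) := by
  set γ := stdGaussian (EuclideanSpace ℝ (Fin p)) with hγ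
  set u : EuclideanSpace ℝ (Fin p) → ℝ := fun z => ∑ j, (z j * f j z - partialDeriv j (f j) z)
    with hu
  have hf1 : ∀ j, ContDiff ℝ 1 (f j) := fun j => (hf j).of_le (by norm_num)
  have hfc : ∀ j, Continuous (f j) := fun j => (hf j).continuous
  have hP1 : ∀ j k, ContDiff ℝ 1 (partialDeriv j (f k)) := fun j k => contDiff_partialDeriv (hf k) j
  have hPc : ∀ j k, Continuous (partialDeriv j (f k)) := fun j k => (hP1 j k).continuous
  have hPPc : ∀ i j k, Continuous (partialDeriv i (partialDeriv j (f k))) := fun i j k =>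
    continuous_partialDeriv (hP1 j k) i
  have hcoord : ∀ j : Fin p, ContDiff ℝ 1 fun z : EuclideanSpace ℝ (Fin p) => z j := fun j => by
    fun_prop
  have hcoordc : ∀ j : Fin p, Continuous fun z : EuclideanSpace ℝ (Fin p) => z j := fun j =>
    (hcoord j).continuous
  have hu1 : ContDiff ℝ 1 u := ContDiff.sum fun j _ => ((hcoord j).mul (hf1 j)).sub (hP1 j j)
  have hint : ∀ j, ∀ g : EuclideanSpace ℝ (Fin p) → ℝ, Continuous g →
      Integrable (fun z => f j z * g z) γ := fun j g hg =>
    ((hfc j).mul hg).integrable_of_hasCompactSupport (hc j).mul_right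
  have hint' : ∀ j k, ∀ g : EuclideanSpace ℝ (Fin p) → ℝ, Continuous g →
      Integrable (fun z => partialDeriv j (f k) z * g z) γ := fun j k g hg =>
    ((hPc j k).mul hg).integrable_of_hasCompactSupport
      (hasCompactSupport_partialDeriv (hc k) j).mul_right
  have hpu : ∀ j z, partialDeriv j u z = f j z +
      ∑ k, (z k * partialDeriv j (f k) z - partialDeriv k (partialDeriv j (f k)) z) := fun j z => by
    have h1 : partialDeriv j u z =
        ∑ k, (partialDeriv j (fun x => x k * f k x) z -
          partialDeriv j (partialDeriv k (f k)) z) := by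
      unfold partialDeriv
      rw [hu, fderiv_fun_sum (fun k _ => (((hcoord k).mul (hf1 k)).sub (hP1 k k)).differentiable
        one_ne_zero z)]
      rw [_root_.sum_apply]
      refine Finset.sum_congr rfl fun k _ => ?_
      rw [fderiv_fun_sub (((hcoord k).mul (hf1 k)).differentiable one_ne_zero z)
        ((hP1 k k).differentiable one_ne_zero z)]
      rfl
    have h2 : ∀ k, partialDeriv j (fun x : EuclideanSpace ℝ (Fin p) => x k) z =
        if k = j then 1 else 0 := fun k => by
      unfold partialDeriv
      have h3 : HasFDerivAt (fun x : EuclideanSpace ℝ (Fin p) => x k)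
          (EuclideanSpace.proj k : EuclideanSpace ℝ (Fin p) →L[ℝ] ℝ) z :=
        (EuclideanSpace.proj k : EuclideanSpace ℝ (Fin p) →L[ℝ] ℝ).hasFDerivAt
      rw [h3.fderiv]
      simp
    rw [h1]
    simp_rw [partialDeriv_mul (hcoord _) (hf1 _), h2, partialDeriv_comm (hf _) j]
    simp only [ite_mul, one_mul, zero_mul, add_sub_assoc, Finset.sum_add_distrib]
    simp
  -- integration by parts of one factor of `u ^ 2`
  have hA : ∫ z, u z ^ 2 ∂γ = ∑ j, ∫ z, f j z * partialDeriv j u z ∂γ := by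
    have h1 : ∀ z, u z ^ 2 =
        ∑ j, (z j * (f j z * u z) - partialDeriv j (f j) z * u z) := fun z => by
      rw [sq]
      nth_rewrite 1 [hu]
      rw [Finset.sum_mul]
      exact Finset.sum_congr rfl fun j _ => by ring
    have i1 : ∀ j, Integrable (fun z => z j * (f j z * u z)) γ := fun j => by
      refine (hint j (fun z => z j * u z) ((hcoordc j).mul hu1.continuous)).congr
        (Filter.Eventually.of_forall fun z => ?_)
      simp only
      ring
    have i2 : ∀ j, Integrable
        (fun z => z j * (f j z * u z) - partialDeriv j (f j) z * u z) γ := fun j =>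
      (i1 j).sub (hint' j j u hu1.continuous)
    simp_rw [h1]
    rw [integral_finsetSum _ fun j _ => i2 j]
    refine Finset.sum_congr rfl fun j _ => ?_
    rw [integral_sub (i1 j) (hint' j j u hu1.continuous),
      integral_coord_mul_mul (hf1 j) hu1 (hc j), integral_add (hint' j j u hu1.continuous)
      (hint j _ (continuous_partialDeriv hu1 j))]
    ring
  -- integration by parts of the terms `zₖ (∂ⱼ fₖ) fⱼ`, in which the second derivatives cancel
  have hB : ∀ j, ∫ z, f j z * partialDeriv j u z ∂γ = ∫ z, f j z ^ 2 ∂γ +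
      ∑ k, ∫ z, partialDeriv k (f j) z * partialDeriv j (f k) z ∂γ := fun j => by
    have h1 : ∀ z, f j z * partialDeriv j u z = f j z ^ 2 +
        ∑ k, (z k * (f j z * partialDeriv j (f k) z) -
          f j z * partialDeriv k (partialDeriv j (f k)) z) := fun z => by
      rw [hpu, mul_add, sq, Finset.mul_sum]
      congr 1
      exact Finset.sum_congr rfl fun k _ => by ring
    have i0 : Integrable (fun z => f j z ^ 2) γ := by
      simpa only [sq] using hint j _ (hfc j)
    have i1 : ∀ k, Integrable (fun z => z k * (f j z * partialDeriv j (f k) z)) γ := fun k => by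
      refine (hint j (fun z => z k * partialDeriv j (f k) z) ((hcoordc k).mul (hPc j k))).congr
        (Filter.Eventually.of_forall fun z => ?_)
      simp only
      ring
    have i2 : ∀ k, Integrable (fun z => f j z * partialDeriv k (partialDeriv j (f k)) z) γ :=
      fun k => hint j _ (hPPc k j k)
    have i3 : ∀ k, Integrable (fun z => z k * (f j z * partialDeriv j (f k) z) -
        f j z * partialDeriv k (partialDeriv j (f k)) z) γ := fun k => (i1 k).sub (i2 k)
    simp_rw [h1]
    rw [integral_add i0 (integrable_finsetSum _ fun k _ => i3 k),
      integral_finsetSum _ fun k _ => i3 k]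
    congr 1
    refine Finset.sum_congr rfl fun k _ => ?_
    rw [integral_sub (i1 k) (i2 k), integral_coord_mul_mul (hf1 j) (hP1 j k) (hc j),
      integral_add (hint' k j _ (hPc j k)) (i2 k)]
    ring
  have i0 : ∀ j, Integrable (fun z => f j z ^ 2) γ := fun j => by
    simpa only [sq] using hint j _ (hfc j)
  rw [hA]
  simp_rw [hB]
  rw [integral_add (integrable_finsetSum _ fun j _ => i0 j)
    (integrable_finsetSum _ fun j _ => integrable_finsetSum _ fun k _ => hint' k j _ (hPc j k)),
    Finset.sum_add_distrib, integral_finsetSum _ fun j _ => i0 j,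
    integral_finsetSum _ fun j _ => integrable_finsetSum _ fun k _ => hint' k j _ (hPc j k)]
  congr 1
  refine Finset.sum_congr rfl fun j _ => ?_
  rw [integral_finsetSum _ fun k _ => hint' k j _ (hPc j k)]

/-- The Gaussian divergence `⟪z, F z⟫ - div F z` of a vector field. -/
def gaussianDivergence (F : EuclideanSpace ℝ (Fin p) → EuclideanSpace ℝ (Fin p))
    (z : EuclideanSpace ℝ (Fin p)) : ℝ :=
  inner ℝ z (F z) - ∑ j, fderiv ℝ F z (EuclideanSpace.single j 1) j

theorem partialDeriv_component {F : EuclideanSpace ℝ (Fin p) → EuclideanSpace ℝ (Fin p)}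
    {z : EuclideanSpace ℝ (Fin p)} (hF : DifferentiableAt ℝ F z) (j k : Fin p) :
    partialDeriv j (fun x => F x k) z = fderiv ℝ F z (EuclideanSpace.single j 1) k := by
  have h := (EuclideanSpace.proj k : EuclideanSpace ℝ (Fin p) →L[ℝ] ℝ).hasFDerivAt.comp z
    hF.hasFDerivAt
  have h' : HasFDerivAt (fun x => F x k)
    ((EuclideanSpace.proj k : EuclideanSpace ℝ (Fin p) →L[ℝ] ℝ).comp (fderiv ℝ F z)) z := h
  rw [partialDeriv, h'.fderiv]
  rfl

theorem integrable_norm_sq_stdGaussian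
    {G : EuclideanSpace ℝ (Fin p) → EuclideanSpace ℝ (Fin p)} (hG : Continuous G)
    (hc : HasCompactSupport G) :
    Integrable (fun z => ‖G z‖ ^ 2) (stdGaussian (EuclideanSpace ℝ (Fin p))) := by
  have h1 : HasCompactSupport fun z => ‖G z‖ ^ 2 :=
    hc.norm.comp_left (g := fun t : ℝ => t ^ 2) (by simp)
  exact (hG.norm.pow 2).integrable_of_hasCompactSupport h1

theorem integrable_coord_mul_coord_stdGaussian
    {G H : EuclideanSpace ℝ (Fin p) → EuclideanSpace ℝ (Fin p)} (hG : Continuous G)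
    (hH : Continuous H) (hc : HasCompactSupport G) (j k : Fin p) :
    Integrable (fun z => G z j * H z k) (stdGaussian (EuclideanSpace ℝ (Fin p))) := by
  have h1 : HasCompactSupport fun z => G z j :=
    hc.comp_left (g := fun v : EuclideanSpace ℝ (Fin p) => v j) rfl
  have h2 : Continuous fun z => G z j * H z k := by fun_prop
  exact h2.integrable_of_hasCompactSupport h1.mul_right

theorem integral_gaussianDivergence_sq_le_of_contDiff
    {F : EuclideanSpace ℝ (Fin p) → EuclideanSpace ℝ (Fin p)} (hF : ContDiff ℝ 2 F)
    (hc : HasCompactSupport F) :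
    ∫ z, gaussianDivergence F z ^ 2 ∂(stdGaussian (EuclideanSpace ℝ (Fin p))) ≤
      ∫ z, (‖F z‖ ^ 2 + ∑ j, ‖fderiv ℝ F z (EuclideanSpace.single j 1)‖ ^ 2)
        ∂(stdGaussian (EuclideanSpace ℝ (Fin p))) := by
  have hf : ∀ j, ContDiff ℝ 2 fun z => F z j := fun j =>
    (EuclideanSpace.proj j : EuclideanSpace ℝ (Fin p) →L[ℝ] ℝ).contDiff.comp hF
  have hcj : ∀ j, HasCompactSupport fun z => F z j := fun j =>
    hc.comp_left (g := fun v : EuclideanSpace ℝ (Fin p) => v j) rfl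
  have hd : Differentiable ℝ F := hF.differentiable two_ne_zero
  have hF' : ∀ v, Continuous fun z => fderiv ℝ F z v := fun v =>
    (hF.continuous_fderiv two_ne_zero).clm_apply continuous_const
  have h := integral_divergence_sq_eq hf hcj
  have e1 : ∀ z, ∑ j, (z j * F z j - partialDeriv j (fun x => F x j) z) =
      gaussianDivergence F z := fun z => by
    rw [gaussianDivergence, Finset.sum_sub_distrib]
    simp_rw [partialDeriv_component (hd z)]
    congr 1
    simp [PiLp.inner_apply, mul_comm]
  simp_rw [e1] at h
  rw [h]
  have hFc := hF.continuous
  have hF's : ∀ v, HasCompactSupport fun z => fderiv ℝ F z v := fun v => hc.fderiv_apply (𝕜 := ℝ) v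
  simp_rw [partialDeriv_component (hd _)]
  refine integral_mono ?_ ?_ fun z => ?_
  · refine Integrable.add (integrable_finsetSum _ fun j _ => ?_)
      (integrable_finsetSum _ fun j _ => integrable_finsetSum _ fun k _ => ?_)
    · simp_rw [sq]
      exact integrable_coord_mul_coord_stdGaussian hFc hFc hc j j
    · exact integrable_coord_mul_coord_stdGaussian (hF' _) (hF' _) (hF's _) j k
  · refine Integrable.add ?_ (integrable_finsetSum _ fun j _ => ?_)
    · exact integrable_norm_sq_stdGaussian hFc hc
    · exact integrable_norm_sq_stdGaussian (hF' _) (hF's _)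
  · simp only [EuclideanSpace.real_norm_sq_eq]
    refine add_le_add le_rfl ?_
    set a : Fin p → Fin p → ℝ := fun j k => fderiv ℝ F z (EuclideanSpace.single j 1) k
    have h1 : ∀ j k, a k j * a j k ≤ (a k j ^ 2 + a j k ^ 2) / 2 := fun j k => by
      nlinarith [sq_nonneg (a k j - a j k)]
    calc ∑ j, ∑ k, a k j * a j k ≤ ∑ j, ∑ k, (a k j ^ 2 + a j k ^ 2) / 2 :=
          Finset.sum_le_sum fun j _ => Finset.sum_le_sum fun k _ => h1 j k
      _ = (∑ j, ∑ k, a k j ^ 2 + ∑ j, ∑ k, a j k ^ 2) / 2 := by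
          simp only [← Finset.sum_add_distrib, Finset.sum_div]
      _ = ∑ j, ∑ k, a j k ^ 2 := by
          rw [Finset.sum_comm]; ring

end SecondOrderStein

end

noncomputable section

/-! ### Mollification of Lipschitz vector fields -/

section Mollification

open scoped Convolution

variable {E V : Type*} [NormedAddCommGroup E] [InnerProductSpace ℝ E] [FiniteDimensional ℝ E]
  [MeasurableSpace E] [BorelSpace E] [NormedAddCommGroup V] [NormedSpace ℝ V]

theorem norm_normed_convolution_le (φ : ContDiffBump (0 : E)) {G : E → V} {B : ℝ}
    (hB : ∀ x, ‖G x‖ ≤ B) (x : E) :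
    ‖(φ.normed volume ⋆[ContinuousLinearMap.lsmul ℝ ℝ, volume] G : E → V) x‖ ≤ B := by
  rw [convolution_def]
  have h1 : ∫ t, φ.normed volume t * B = B := by
    rw [integral_mul_const, φ.integral_normed, one_mul]
  refine (norm_integral_le_of_norm_le (φ.integrable_normed.mul_const B)
    (Filter.Eventually.of_forall fun t => ?_)).trans h1.le
  rw [ContinuousLinearMap.lsmul_apply, norm_smul, Real.norm_of_nonneg (φ.nonneg_normed t)]
  exact mul_le_mul_of_nonneg_left (hB _) (φ.nonneg_normed t)

/-- The derivative of the mollification of a Lipschitz function is the mollification of its almost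
everywhere defined derivative. -/
theorem hasFDerivAt_normed_convolution [FiniteDimensional ℝ V] (φ : ContDiffBump (0 : E))
    {G : E → V} {L : NNReal} (hG : LipschitzWith L G) (x : E) :
    HasFDerivAt (φ.normed volume ⋆[ContinuousLinearMap.lsmul ℝ ℝ, volume] G : E → V)
      ((φ.normed volume ⋆[ContinuousLinearMap.lsmul ℝ ℝ, volume] (fderiv ℝ G) : E → E →L[ℝ] V) x)
      x := by
  have hφc : Continuous (φ.normed volume) := φ.continuous_normed
  have hmeas : ∀ y, Continuous fun t => φ.normed volume t • G (y - t) := fun y =>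
    hφc.smul (hG.continuous.comp (by fun_prop))
  have hqmp : Measure.QuasiMeasurePreserving (fun t : E => x - t) volume volume :=
    (Measure.measurePreserving_sub_left volume x).quasiMeasurePreserving
  have hdiff : ∀ᵐ t, DifferentiableAt ℝ G (x - t) := hqmp.ae hG.ae_differentiableAt
  have hint : Integrable (fun t => φ.normed volume t • G (x - t)) :=
    (hmeas x).integrable_of_hasCompactSupport φ.hasCompactSupport_normed.smul_right
  have hfm : Measurable fun t => fderiv ℝ G (x - t) :=
    (measurable_fderiv ℝ G).comp (by fun_prop)
  have h := hasFDerivAt_integral_of_dominated_loc_of_lip (μ := (volume : Measure E))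
    (F := fun y t => φ.normed volume t • G (y - t))
    (F' := fun t => φ.normed volume t • fderiv ℝ G (x - t))
    (bound := fun t => φ.normed volume t * L) (x₀ := x) (s := Set.univ) Filter.univ_mem
    (Filter.Eventually.of_forall fun y => (hmeas y).aestronglyMeasurable) hint
    ((hφc.measurable.smul hfm).aestronglyMeasurable)
    (Filter.Eventually.of_forall fun t => by
      rw [lipschitzOnWith_univ]
      refine LipschitzWith.of_dist_le_mul fun y y' => ?_
      rw [dist_smul₀, Real.norm_of_nonneg (φ.nonneg_normed t), Real.coe_nnabs,
        abs_of_nonneg (mul_nonneg (φ.nonneg_normed t) L.coe_nonneg), mul_assoc]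
      refine mul_le_mul_of_nonneg_left ?_ (φ.nonneg_normed t)
      simpa using hG.dist_le_mul (y - t) (y' - t))
    (φ.integrable_normed.mul_const _)
    (by
      filter_upwards [hdiff] with t ht
      have h1 : HasFDerivAt (fun y : E => y - t) (ContinuousLinearMap.id ℝ E) x :=
        (hasFDerivAt_id x).sub_const t
      have h2 := (ht.hasFDerivAt.comp x h1).const_smul (φ.normed volume t)
      exact h2.congr_fderiv (by simp))
  exact h.2

end Mollification

section LipschitzStein

open scoped Convolution

variable {p : ℕ}

theorem abs_gaussianDivergence_le {F : EuclideanSpace ℝ (Fin p) → EuclideanSpace ℝ (Fin p)}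
    {B L : ℝ} {z : EuclideanSpace ℝ (Fin p)} (hB : ‖F z‖ ≤ B) (hL : ‖fderiv ℝ F z‖ ≤ L) :
    |gaussianDivergence F z| ≤ ‖z‖ * B + p * L := by
  rw [gaussianDivergence]
  refine (abs_sub _ _).trans (add_le_add ((abs_real_inner_le_norm _ _).trans (by gcongr)) ?_)
  refine (Finset.abs_sum_le_sum_abs _ _).trans ?_
  have h1 : ∀ j ∈ (Finset.univ : Finset (Fin p)),
      |fderiv ℝ F z (EuclideanSpace.single j 1) j| ≤ L := fun j _ => by
    refine (PiLp.norm_apply_le (fderiv ℝ F z (EuclideanSpace.single j 1)) j).trans ?_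
    refine ((fderiv ℝ F z).le_opNorm _).trans ?_
    simpa using hL
  refine (Finset.sum_le_sum h1).trans ?_
  simp

theorem measurable_gaussianDivergence
    {F : EuclideanSpace ℝ (Fin p) → EuclideanSpace ℝ (Fin p)} (hF : Continuous F) :
    Measurable (gaussianDivergence F) := by
  have h1 : ∀ j, Measurable fun z => fderiv ℝ F z (EuclideanSpace.single j 1) j := fun j => by
    have h2 : Measurable fun z => fderiv ℝ F z (EuclideanSpace.single j 1) :=
      measurable_fderiv_apply_const ℝ F _
    fun_prop
  have h3 : Measurable fun z : EuclideanSpace ℝ (Fin p) => (inner ℝ z (F z) : ℝ) :=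
    (continuous_id.inner hF).measurable
  exact h3.sub (Finset.measurable_sum _ fun j _ => h1 j)

theorem integrable_norm_sq_id_stdGaussian :
    Integrable (fun z : EuclideanSpace ℝ (Fin p) => ‖z‖ ^ 2)
      (stdGaussian (EuclideanSpace ℝ (Fin p))) :=
  (IsGaussian.memLp_two_id
    (μ := stdGaussian (EuclideanSpace ℝ (Fin p)))).integrable_norm_pow two_ne_zero

theorem gaussianDivergence_sq_le {F : EuclideanSpace ℝ (Fin p) → EuclideanSpace ℝ (Fin p)}
    {B L : ℝ} {z : EuclideanSpace ℝ (Fin p)} (hB : ‖F z‖ ≤ B) (hL : ‖fderiv ℝ F z‖ ≤ L) :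
    gaussianDivergence F z ^ 2 ≤ 2 * (B ^ 2 * ‖z‖ ^ 2) + 2 * (p * L) ^ 2 := by
  have h2 := abs_gaussianDivergence_le hB hL
  rw [← sq_abs]
  calc |gaussianDivergence F z| ^ 2 ≤ (‖z‖ * B + p * L) ^ 2 := by gcongr
    _ ≤ _ := by nlinarith [sq_nonneg (‖z‖ * B - p * L)]

theorem integrable_gaussianDivergence_sq
    {F : EuclideanSpace ℝ (Fin p) → EuclideanSpace ℝ (Fin p)} {L : NNReal}
    (hF : LipschitzWith L F) (hc : HasCompactSupport F) :
    Integrable (fun z => gaussianDivergence F z ^ 2) (stdGaussian (EuclideanSpace ℝ (Fin p))) := by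
  obtain ⟨B, hB⟩ := hF.continuous.bounded_above_of_compact_support hc
  refine (((integrable_norm_sq_id_stdGaussian.const_mul (B ^ 2)).const_mul 2).add
    (integrable_const (2 * (p * (L : ℝ)) ^ 2))).mono'
    ((measurable_gaussianDivergence hF.continuous).pow_const 2).aestronglyMeasurable
    (Filter.Eventually.of_forall fun z => ?_)
  rw [Real.norm_of_nonneg (sq_nonneg _)]
  exact gaussianDivergence_sq_le (hB z) (norm_fderiv_le_of_lipschitz ℝ hF)

/-- **Second-order Stein inequality** for Lipschitz vector fields of compact support. -/
theorem integral_gaussianDivergence_sq_le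
    {F : EuclideanSpace ℝ (Fin p) → EuclideanSpace ℝ (Fin p)} {L : NNReal}
    (hF : LipschitzWith L F) (hc : HasCompactSupport F) :
    ∫ z, gaussianDivergence F z ^ 2 ∂(stdGaussian (EuclideanSpace ℝ (Fin p))) ≤
      ∫ z, (‖F z‖ ^ 2 + ∑ j, ‖fderiv ℝ F z (EuclideanSpace.single j 1)‖ ^ 2)
        ∂(stdGaussian (EuclideanSpace ℝ (Fin p))) := by
  set γ := stdGaussian (EuclideanSpace ℝ (Fin p)) with hγ
  obtain ⟨B, hB⟩ := hF.continuous.bounded_above_of_compact_support hc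
  have hB0 : 0 ≤ B := (norm_nonneg _).trans (hB 0)
  have hL : ∀ z, ‖fderiv ℝ F z‖ ≤ L := fun z => norm_fderiv_le_of_lipschitz ℝ hF
  -- The mollifications `G k` of `F` satisfy the bounds of `F` and `DF`; both sides converge by
  -- dominated convergence, as `D(G k) → DF` at the Lebesgue points of `DF`.
  let φ : ℕ → ContDiffBump (0 : EuclideanSpace ℝ (Fin p)) := fun k =>
    ⟨1 / ((k : ℝ) + 1), 2 * (1 / ((k : ℝ) + 1)), by positivity, by
      have : (0 : ℝ) < 1 / ((k : ℝ) + 1) := by positivity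
      linarith⟩
  have hφ : Tendsto (fun k => (φ k).rOut) atTop (𝓝 0) := by
    have := (tendsto_one_div_add_atTop_nhds_zero_nat (𝕜 := ℝ)).const_mul 2
    rw [mul_zero] at this
    exact this
  let G : ℕ → EuclideanSpace ℝ (Fin p) → EuclideanSpace ℝ (Fin p) := fun k =>
    (φ k).normed volume ⋆[ContinuousLinearMap.lsmul ℝ ℝ, volume] F
  have hG' : ∀ k z, fderiv ℝ (G k) z =
      ((φ k).normed volume ⋆[ContinuousLinearMap.lsmul ℝ ℝ, volume] (fderiv ℝ F)) z := fun k z =>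
    (hasFDerivAt_normed_convolution (φ k) hF z).fderiv
  have hGB : ∀ k z, ‖G k z‖ ≤ B := fun k z => norm_normed_convolution_le (φ k) hB z
  have hGL : ∀ k z, ‖fderiv ℝ (G k) z‖ ≤ L := fun k z => by
    rw [hG']
    exact norm_normed_convolution_le (φ k) hL z
  have hGc : ∀ k, HasCompactSupport (G k) := fun k =>
    HasCompactSupport.convolution _ (φ k).hasCompactSupport_normed hc
  have hGs : ∀ k, ContDiff ℝ 2 (G k) := fun k =>
    (φ k).hasCompactSupport_normed.contDiff_convolution_left _ (φ k).contDiff_normed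
      (hF.continuous.locallyIntegrable)
  have hlim : ∀ z, Tendsto (fun k => G k z) atTop (𝓝 (F z)) := fun z =>
    ContDiffBump.convolution_tendsto_right_of_continuous hφ hF.continuous z
  have hfm : Measurable (fderiv ℝ F) := measurable_fderiv ℝ F
  have hli : LocallyIntegrable (fderiv ℝ F) := by
    intro x
    refine ⟨Metric.closedBall x 1, Metric.closedBall_mem_nhds x one_pos, ?_⟩
    exact Measure.integrableOn_of_bounded (M := L)
      (isCompact_closedBall x 1).measure_lt_top.ne hfm.aestronglyMeasurable
      (Filter.Eventually.of_forall hL)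
  have hlim' : ∀ᵐ z ∂γ, Tendsto (fun k => fderiv ℝ (G k) z) atTop (𝓝 (fderiv ℝ F z)) := by
    have h1 := ContDiffBump.ae_convolution_tendsto_right_of_locallyIntegrable (K := 2) hφ
      (Filter.Eventually.of_forall fun k => le_rfl) hli
    filter_upwards [stdGaussian_absolutelyContinuous.ae_le h1] with z hz
    simpa only [hG'] using hz
  have hrhsm : ∀ H : EuclideanSpace ℝ (Fin p) → EuclideanSpace ℝ (Fin p), Continuous H →
      Measurable fun z => ‖H z‖ ^ 2 + ∑ j, ‖fderiv ℝ H z (EuclideanSpace.single j 1)‖ ^ 2 :=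
    fun H hH => by
      refine (hH.norm.pow 2).measurable.add (Finset.measurable_sum _ fun j _ => ?_)
      exact (measurable_fderiv_apply_const ℝ H _).norm.pow_const 2
  have h1 : Tendsto (fun k => ∫ z, gaussianDivergence (G k) z ^ 2 ∂γ) atTop
      (𝓝 (∫ z, gaussianDivergence F z ^ 2 ∂γ)) := by
    refine tendsto_integral_of_dominated_convergence
      (fun z => 2 * (B ^ 2 * ‖z‖ ^ 2) + 2 * (p * L) ^ 2)
      (fun k =>
        ((measurable_gaussianDivergence (hGs k).continuous).pow_const 2).aestronglyMeasurable)
      (((integrable_norm_sq_id_stdGaussian.const_mul _).const_mul _).add (integrable_const _))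
      (fun k => ?_) ?_
    · refine Filter.Eventually.of_forall fun z => ?_
      rw [Real.norm_of_nonneg (sq_nonneg _)]
      exact gaussianDivergence_sq_le (hGB k z) (hGL k z)
    · filter_upwards [hlim'] with z hz
      refine Tendsto.pow ?_ 2
      refine (tendsto_const_nhds.inner (hlim z)).sub (tendsto_finsetSum _ fun j _ => ?_)
      have h4 : Continuous fun T : EuclideanSpace ℝ (Fin p) →L[ℝ] EuclideanSpace ℝ (Fin p) =>
          T (EuclideanSpace.single j 1) j := by fun_prop
      exact (h4.tendsto _).comp hz
  have h2 : Tendsto (fun k => ∫ z, (‖G k z‖ ^ 2 +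
      ∑ j, ‖fderiv ℝ (G k) z (EuclideanSpace.single j 1)‖ ^ 2) ∂γ) atTop
      (𝓝 (∫ z, (‖F z‖ ^ 2 + ∑ j, ‖fderiv ℝ F z (EuclideanSpace.single j 1)‖ ^ 2) ∂γ)) := by
    refine tendsto_integral_of_dominated_convergence (fun _ => B ^ 2 + ∑ _j : Fin p, (L : ℝ) ^ 2)
      (fun k => (hrhsm _ (hGs k).continuous).aestronglyMeasurable)
      (integrable_const _) (fun k => ?_) ?_
    · refine Filter.Eventually.of_forall fun z => ?_
      rw [Real.norm_of_nonneg (by positivity)]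
      have h3 := hGB k z
      refine add_le_add (by gcongr) (Finset.sum_le_sum fun j _ => ?_)
      have h4 : ‖fderiv ℝ (G k) z (EuclideanSpace.single j 1)‖ ≤ L := by
        refine ((fderiv ℝ (G k) z).le_opNorm _).trans ?_
        simpa using hGL k z
      gcongr
    · filter_upwards [hlim'] with z hz
      refine ((hlim z).norm.pow 2).add (tendsto_finsetSum _ fun j _ => ?_)
      have h4 : Continuous fun T : EuclideanSpace ℝ (Fin p) →L[ℝ] EuclideanSpace ℝ (Fin p) =>
          ‖T (EuclideanSpace.single j 1)‖ ^ 2 := by fun_prop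
      exact (h4.tendsto _).comp hz
  exact le_of_tendsto_of_tendsto' h1 h2 fun k =>
    integral_gaussianDivergence_sq_le_of_contDiff (hGs k) (hGc k)

end LipschitzStein

end

noncomputable section

/-! ### Gaussian moments -/

section Moments

variable {p : ℕ}

theorem integrable_inner_sq_stdGaussian (v : EuclideanSpace ℝ (Fin p)) :
    Integrable (fun z : EuclideanSpace ℝ (Fin p) => (inner ℝ z v : ℝ) ^ 2)
      (stdGaussian (EuclideanSpace ℝ (Fin p))) := by
  refine (integrable_norm_sq_id_stdGaussian.mul_const (‖v‖ ^ 2)).mono'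
    (by fun_prop) (Filter.Eventually.of_forall fun z => ?_)
  rw [Real.norm_of_nonneg (sq_nonneg _), ← mul_pow, ← sq_abs]
  have := abs_real_inner_le_norm z v
  gcongr

theorem integral_inner_sq_stdGaussian (v : EuclideanSpace ℝ (Fin p)) :
    ∫ z, (inner ℝ z v : ℝ) ^ 2 ∂(stdGaussian (EuclideanSpace ℝ (Fin p))) = ‖v‖ ^ 2 := by
  have h1 := variance_dual_stdGaussian (innerSL ℝ v : EuclideanSpace ℝ (Fin p) →L[ℝ] ℝ)
  rw [variance_of_integral_eq_zero (innerSL ℝ v).continuous.aemeasurable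
    (integral_strongDual_stdGaussian _), innerSL_apply_norm] at h1
  rw [← h1]
  refine integral_congr_ae (Filter.Eventually.of_forall fun z => ?_)
  simp [real_inner_comm]

theorem integral_norm_sq_stdGaussian :
    ∫ z, ‖z‖ ^ 2 ∂(stdGaussian (EuclideanSpace ℝ (Fin p))) = p := by
  have h1 : ∀ z : EuclideanSpace ℝ (Fin p), ‖z‖ ^ 2 =
      ∑ j, (inner ℝ z (EuclideanSpace.single j (1 : ℝ)) : ℝ) ^ 2 := fun z => by
    simp [EuclideanSpace.real_norm_sq_eq, EuclideanSpace.inner_single_right]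
  simp_rw [h1]
  rw [integral_finsetSum _ fun j _ => integrable_inner_sq_stdGaussian _]
  simp [integral_inner_sq_stdGaussian]

end Moments

/-! ### Truncation of vector fields -/

section Truncation

variable {E : Type*} [NormedAddCommGroup E]

/-- A Lipschitz cutoff function, equal to `1` on the ball of radius `R` and to `0` outside the ball
of radius `2 R`. -/
def cutoff (R : ℝ) (z : E) : ℝ := max 0 (min 1 (2 - R⁻¹ * ‖z‖))

theorem cutoff_nonneg (R : ℝ) (z : E) : 0 ≤ cutoff R z := le_max_left _ _

theorem cutoff_le_one (R : ℝ) (z : E) : cutoff R z ≤ 1 :=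
  max_le zero_le_one (min_le_left _ _)

theorem cutoff_eq_one {R : ℝ} (hR : 0 < R) {z : E} (hz : ‖z‖ ≤ R) : cutoff R z = 1 := by
  have h1 : R⁻¹ * ‖z‖ ≤ 1 := by rwa [inv_mul_le_iff₀ hR, mul_one]
  rw [cutoff, min_eq_left (by linarith), max_eq_right zero_le_one]

theorem cutoff_eq_zero {R : ℝ} (hR : 0 < R) {z : E} (hz : 2 * R ≤ ‖z‖) : cutoff R z = 0 := by
  have h1 : 2 ≤ R⁻¹ * ‖z‖ := by rw [le_inv_mul_iff₀ hR]; linarith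
  rw [cutoff, max_eq_left]
  exact (min_le_right _ _).trans (by linarith)

theorem lipschitzWith_cutoff {R : ℝ} (hR : 0 < R) :
    LipschitzWith (Real.toNNReal R⁻¹) (cutoff R : E → ℝ) := by
  have h1 : LipschitzWith (Real.toNNReal R⁻¹) fun z : E => 2 - R⁻¹ * ‖z‖ := by
    refine LipschitzWith.of_dist_le_mul fun x y => ?_
    rw [Real.coe_toNNReal _ (by positivity), Real.dist_eq, dist_eq_norm]
    have e : 2 - R⁻¹ * ‖x‖ - (2 - R⁻¹ * ‖y‖) = -(R⁻¹ * (‖x‖ - ‖y‖)) := by ring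
    rw [e, abs_neg, abs_mul, abs_of_pos (inv_pos.2 hR)]
    exact mul_le_mul_of_nonneg_left (abs_norm_sub_norm_le x y) (inv_pos.2 hR).le
  exact (h1.const_min 1).const_max 0

variable [NormedSpace ℝ E]

/-- The product of a bounded Lipschitz function that vanishes off `K` and a vector field that is
bounded and Lipschitz on `K`. -/
theorem lipschitzWith_smul_of_lipschitzOnWith {χ : E → ℝ} {f : E → E} {K : Set E} {a b B : NNReal}
    (hχ : LipschitzWith a χ) (hχ1 : ∀ x, |χ x| ≤ 1) (hχ0 : ∀ x, x ∉ K → χ x = 0)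
    (hf : LipschitzOnWith b f K) (hB : ∀ x ∈ K, ‖f x‖ ≤ B) :
    LipschitzWith (a * B + b) fun x => χ x • f x := by
  have key : ∀ x ∈ K, ∀ y, dist (χ x • f x) (χ y • f y) ≤ (a * B + b) * dist x y := by
    intro x hx y
    have h1 : dist (χ x • f x) (χ y • f x) ≤ a * dist x y * B := by
      rw [dist_eq_norm, ← sub_smul, norm_smul, ← dist_eq_norm]
      exact mul_le_mul (hχ.dist_le_mul x y) (hB x hx) (norm_nonneg _) (by positivity)
    have h2 : dist (χ y • f x) (χ y • f y) ≤ b * dist x y := by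
      by_cases hy : y ∈ K
      · rw [dist_eq_norm, ← smul_sub, norm_smul, ← dist_eq_norm (f x)]
        calc ‖χ y‖ * dist (f x) (f y) ≤ 1 * (b * dist x y) :=
              mul_le_mul (hχ1 y) (hf.dist_le_mul x hx y hy) dist_nonneg zero_le_one
          _ = _ := one_mul _
      · rw [hχ0 y hy, zero_smul, zero_smul, dist_self]
        positivity
    calc dist (χ x • f x) (χ y • f y)
        ≤ dist (χ x • f x) (χ y • f x) + dist (χ y • f x) (χ y • f y) := dist_triangle _ _ _
      _ ≤ a * dist x y * B + b * dist x y := add_le_add h1 h2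
      _ = _ := by ring
  refine LipschitzWith.of_dist_le_mul fun x y => ?_
  push_cast
  by_cases hx : x ∈ K
  · exact key x hx y
  · by_cases hy : y ∈ K
    · rw [dist_comm, dist_comm x]
      exact key y hy x
    · rw [hχ0 x hx, hχ0 y hy, zero_smul, zero_smul, dist_self]
      positivity

end Truncation

namespace WhiteAssumption

variable {n p : ℕ} {μ : ℝ} {ρ : ℝ → ℝ} {g : EuclideanSpace ℝ (Fin p) → ℝ}

/-! ### The M-estimator as a function of one row -/

/-- The M-estimator as a function of the row `xᵢ = z`, all other data being those of `d`. -/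
def rowSection (ρ : ℝ → ℝ) (g : EuclideanSpace ℝ (Fin p) → ℝ) (i : Fin n)
    (d : (Fin n → ℝ) × (Fin n → EuclideanSpace ℝ (Fin p))) (z : EuclideanSpace ℝ (Fin p)) :
    EuclideanSpace ℝ (Fin p) :=
  betaHat ρ g (d.1, Function.update d.2 i z)

/-- The change of the M-estimator when the row `xᵢ = 0` is replaced by `xᵢ = z`. -/
def rowIncrement (ρ : ℝ → ℝ) (g : EuclideanSpace ℝ (Fin p) → ℝ) (i : Fin n)
    (d : (Fin n → ℝ) × (Fin n → EuclideanSpace ℝ (Fin p))) (z : EuclideanSpace ℝ (Fin p)) :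
    EuclideanSpace ℝ (Fin p) :=
  rowSection ρ g i d z - rowSection ρ g i d 0

theorem hasFDerivAt_rowSection {i : Fin n}
    {d : (Fin n → ℝ) × (Fin n → EuclideanSpace ℝ (Fin p))} {z : EuclideanSpace ℝ (Fin p)}
    (hd : DifferentiableAt ℝ (betaHat ρ g) (d.1, Function.update d.2 i z)) :
    HasFDerivAt (rowSection ρ g i d)
      ((fderiv ℝ (betaHat ρ g) (d.1, Function.update d.2 i z)).comp
        ((ContinuousLinearMap.inr ℝ (Fin n → ℝ) (Fin n → EuclideanSpace ℝ (Fin p))).comp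
          (ContinuousLinearMap.single ℝ (fun _ : Fin n => EuclideanSpace ℝ (Fin p)) i))) z := by
  have h1 : HasFDerivAt (fun w => (d.1, Function.update d.2 i w))
      ((ContinuousLinearMap.inr ℝ (Fin n → ℝ) (Fin n → EuclideanSpace ℝ (Fin p))).comp
        (ContinuousLinearMap.single ℝ (fun _ : Fin n => EuclideanSpace ℝ (Fin p)) i)) z := by
    have h2 := (hasFDerivAt_const (𝕜 := ℝ) d.1 z).prodMk
      (hasFDerivAt_update (𝕜 := ℝ) d.2 (i := i) z)
    refine h2.congr_fderiv ?_
    refine ContinuousLinearMap.ext fun v => Prod.ext rfl (funext fun l => ?_)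
    rcases eq_or_ne l i with rfl | hl
    · simp
    · simp [hl]
  exact hd.hasFDerivAt.comp z h1

theorem fderiv_rowSection {i : Fin n}
    {d : (Fin n → ℝ) × (Fin n → EuclideanSpace ℝ (Fin p))} {z : EuclideanSpace ℝ (Fin p)}
    (hd : DifferentiableAt ℝ (betaHat ρ g) (d.1, Function.update d.2 i z))
    (v : EuclideanSpace ℝ (Fin p)) :
    fderiv ℝ (rowSection ρ g i d) z v =
      fderiv ℝ (betaHat ρ g) (d.1, Function.update d.2 i z) (0, Pi.single i v) := by
  rw [(hasFDerivAt_rowSection hd).fderiv]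
  rfl

theorem exists_lipschitzOnWith_rowSection (h : WhiteAssumption n μ ρ g) (i : Fin n)
    (d : (Fin n → ℝ) × (Fin n → EuclideanSpace ℝ (Fin p))) (N : ℝ) :
    ∃ C, LipschitzOnWith C (rowSection ρ g i d) (Metric.closedBall 0 N) := by
  obtain ⟨C, hC⟩ := h.exists_lipschitzOnWith_betaHat (‖d‖ + max N 0)
  have h1 : ∀ x y : EuclideanSpace ℝ (Fin p),
      dist (d.1, Function.update d.2 i x) (d.1, Function.update d.2 i y) ≤ dist x y := by
    intro x y
    rw [dist_prod_same_left]
    refine (dist_pi_le_iff dist_nonneg).2 fun l => ?_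
    rcases eq_or_ne l i with rfl | hl
    · simp
    · simp [hl]
  have h2 : ∀ x ∈ Metric.closedBall (0 : EuclideanSpace ℝ (Fin p)) N,
      (d.1, Function.update d.2 i x) ∈ Metric.closedBall
        (0 : (Fin n → ℝ) × (Fin n → EuclideanSpace ℝ (Fin p))) (‖d‖ + max N 0) := by
    intro x hx
    rw [mem_closedBall_zero_iff] at hx ⊢
    rw [Prod.norm_def]
    have hN : 0 ≤ max N 0 := le_max_right _ _
    refine max_le ((norm_fst_le d).trans (by linarith)) ?_
    refine (pi_norm_le_iff_of_nonneg (by positivity)).2 fun l => ?_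
    rcases eq_or_ne l i with rfl | hl
    · simp only [Function.update_self]
      exact hx.trans ((le_max_left _ _).trans (by linarith [norm_nonneg d]))
    · simp only [Function.update_of_ne hl]
      exact ((norm_le_pi_norm d.2 l).trans (norm_snd_le d)).trans (by linarith)
  refine ⟨C, LipschitzOnWith.of_dist_le_mul fun x hx y hy => ?_⟩
  exact (hC.dist_le_mul _ (h2 x hx) _ (h2 y hy)).trans
    (mul_le_mul_of_nonneg_left (h1 x y) C.coe_nonneg)

end WhiteAssumption

end

noncomputable section

namespace WhiteAssumption

variable {n p : ℕ} {μ : ℝ} {ρ : ℝ → ℝ} {g : EuclideanSpace ℝ (Fin p) → ℝ}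

/-! ### The Gaussian divergence of the leave-one-out increment -/

/-- The bound on the score `|ψ(rᵢ)|`, as a function of the row `xᵢ = z`, in terms of the noise and
of the leave-one-out estimator. -/
def scoreBound (ρ : ℝ → ℝ) (g : EuclideanSpace ℝ (Fin p) → ℝ) (i : Fin n)
    (d : (Fin n → ℝ) × (Fin n → EuclideanSpace ℝ (Fin p))) (z : EuclideanSpace ℝ (Fin p)) : ℝ :=
  |deriv ρ (d.1 i)| + |inner ℝ z (rowSection ρ g i d 0)|

theorem scoreBound_nonneg (i : Fin n) (d : (Fin n → ℝ) × (Fin n → EuclideanSpace ℝ (Fin p)))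
    (z : EuclideanSpace ℝ (Fin p)) : 0 ≤ scoreBound ρ g i d z := by
  unfold scoreBound
  positivity

theorem abs_psi_mResidual_update_le (h : WhiteAssumption n μ ρ g) (i : Fin n)
    (d : (Fin n → ℝ) × (Fin n → EuclideanSpace ℝ (Fin p))) (z : EuclideanSpace ℝ (Fin p)) :
    |deriv ρ (mResidual ρ g (d.1, Function.update d.2 i z) i)| ≤ scoreBound ρ g i d z := by
  simpa [scoreBound, rowSection] using h.abs_psi_mResidual_le i (d.1, Function.update d.2 i z)

theorem norm_rowIncrement_le (h : WhiteAssumption n μ ρ g) (i : Fin n)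
    (d : (Fin n → ℝ) × (Fin n → EuclideanSpace ℝ (Fin p))) (z : EuclideanSpace ℝ (Fin p)) :
    ‖rowIncrement ρ g i d z‖ ≤ (n * μ)⁻¹ * (scoreBound ρ g i d z * ‖z‖) := by
  have hμ := h.mu_pos
  have h1 := h.norm_betaHat_sub_update_le i (d.1, Function.update d.2 i z)
  simp only [Function.update_idem, Function.update_self] at h1
  refine h1.trans ?_
  have := h.abs_psi_mResidual_update_le i d z
  gcongr

theorem fderiv_rowSection_eq {i : Fin n}
    {d : (Fin n → ℝ) × (Fin n → EuclideanSpace ℝ (Fin p))} {z : EuclideanSpace ℝ (Fin p)}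
    {A : EuclideanSpace ℝ (Fin p) →L[ℝ] EuclideanSpace ℝ (Fin p)}
    (hA : IsDerivativeOperator μ ρ g (d.1, Function.update d.2 i z) A)
    (v : EuclideanSpace ℝ (Fin p)) :
    fderiv ℝ (rowSection ρ g i d) z v =
      deriv ρ (mResidual ρ g (d.1, Function.update d.2 i z) i) • A v -
      (deriv (deriv ρ) (mResidual ρ g (d.1, Function.update d.2 i z) i) *
        inner ℝ v (rowSection ρ g i d z)) • A z := by
  rw [fderiv_rowSection hA.differentiableAt, hA.fderiv_eq, scoreDeriv_single_right, map_sub,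
    map_smul, map_smul]
  simp [rowSection]

theorem _root_.norm_sub_add_sq_le {E : Type*} [SeminormedAddCommGroup E] (x y w : E) :
    ‖x - y + w‖ ^ 2 ≤ 3 * (‖x‖ ^ 2 + ‖y‖ ^ 2 + ‖w‖ ^ 2) := by
  have h1 : ‖x - y + w‖ ≤ ‖x‖ + ‖y‖ + ‖w‖ :=
    (norm_add_le _ _).trans (by gcongr; exact norm_sub_le _ _)
  calc ‖x - y + w‖ ^ 2 ≤ (‖x‖ + ‖y‖ + ‖w‖) ^ 2 := by gcongr
    _ ≤ _ := by
      nlinarith [sq_nonneg (‖x‖ - ‖y‖), sq_nonneg (‖x‖ - ‖w‖), sq_nonneg (‖y‖ - ‖w‖)]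

/-- The truncated leave-one-out increment. -/
def truncatedIncrement (ρ : ℝ → ℝ) (g : EuclideanSpace ℝ (Fin p) → ℝ) (i : Fin n)
    (d : (Fin n → ℝ) × (Fin n → EuclideanSpace ℝ (Fin p))) (R : ℝ)
    (z : EuclideanSpace ℝ (Fin p)) : EuclideanSpace ℝ (Fin p) :=
  cutoff R z • rowIncrement ρ g i d z

/-- The Jacobian of the increment is a multiple of `A`, whose Frobenius norm is at most
`√p ‖A‖`, plus a matrix of rank one: this is what makes its Frobenius norm of order `n^{-1/2}`. -/
theorem truncatedIncrement_sobolev_le (h : WhiteAssumption n μ ρ g) (i : Fin n)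
    (d : (Fin n → ℝ) × (Fin n → EuclideanSpace ℝ (Fin p))) {R : ℝ} (hR : 0 < R)
    {z : EuclideanSpace ℝ (Fin p)}
    {A : EuclideanSpace ℝ (Fin p) →L[ℝ] EuclideanSpace ℝ (Fin p)}
    (hA : IsDerivativeOperator μ ρ g (d.1, Function.update d.2 i z) A)
    (hχ : DifferentiableAt ℝ (cutoff R) z) :
    ‖truncatedIncrement ρ g i d R z‖ ^ 2 +
      ∑ j, ‖fderiv ℝ (truncatedIncrement ρ g i d R) z (EuclideanSpace.single j 1)‖ ^ 2 ≤
    ((n * μ)⁻¹) ^ 2 * ((4 * R ^ 2 + 3 * p + 12 + 96 * ((n * μ)⁻¹) ^ 2 * R ^ 4) *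
      scoreBound ρ g i d z ^ 2 + 24 * R ^ 2 * ‖rowSection ρ g i d 0‖ ^ 2) := by
  have hμ := h.mu_pos
  have hn : (0 : ℝ) < n := by exact_mod_cast h.n_pos
  set m := (n * μ)⁻¹ with hm
  have hm0 : 0 < m := by positivity
  set a := scoreBound ρ g i d z with ha
  have ha0 : 0 ≤ a := scoreBound_nonneg i d z
  set θ := rowSection ρ g i d z with hθ
  set θ₀ := rowSection ρ g i d 0 with hθ₀
  set Δ := rowIncrement ρ g i d z with hΔ
  have hf : DifferentiableAt ℝ (rowSection ρ g i d) z :=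
    (hasFDerivAt_rowSection hA.differentiableAt).differentiableAt
  have hft : DifferentiableAt ℝ (rowIncrement ρ g i d) z := hf.sub_const _
  have hft' : fderiv ℝ (rowIncrement ρ g i d) z = fderiv ℝ (rowSection ρ g i d) z :=
    fderiv_sub_const _
  have hF' : fderiv ℝ (truncatedIncrement ρ g i d R) z =
      cutoff R z • fderiv ℝ (rowSection ρ g i d) z + (fderiv ℝ (cutoff R) z).smulRight Δ := by
    rw [← hft']
    exact fderiv_fun_smul hχ hft
  rcases le_or_gt ‖z‖ (2 * R) with hz | hz
  · have hΔn : ‖Δ‖ ≤ 2 * m * R * a := by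
      calc ‖Δ‖ ≤ m * (a * ‖z‖) := h.norm_rowIncrement_le i d z
        _ ≤ m * (a * (2 * R)) := by gcongr
        _ = _ := by ring
    have hc0 := cutoff_nonneg R z
    have hc1 := cutoff_le_one R z
    have hθn : ‖θ‖ ^ 2 ≤ 2 * ‖θ₀‖ ^ 2 + 8 * m ^ 2 * R ^ 2 * a ^ 2 := by
      have h1 : ‖θ‖ ≤ ‖θ₀‖ + 2 * m * R * a := by
        have e : θ = θ₀ + Δ := by simp [hΔ, rowIncrement, hθ, hθ₀]
        rw [e]
        exact (norm_add_le _ _).trans (by gcongr)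
      calc ‖θ‖ ^ 2 ≤ (‖θ₀‖ + 2 * m * R * a) ^ 2 := by gcongr
        _ ≤ _ := by nlinarith [sq_nonneg (‖θ₀‖ - 2 * m * R * a)]
    have hF : ‖truncatedIncrement ρ g i d R z‖ ^ 2 ≤ (2 * m * R * a) ^ 2 := by
      have h1 : ‖truncatedIncrement ρ g i d R z‖ ≤ 2 * m * R * a := by
        rw [truncatedIncrement, norm_smul, Real.norm_of_nonneg hc0]
        calc cutoff R z * ‖Δ‖ ≤ 1 * (2 * m * R * a) := by gcongr
          _ = _ := one_mul _
      gcongr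
    have hj : ∀ j : Fin p,
        ‖fderiv ℝ (truncatedIncrement ρ g i d R) z (EuclideanSpace.single j 1)‖ ^ 2 ≤
        3 * ((a * m) ^ 2 + (2 * m * R) ^ 2 * θ j ^ 2 +
          (2 * m * R * a) ^ 2 * ‖fderiv ℝ (cutoff R) z (EuclideanSpace.single j 1)‖ ^ 2) := by
      intro j
      have hψ := h.abs_psi_mResidual_update_le i d z
      have hψ' := h.abs_deriv_psi_le (mResidual ρ g (d.1, Function.update d.2 i z) i)
      rw [hF']
      simp only [add_apply, smul_apply,
        ContinuousLinearMap.smulRight_apply]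
      rw [fderiv_rowSection_eq hA, smul_sub]
      refine (norm_sub_add_sq_le _ _ _).trans ?_
      have b1 : ‖cutoff R z • deriv ρ (mResidual ρ g (d.1, Function.update d.2 i z) i) •
          A (EuclideanSpace.single j 1)‖ ≤ a * m := by
        rw [norm_smul, norm_smul, Real.norm_of_nonneg hc0, Real.norm_eq_abs]
        have h2 : ‖A (EuclideanSpace.single j 1)‖ ≤ m := by
          refine (A.le_opNorm _).trans ?_
          have e : ‖(EuclideanSpace.single j (1 : ℝ) : EuclideanSpace ℝ (Fin p))‖ = 1 := by simp
          rw [e, mul_one]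
          exact hA.norm_le
        calc _ ≤ 1 * (a * m) := by gcongr
          _ = _ := one_mul _
      have b2 : ‖cutoff R z • (deriv (deriv ρ) (mResidual ρ g (d.1, Function.update d.2 i z) i) *
          inner ℝ (EuclideanSpace.single j (1 : ℝ)) θ) • A z‖ ^ 2 ≤ (2 * m * R) ^ 2 * θ j ^ 2 := by
        have h2 : ‖A z‖ ≤ m * (2 * R) := by
          refine (A.le_opNorm _).trans ?_
          have := hA.norm_le
          gcongr
        have h3 : (inner ℝ (EuclideanSpace.single j (1 : ℝ)) θ : ℝ) = θ j := by
          simp [EuclideanSpace.inner_single_left]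
        rw [norm_smul, norm_smul, Real.norm_of_nonneg hc0, Real.norm_eq_abs, abs_mul, h3]
        have h4 : cutoff R z * (|deriv (deriv ρ) (mResidual ρ g (d.1, Function.update d.2 i z) i)| *
            |θ j| * ‖A z‖) ≤ 2 * m * R * |θ j| := by
          calc _ ≤ 1 * (1 * |θ j| * (m * (2 * R))) := by gcongr
            _ = _ := by ring
        calc _ ≤ (2 * m * R * |θ j|) ^ 2 := by gcongr
          _ = _ := by rw [mul_pow, sq_abs]
      have b3 : ‖fderiv ℝ (cutoff R) z (EuclideanSpace.single j 1) • Δ‖ ^ 2 ≤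
          (2 * m * R * a) ^ 2 * ‖fderiv ℝ (cutoff R) z (EuclideanSpace.single j 1)‖ ^ 2 := by
        rw [norm_smul, mul_pow, mul_comm]
        gcongr
      gcongr
    have hχ' : ∑ j : Fin p, ‖fderiv ℝ (cutoff R) z (EuclideanSpace.single j 1)‖ ^ 2 ≤
        (R⁻¹) ^ 2 := by
      have h1 := (EuclideanSpace.basisFun (Fin p) ℝ).norm_dual (fderiv ℝ (cutoff R) z)
      simp only [EuclideanSpace.basisFun_apply] at h1
      simp only [Real.norm_eq_abs, sq_abs]
      rw [← h1]
      have h2 := norm_fderiv_le_of_lipschitz (x₀ := z) ℝ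
        (lipschitzWith_cutoff (E := EuclideanSpace ℝ (Fin p)) hR)
      rw [Real.coe_toNNReal _ (by positivity)] at h2
      gcongr
    have hsum := Finset.sum_le_sum fun j (_ : j ∈ Finset.univ) => hj j
    have e1 : ∑ j, 3 * ((a * m) ^ 2 + (2 * m * R) ^ 2 * θ j ^ 2 +
          (2 * m * R * a) ^ 2 * ‖fderiv ℝ (cutoff R) z (EuclideanSpace.single j 1)‖ ^ 2) =
        3 * (p * (a * m) ^ 2 + (2 * m * R) ^ 2 * ‖θ‖ ^ 2 + (2 * m * R * a) ^ 2 *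
          ∑ j, ‖fderiv ℝ (cutoff R) z (EuclideanSpace.single j 1)‖ ^ 2) := by
      rw [← Finset.mul_sum, Finset.sum_add_distrib, Finset.sum_add_distrib, ← Finset.mul_sum,
        ← Finset.mul_sum, EuclideanSpace.real_norm_sq_eq]
      simp
    rw [e1] at hsum
    have h5 : (2 * m * R * a) ^ 2 *
        ∑ j : Fin p, ‖fderiv ℝ (cutoff R) z (EuclideanSpace.single j 1)‖ ^ 2 ≤
        4 * m ^ 2 * a ^ 2 := by
      calc _ ≤ (2 * m * R * a) ^ 2 * (R⁻¹) ^ 2 := by gcongr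
        _ = _ := by field_simp; ring
    have h6 : (2 * m * R) ^ 2 * ‖θ‖ ^ 2 ≤
        (2 * m * R) ^ 2 * (2 * ‖θ₀‖ ^ 2 + 8 * m ^ 2 * R ^ 2 * a ^ 2) := by gcongr
    calc _ ≤ (2 * m * R * a) ^ 2 + 3 * (p * (a * m) ^ 2 +
          (2 * m * R) ^ 2 * (2 * ‖θ₀‖ ^ 2 + 8 * m ^ 2 * R ^ 2 * a ^ 2) + 4 * m ^ 2 * a ^ 2) := by
          linarith
      _ = _ := by ring
  · have hc : cutoff R z = 0 := cutoff_eq_zero hR hz.le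
    have hc' : fderiv ℝ (cutoff R) z = 0 := by
      refine IsLocalMin.fderiv_eq_zero (Filter.Eventually.of_forall fun x => ?_)
      rw [hc]
      exact cutoff_nonneg R x
    have e1 : truncatedIncrement ρ g i d R z = 0 := by
      rw [truncatedIncrement, hc, zero_smul]
    rw [hF', hc, hc', e1]
    refine le_trans (le_of_eq ?_) (show (0 : ℝ) ≤ _ by positivity)
    simp

theorem exists_lipschitzWith_truncatedIncrement (h : WhiteAssumption n μ ρ g) (i : Fin n)
    (d : (Fin n → ℝ) × (Fin n → EuclideanSpace ℝ (Fin p))) {R : ℝ} (hR : 0 < R) :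
    ∃ C, LipschitzWith C (truncatedIncrement ρ g i d R) := by
  obtain ⟨C, hC⟩ := h.exists_lipschitzOnWith_rowSection i d (2 * R)
  have hC' : LipschitzOnWith C (rowIncrement ρ g i d) (Metric.closedBall 0 (2 * R)) := by
    refine LipschitzOnWith.of_dist_le_mul fun x hx y hy => ?_
    simpa [rowIncrement] using hC.dist_le_mul x hx y hy
  obtain ⟨B, hB⟩ := (isCompact_closedBall (0 : EuclideanSpace ℝ (Fin p))
    (2 * R)).exists_bound_of_continuousOn hC'.continuousOn
  refine ⟨_, lipschitzWith_smul_of_lipschitzOnWith (B := B.toNNReal) (lipschitzWith_cutoff hR)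
    (fun x => ?_) (fun x hx => ?_) hC' fun x hx => (hB x hx).trans (Real.le_coe_toNNReal B)⟩
  · rw [abs_of_nonneg (cutoff_nonneg R x)]
    exact cutoff_le_one R x
  · rw [mem_closedBall_zero_iff, not_le] at hx
    exact cutoff_eq_zero hR hx.le

theorem hasCompactSupport_truncatedIncrement (i : Fin n)
    (d : (Fin n → ℝ) × (Fin n → EuclideanSpace ℝ (Fin p))) {R : ℝ} (hR : 0 < R) :
    HasCompactSupport (truncatedIncrement ρ g i d R) := by
  refine HasCompactSupport.intro (isCompact_closedBall 0 (2 * R)) fun x hx => ?_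
  rw [mem_closedBall_zero_iff, not_le] at hx
  rw [truncatedIncrement, cutoff_eq_zero hR hx.le, zero_smul]

/-- Conditionally on the noise and on the other rows, the Gaussian divergence of the leave-one-out
increment is small: this is Chebyshev's inequality for the second-order Stein inequality. -/
theorem measure_gaussianDivergence_rowIncrement_ge_le (h : WhiteAssumption n μ ρ g) (i : Fin n)
    (d : (Fin n → ℝ) × (Fin n → EuclideanSpace ℝ (Fin p))) {R T : ℝ} (hR : 0 < R) (hT : 0 < T)
    (hs : 0 < |deriv ρ (d.1 i)| + ‖rowSection ρ g i d 0‖)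
    (hA : ∀ᵐ z ∂(stdGaussian (EuclideanSpace ℝ (Fin p))),
      ∃ A, IsDerivativeOperator μ ρ g (d.1, Function.update d.2 i z) A) :
    stdGaussian (EuclideanSpace ℝ (Fin p))
      {z | ‖z‖ < R ∧ T * (|deriv ρ (d.1 i)| + ‖rowSection ρ g i d 0‖) ≤
        |gaussianDivergence (rowIncrement ρ g i d) z|} ≤
    ENNReal.ofReal (((n * μ)⁻¹) ^ 2 * (2 * (4 * R ^ 2 + 3 * p + 12 +
      96 * ((n * μ)⁻¹) ^ 2 * R ^ 4) + 24 * R ^ 2) / T ^ 2) := by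
  set γ := stdGaussian (EuclideanSpace ℝ (Fin p)) with hγ
  set m := (n * μ)⁻¹ with hm
  set F := truncatedIncrement ρ g i d R with hF
  set s := |deriv ρ (d.1 i)| + ‖rowSection ρ g i d 0‖ with hsdef
  set θ₀ := rowSection ρ g i d 0 with hθ₀
  set C := 4 * R ^ 2 + 3 * p + 12 + 96 * m ^ 2 * R ^ 4 with hC
  have hC0 : 0 ≤ C := by positivity
  obtain ⟨L, hL⟩ := h.exists_lipschitzWith_truncatedIncrement i d hR
  have hcs := hasCompactSupport_truncatedIncrement (ρ := ρ) (g := g) i d hR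
  have hstein := integral_gaussianDivergence_sq_le hL hcs
  have hχ : ∀ᵐ z ∂γ, DifferentiableAt ℝ (cutoff R) z :=
    stdGaussian_absolutelyContinuous.ae_le (lipschitzWith_cutoff hR).ae_differentiableAt
  have hint : Integrable (fun z => 2 * |deriv ρ (d.1 i)| ^ 2 + 2 * (inner ℝ z θ₀ : ℝ) ^ 2) γ :=
    (integrable_const _).add ((integrable_inner_sq_stdGaussian θ₀).const_mul 2)
  have hsb : ∀ z, scoreBound ρ g i d z ^ 2 ≤
      2 * |deriv ρ (d.1 i)| ^ 2 + 2 * (inner ℝ z θ₀ : ℝ) ^ 2 := fun z => by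
    rw [scoreBound, ← sq_abs (inner ℝ z θ₀)]
    nlinarith [sq_nonneg (|deriv ρ (d.1 i)| - |inner ℝ z θ₀|)]
  have hbound : ∫ z, (‖F z‖ ^ 2 + ∑ j, ‖fderiv ℝ F z (EuclideanSpace.single j 1)‖ ^ 2) ∂γ ≤
      m ^ 2 * (2 * C + 24 * R ^ 2) * s ^ 2 := by
    have h1 : ∫ z, (‖F z‖ ^ 2 + ∑ j, ‖fderiv ℝ F z (EuclideanSpace.single j 1)‖ ^ 2) ∂γ ≤
        ∫ z, m ^ 2 * (C * (2 * |deriv ρ (d.1 i)| ^ 2 + 2 * (inner ℝ z θ₀ : ℝ) ^ 2) +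
          24 * R ^ 2 * ‖θ₀‖ ^ 2) ∂γ := by
      refine integral_mono_of_nonneg (Filter.Eventually.of_forall fun z => ?_)
        (((hint.const_mul C).add (integrable_const _)).const_mul _) ?_
      · simp only [Pi.zero_apply]
        positivity
      · filter_upwards [hA, hχ] with z hz hz'
        obtain ⟨A, hAz⟩ := hz
        refine (h.truncatedIncrement_sobolev_le i d hR hAz hz').trans ?_
        have := hsb z
        gcongr
    refine h1.trans ?_
    have hI : ∫ z, (2 * |deriv ρ (d.1 i)| ^ 2 + 2 * (inner ℝ z θ₀ : ℝ) ^ 2) ∂γ =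
        2 * |deriv ρ (d.1 i)| ^ 2 + 2 * ‖θ₀‖ ^ 2 := by
      rw [integral_add (integrable_const _)
        ((integrable_inner_sq_stdGaussian θ₀).const_mul 2), integral_const_mul (2 : ℝ)
        fun z : EuclideanSpace ℝ (Fin p) => (inner ℝ z θ₀ : ℝ) ^ 2, integral_inner_sq_stdGaussian]
      simp only [integral_const, probReal_univ, one_smul]
    rw [integral_const_mul, integral_add (hint.const_mul C) (integrable_const _),
      integral_const_mul, hI]
    simp only [integral_const, probReal_univ, one_smul]
    have h2 : |deriv ρ (d.1 i)| ^ 2 + ‖θ₀‖ ^ 2 ≤ s ^ 2 := by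
      rw [hsdef]
      nlinarith [mul_nonneg (abs_nonneg (deriv ρ (d.1 i))) (norm_nonneg θ₀)]
    have h3 : ‖θ₀‖ ^ 2 ≤ s ^ 2 := by nlinarith [sq_nonneg |deriv ρ (d.1 i)|]
    calc _ = m ^ 2 * (2 * C * (|deriv ρ (d.1 i)| ^ 2 + ‖θ₀‖ ^ 2) + 24 * R ^ 2 * ‖θ₀‖ ^ 2) := by
          ring
      _ ≤ m ^ 2 * (2 * C * s ^ 2 + 24 * R ^ 2 * s ^ 2) := by gcongr
      _ = _ := by ring
  have hsub : {z | ‖z‖ < R ∧ T * s ≤ |gaussianDivergence (rowIncrement ρ g i d) z|} ⊆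
      {z | (T * s) ^ 2 ≤ gaussianDivergence F z ^ 2} := by
    rintro z ⟨hz, hz'⟩
    have h1 : F =ᶠ[𝓝 z] rowIncrement ρ g i d := by
      filter_upwards [(isOpen_lt continuous_norm continuous_const).mem_nhds hz] with x hx
      rw [hF, truncatedIncrement, cutoff_eq_one hR (le_of_lt hx), one_smul]
    have h2 : gaussianDivergence F z = gaussianDivergence (rowIncrement ρ g i d) z := by
      rw [gaussianDivergence, gaussianDivergence, h1.fderiv_eq, h1.eq_of_nhds]
    rw [Set.mem_ofPred_eq, h2, ← sq_abs (gaussianDivergence _ z)]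
    gcongr
  refine (measure_mono hsub).trans ?_
  have hTs : 0 < (T * s) ^ 2 := by positivity
  have hmk := mul_meas_ge_le_integral_of_nonneg
    (Filter.Eventually.of_forall fun z => sq_nonneg (gaussianDivergence F z))
    (integrable_gaussianDivergence_sq hL hcs) ((T * s) ^ 2)
  have hreal : γ.real {z | (T * s) ^ 2 ≤ gaussianDivergence F z ^ 2} ≤
      m ^ 2 * (2 * C + 24 * R ^ 2) / T ^ 2 := by
    rw [le_div_iff₀ (by positivity)]
    have h1 := hmk.trans (hstein.trans hbound)
    have h2 : T ^ 2 * γ.real {z | (T * s) ^ 2 ≤ gaussianDivergence F z ^ 2} * s ^ 2 ≤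
        m ^ 2 * (2 * C + 24 * R ^ 2) * s ^ 2 := by
      calc _ = (T * s) ^ 2 * γ.real {z | (T * s) ^ 2 ≤ gaussianDivergence F z ^ 2} := by ring
        _ ≤ _ := h1
    have h3 := le_of_mul_le_mul_right h2 (by positivity)
    linarith
  rw [← ofReal_measureReal]
  exact ENNReal.ofReal_le_ofReal hreal

end WhiteAssumption

end

noncomputable section

/-! ### Product measures: absolute continuity and resampling of one coordinate -/

theorem absolutelyContinuous_pi {n : ℕ} {α : Type*} [MeasurableSpace α] {μ ν : Measure α}
    [SigmaFinite μ] [SigmaFinite ν] (h : μ ≪ ν) :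
    Measure.pi (fun _ : Fin n => μ) ≪ Measure.pi fun _ : Fin n => ν := by
  induction n with
  | zero =>
    rw [Measure.pi_of_empty, Measure.pi_of_empty]
  | succ n ih =>
    have h1 := (measurePreserving_piFinSuccAbove (fun _ : Fin (n + 1) => μ) 0).symm
    have h2 := (measurePreserving_piFinSuccAbove (fun _ : Fin (n + 1) => ν) 0).symm
    rw [← h1.map_eq, ← h2.map_eq]
    exact (h.prod ih).map (MeasurableEquiv.measurable _)

theorem lintegral_pi_eq_lintegral_update {ι α : Type*} [Fintype ι] [DecidableEq ι]
    [MeasurableSpace α] {ν : Measure α} [IsProbabilityMeasure ν] (i : ι) {F : (ι → α) → ENNReal}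
    (hF : Measurable F) :
    ∫⁻ x, F x ∂(Measure.pi fun _ => ν) =
      ∫⁻ x, ∫⁻ z, F (Function.update x i z) ∂ν ∂(Measure.pi fun _ => ν) := by
  have hm : Measurable fun x : ι → α => ∫⁻ z, F (Function.update x i z) ∂ν := by
    refine Measurable.lintegral_prod_right' (f := fun q : (ι → α) × α =>
      F (Function.update q.1 i q.2)) ?_
    exact hF.comp measurable_update'
  refine lintegral_eq_of_lmarginal_eq {i} hF hm ?_
  rw [lmarginal_singleton, lmarginal_singleton]
  funext x
  simp

section Resampling

variable {n p : ℕ}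

/-- The law of whitened data: noise with law `ν`, and independent standard Gaussian rows. -/
def whiteLaw (p : ℕ) (ν : Measure (Fin n → ℝ)) :
    Measure ((Fin n → ℝ) × (Fin n → EuclideanSpace ℝ (Fin p))) :=
  ν.prod (Measure.pi fun _ => stdGaussian (EuclideanSpace ℝ (Fin p)))

variable {ν : Measure (Fin n → ℝ)}

instance isProbabilityMeasure_whiteLaw [IsProbabilityMeasure ν] :
    IsProbabilityMeasure (whiteLaw p ν) := by
  unfold whiteLaw
  infer_instance

theorem whiteLaw_absolutelyContinuous (hν : ν ≪ volume) : whiteLaw p ν ≪ volume :=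
  hν.prod (absolutelyContinuous_pi stdGaussian_absolutelyContinuous)

theorem measurable_updateRow (i : Fin n) :
    Measurable fun q : ((Fin n → ℝ) × (Fin n → EuclideanSpace ℝ (Fin p))) ×
      EuclideanSpace ℝ (Fin p) => (q.1.1, Function.update q.1.2 i q.2) := by
  refine (measurable_fst.comp measurable_fst).prodMk ?_
  exact measurable_update'.comp ((measurable_snd.comp measurable_fst).prodMk measurable_snd)

theorem lintegral_whiteLaw_eq_lintegral_update (i : Fin n)
    {F : (Fin n → ℝ) × (Fin n → EuclideanSpace ℝ (Fin p)) → ENNReal} (hF : Measurable F) :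
    ∫⁻ d, F d ∂(whiteLaw p ν) =
      ∫⁻ d, ∫⁻ z, F (d.1, Function.update d.2 i z) ∂(stdGaussian (EuclideanSpace ℝ (Fin p)))
        ∂(whiteLaw p ν) := by
  have hm : Measurable fun d : (Fin n → ℝ) × (Fin n → EuclideanSpace ℝ (Fin p)) =>
      ∫⁻ z, F (d.1, Function.update d.2 i z) ∂(stdGaussian (EuclideanSpace ℝ (Fin p))) :=
    Measurable.lintegral_prod_right' (f := fun q : ((Fin n → ℝ) ×
      (Fin n → EuclideanSpace ℝ (Fin p))) × EuclideanSpace ℝ (Fin p) =>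
        F (q.1.1, Function.update q.1.2 i q.2)) (hF.comp (measurable_updateRow i))
  rw [whiteLaw, lintegral_prod _ hF.aemeasurable, lintegral_prod _ hm.aemeasurable]
  refine lintegral_congr fun e => ?_
  exact lintegral_pi_eq_lintegral_update i (hF.comp measurable_prodMk_left)

theorem whiteLaw_apply_eq_lintegral_update (i : Fin n)
    {s : Set ((Fin n → ℝ) × (Fin n → EuclideanSpace ℝ (Fin p)))} (hs : MeasurableSet s) :
    whiteLaw p ν s = ∫⁻ d, stdGaussian (EuclideanSpace ℝ (Fin p))
      {z | (d.1, Function.update d.2 i z) ∈ s} ∂(whiteLaw p ν) := by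
  have h1 := lintegral_whiteLaw_eq_lintegral_update (p := p) (ν := ν) i
    (measurable_one.indicator hs)
  rw [lintegral_indicator_one hs] at h1
  rw [h1]
  refine lintegral_congr fun d => ?_
  have hm : Measurable fun z : EuclideanSpace ℝ (Fin p) => (d.1, Function.update d.2 i z) :=
    (measurable_updateRow i).comp measurable_prodMk_left
  exact lintegral_indicator_one (hm hs)

theorem ae_ae_update_of_ae_whiteLaw (i : Fin n)
    {P : (Fin n → ℝ) × (Fin n → EuclideanSpace ℝ (Fin p)) → Prop}
    (hP : ∀ᵐ d ∂(whiteLaw p ν), P d) :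
    ∀ᵐ d ∂(whiteLaw p ν), ∀ᵐ z ∂(stdGaussian (EuclideanSpace ℝ (Fin p))),
      P (d.1, Function.update d.2 i z) := by
  set N := toMeasurable (whiteLaw p ν) {d | ¬ P d}
  have hN : whiteLaw p ν N = 0 := by rw [measure_toMeasurable]; exact hP
  have hNm : MeasurableSet N := measurableSet_toMeasurable _ _
  rw [whiteLaw_apply_eq_lintegral_update i hNm] at hN
  have hm : Measurable fun d : (Fin n → ℝ) × (Fin n → EuclideanSpace ℝ (Fin p)) =>
      stdGaussian (EuclideanSpace ℝ (Fin p)) {z | (d.1, Function.update d.2 i z) ∈ N} :=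
    measurable_measure_prodMk_left (measurable_updateRow i hNm)
  rw [lintegral_eq_zero_iff hm] at hN
  filter_upwards [hN] with d hd
  refine measure_mono_null (fun z hz => ?_) hd
  exact subset_toMeasurable _ _ hz

/-- The row `xᵢ` is standard Gaussian under `whiteLaw`. -/
theorem whiteLaw_row_apply [IsProbabilityMeasure ν] (i : Fin n) {s : Set (EuclideanSpace ℝ (Fin p))}
    (hs : MeasurableSet s) :
    whiteLaw p ν {d | d.2 i ∈ s} = stdGaussian (EuclideanSpace ℝ (Fin p)) s := by
  have hm : MeasurableSet {d : (Fin n → ℝ) × (Fin n → EuclideanSpace ℝ (Fin p)) | d.2 i ∈ s} :=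
    ((measurable_pi_apply i).comp measurable_snd) hs
  rw [whiteLaw_apply_eq_lintegral_update i hm]
  simp

end Resampling

end

noncomputable section

/-! ### The approximating normal variable and the remainder -/

namespace WhiteAssumption

variable {n p : ℕ} {μ : ℝ} {ρ : ℝ → ℝ} {g : EuclideanSpace ℝ (Fin p) → ℝ}

/-- The approximating normal variable: minus the projection of `xᵢ` onto the direction of the
leave-one-out estimator, or the auxiliary normal variable `q.2` if that estimator vanishes. -/
def rowNormal (ρ : ℝ → ℝ) (g : EuclideanSpace ℝ (Fin p) → ℝ) (i : Fin n)
    (q : ((Fin n → ℝ) × (Fin n → EuclideanSpace ℝ (Fin p))) × ℝ) : ℝ :=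
  if rowSection ρ g i q.1 0 = 0 then q.2
  else -(inner ℝ (q.1.2 i) (rowSection ρ g i q.1 0)) / ‖rowSection ρ g i q.1 0‖

/-- The Gaussian divergence of the leave-one-out increment at the row `xᵢ`, expressed through the
partial derivatives of the M-estimator. -/
def rowDivergence (ρ : ℝ → ℝ) (g : EuclideanSpace ℝ (Fin p) → ℝ) (i : Fin n)
    (d : (Fin n → ℝ) × (Fin n → EuclideanSpace ℝ (Fin p))) : ℝ :=
  inner ℝ (d.2 i) (betaHat ρ g d - rowSection ρ g i d 0) -
    ∑ j, fderiv ℝ (betaHat ρ g) d (0, Pi.single i (EuclideanSpace.single j 1)) j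

/-- The adjusted residual `rᵢ + tr(A) ψ(rᵢ)`, expressed through the partial derivatives of the
M-estimator so that it is measurable without a choice of `A`. -/
def whiteAdjusted (ρ : ℝ → ℝ) (g : EuclideanSpace ℝ (Fin p) → ℝ) (i : Fin n)
    (d : (Fin n → ℝ) × (Fin n → EuclideanSpace ℝ (Fin p))) : ℝ :=
  mResidual ρ g d i +
    ∑ j, fderiv ℝ (betaHat ρ g) d (0, Pi.single i (EuclideanSpace.single j 1)) j +
    inner ℝ (fderiv ℝ (betaHat ρ g) d (Pi.single i 1, 0)) (betaHat ρ g d)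

/-- The error of the normal approximation of the adjusted residual. -/
def whiteError (ρ : ℝ → ℝ) (g : EuclideanSpace ℝ (Fin p) → ℝ) (i : Fin n)
    (q : ((Fin n → ℝ) × (Fin n → EuclideanSpace ℝ (Fin p))) × ℝ) : ℝ :=
  whiteAdjusted ρ g i q.1 - (q.1.1 i + ‖betaHat ρ g q.1‖ * rowNormal ρ g i q)

/-- The error of the normal approximation, relative to `|ψ(εᵢ)| + ‖β̂‖`. -/
def relativeError (ρ : ℝ → ℝ) (g : EuclideanSpace ℝ (Fin p) → ℝ) (i : Fin n)
    (q : ((Fin n → ℝ) × (Fin n → EuclideanSpace ℝ (Fin p))) × ℝ) : ℝ :=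
  whiteError ρ g i q / (|deriv ρ (q.1.1 i)| + ‖betaHat ρ g q.1‖)

theorem rowSection_update (i : Fin n) (d : (Fin n → ℝ) × (Fin n → EuclideanSpace ℝ (Fin p)))
    (z w : EuclideanSpace ℝ (Fin p)) :
    rowSection ρ g i (d.1, Function.update d.2 i z) w = rowSection ρ g i d w := by
  simp [rowSection]

theorem whiteAdjusted_eq {i : Fin n} {d : (Fin n → ℝ) × (Fin n → EuclideanSpace ℝ (Fin p))}
    {A : EuclideanSpace ℝ (Fin p) →L[ℝ] EuclideanSpace ℝ (Fin p)}
    (hA : IsDerivativeOperator μ ρ g d A) :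
    whiteAdjusted ρ g i d = mResidual ρ g d i +
      (∑ j, A (EuclideanSpace.single j 1) j) * deriv ρ (mResidual ρ g d i) := by
  have h1 : (inner ℝ (A (d.2 i)) (betaHat ρ g d) : ℝ) =
      ∑ j, inner ℝ (EuclideanSpace.single j (1 : ℝ)) (betaHat ρ g d) * A (d.2 i) j := by
    simp [PiLp.inner_apply]
  simp only [whiteAdjusted, hA.fderiv_eq, scoreDeriv_single_right, scoreDeriv_single_left, map_sub,
    map_smul, mul_one, inner_smul_left, h1, PiLp.sub_apply, PiLp.smul_apply, smul_eq_mul,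
    Finset.sum_sub_distrib, ← Finset.mul_sum, mul_assoc]
  simp only [conj_trivial]
  ring

theorem norm_mul_rowNormal (i : Fin n)
    (q : ((Fin n → ℝ) × (Fin n → EuclideanSpace ℝ (Fin p))) × ℝ) :
    ‖rowSection ρ g i q.1 0‖ * rowNormal ρ g i q =
      -inner ℝ (q.1.2 i) (rowSection ρ g i q.1 0) := by
  unfold rowNormal
  split_ifs with h
  · simp [h]
  · rw [mul_div_cancel₀]
    exact norm_ne_zero_iff.2 h

theorem whiteError_eq (i : Fin n)
    (q : ((Fin n → ℝ) × (Fin n → EuclideanSpace ℝ (Fin p))) × ℝ) :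
    whiteError ρ g i q =
      (‖rowSection ρ g i q.1 0‖ - ‖betaHat ρ g q.1‖) * rowNormal ρ g i q - rowDivergence ρ g i q.1 +
      inner ℝ (fderiv ℝ (betaHat ρ g) q.1 (Pi.single i 1, 0)) (betaHat ρ g q.1) := by
  rw [sub_mul, norm_mul_rowNormal, whiteError, whiteAdjusted, rowDivergence, mResidual,
    inner_sub_right]
  ring

/-- The error is small on the event where `xᵢ` is not too long, the normal variable is not too
large, and the Gaussian divergence is small relative to its scale. -/
theorem abs_whiteError_le (h : WhiteAssumption n μ ρ g) (i : Fin n)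
    {q : ((Fin n → ℝ) × (Fin n → EuclideanSpace ℝ (Fin p))) × ℝ}
    {A : EuclideanSpace ℝ (Fin p) →L[ℝ] EuclideanSpace ℝ (Fin p)}
    (hA : IsDerivativeOperator μ ρ g q.1 A) {R k T : ℝ} (hT : 0 ≤ T)
    (hR : ‖q.1.2 i‖ ≤ R) (hk : |rowNormal ρ g i q| ≤ k)
    (hg : |rowDivergence ρ g i q.1| ≤ T * (|deriv ρ (q.1.1 i)| + ‖rowSection ρ g i q.1 0‖)) :
    |whiteError ρ g i q| ≤
      ((k * ((n * μ)⁻¹ * (1 + k) * R) + T) * (1 + (n * μ)⁻¹ * R + (n * μ)⁻¹ * R ^ 2) +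
        (n * μ)⁻¹ * R) * (|deriv ρ (q.1.1 i)| + ‖betaHat ρ g q.1‖) := by
  have hμ := h.mu_pos
  set m := (n * μ)⁻¹ with hm
  have hm0 : 0 ≤ m := by positivity
  have hR0 : 0 ≤ R := (norm_nonneg _).trans hR
  have hk0 : 0 ≤ k := (abs_nonneg _).trans hk
  set θ := betaHat ρ g q.1 with hθ
  set θ₀ := rowSection ρ g i q.1 0 with hθ₀
  set e := |deriv ρ (q.1.1 i)| with he
  set ψ := |deriv ρ (mResidual ρ g q.1 i)| with hψ
  have he0 : 0 ≤ e := abs_nonneg _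
  have hψ0 : 0 ≤ ψ := abs_nonneg _
  have h1 : ‖θ - θ₀‖ ≤ m * (ψ * R) := by
    refine (h.norm_betaHat_sub_update_le i q.1).trans ?_
    gcongr
  have h2 : ψ ≤ (1 + k) * (e + ‖θ₀‖) := by
    have a1 : ψ ≤ e + |inner ℝ (q.1.2 i) θ₀| := h.abs_psi_mResidual_le i q.1
    have a2 : |(inner ℝ (q.1.2 i) θ₀ : ℝ)| ≤ ‖θ₀‖ * k := by
      rw [← abs_neg, ← norm_mul_rowNormal, abs_mul, abs_norm]
      gcongr
    nlinarith [mul_nonneg hk0 he0, norm_nonneg θ₀]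
  have h3 : ψ ≤ e + R * ‖θ‖ := by
    refine (h.abs_psi_mResidual_le' i q.1).trans ?_
    gcongr
  have h4 : e + ‖θ₀‖ ≤ (1 + m * R + m * R ^ 2) * (e + ‖θ‖) := by
    have a1 : ‖θ₀‖ ≤ ‖θ‖ + m * (ψ * R) := by
      have := norm_sub_norm_le θ₀ θ
      rw [norm_sub_rev] at this
      linarith
    have a2 : m * (ψ * R) ≤ m * ((e + R * ‖θ‖) * R) := by gcongr
    have a3 : 0 ≤ m * R * ‖θ‖ := by positivity
    have a4 : 0 ≤ m * R ^ 2 * e := by positivity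
    linarith
  have h5 : |(‖θ₀‖ - ‖θ‖) * rowNormal ρ g i q| ≤ k * (m * (1 + k) * R) * (e + ‖θ₀‖) := by
    rw [abs_mul]
    have a1 : |‖θ₀‖ - ‖θ‖| ≤ m * (ψ * R) := by
      refine (abs_norm_sub_norm_le _ _).trans ?_
      rwa [norm_sub_rev]
    calc |‖θ₀‖ - ‖θ‖| * |rowNormal ρ g i q| ≤ m * ((1 + k) * (e + ‖θ₀‖) * R) * k := by
          refine mul_le_mul (a1.trans ?_) hk (abs_nonneg _) (by positivity)
          gcongr
      _ = _ := by ring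
  have h6 : |(inner ℝ (fderiv ℝ (betaHat ρ g) q.1 (Pi.single i 1, 0)) θ : ℝ)| ≤
      m * R * ‖θ‖ := by
    rw [hA.fderiv_eq, scoreDeriv_single_left, map_smul, mul_one]
    refine (abs_real_inner_le_norm _ _).trans ?_
    rw [norm_smul, Real.norm_eq_abs]
    have a1 := h.abs_deriv_psi_le (mResidual ρ g q.1 i)
    have a2 : ‖A (q.1.2 i)‖ ≤ m * R := by
      refine (A.le_opNorm _).trans ?_
      have := hA.norm_le
      gcongr
    calc _ ≤ 1 * (m * R) * ‖θ‖ := by gcongr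
      _ = _ := by ring
  rw [whiteError_eq]
  calc _ ≤ |(‖θ₀‖ - ‖θ‖) * rowNormal ρ g i q| + |rowDivergence ρ g i q.1| +
        |(inner ℝ (fderiv ℝ (betaHat ρ g) q.1 (Pi.single i 1, 0)) θ : ℝ)| :=
        (abs_add_le _ _).trans (by gcongr; exact abs_sub _ _)
    _ ≤ k * (m * (1 + k) * R) * (e + ‖θ₀‖) + T * (e + ‖θ₀‖) + m * R * ‖θ‖ := by gcongr
    _ = (k * (m * (1 + k) * R) + T) * (e + ‖θ₀‖) + m * R * ‖θ‖ := by ring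
    _ ≤ (k * (m * (1 + k) * R) + T) * ((1 + m * R + m * R ^ 2) * (e + ‖θ‖)) +
        m * R * (e + ‖θ‖) := by
        gcongr
        linarith
    _ = _ := by ring

/-! ### Measurability, and the law of the approximating normal variable -/

theorem measurable_leaveOneOut (h : WhiteAssumption n μ ρ g) (i : Fin n) :
    Measurable fun d : (Fin n → ℝ) × (Fin n → EuclideanSpace ℝ (Fin p)) =>
      rowSection ρ g i d 0 := by
  refine h.continuous_betaHat.measurable.comp (measurable_fst.prodMk ?_)
  exact measurable_update'.comp (measurable_snd.prodMk measurable_const)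

theorem measurable_rowNormal (h : WhiteAssumption n μ ρ g) (i : Fin n) :
    Measurable (rowNormal ρ g i) := by
  have h1 : Measurable fun q : ((Fin n → ℝ) × (Fin n → EuclideanSpace ℝ (Fin p))) × ℝ =>
      rowSection ρ g i q.1 0 := (h.measurable_leaveOneOut i).comp measurable_fst
  refine Measurable.ite (h1 (measurableSet_singleton 0)) measurable_snd ?_
  refine Measurable.div (Measurable.neg ?_) h1.norm
  exact (((measurable_pi_apply i).comp measurable_snd).comp measurable_fst).inner h1

theorem measurable_fderiv_betaHat_apply
    (v : (Fin n → ℝ) × (Fin n → EuclideanSpace ℝ (Fin p))) :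
    Measurable fun d => fderiv ℝ (betaHat (n := n) ρ g) d v :=
  measurable_fderiv_apply_const ℝ _ v

theorem measurable_sum_fderiv_betaHat (i : Fin n) :
    Measurable fun d : (Fin n → ℝ) × (Fin n → EuclideanSpace ℝ (Fin p)) =>
      ∑ j, fderiv ℝ (betaHat ρ g) d (0, Pi.single i (EuclideanSpace.single j 1)) j := by
  refine Finset.measurable_sum _ fun j _ => ?_
  exact (EuclideanSpace.proj (𝕜 := ℝ) j).continuous.measurable.comp
    (measurable_fderiv_betaHat_apply _)

theorem measurable_rowDivergence (h : WhiteAssumption n μ ρ g) (i : Fin n) :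
    Measurable (rowDivergence ρ g i) := by
  refine Measurable.sub ?_ (measurable_sum_fderiv_betaHat i)
  exact ((measurable_pi_apply i).comp measurable_snd).inner
    (h.continuous_betaHat.measurable.sub (h.measurable_leaveOneOut i))

theorem measurable_whiteAdjusted (h : WhiteAssumption n μ ρ g) (i : Fin n) :
    Measurable (whiteAdjusted ρ g i) := by
  refine Measurable.add (Measurable.add ?_ (measurable_sum_fderiv_betaHat i)) ?_
  · exact (h.continuous_mResidual i).measurable
  · exact (measurable_fderiv_betaHat_apply _).inner h.continuous_betaHat.measurable

theorem measurable_whiteError (h : WhiteAssumption n μ ρ g) (i : Fin n) :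
    Measurable (whiteError ρ g i) := by
  refine Measurable.sub ((h.measurable_whiteAdjusted i).comp measurable_fst) (Measurable.add ?_ ?_)
  · exact ((measurable_pi_apply i).comp measurable_fst).comp measurable_fst
  · exact (h.continuous_betaHat.measurable.norm.comp measurable_fst).mul (h.measurable_rowNormal i)

theorem measurable_relativeError (h : WhiteAssumption n μ ρ g) (i : Fin n) :
    Measurable (relativeError ρ g i) := by
  refine (h.measurable_whiteError i).div (Measurable.add ?_ ?_)
  · exact h.lipschitzWith_psi.continuous.abs.measurable.comp
      (((measurable_pi_apply i).comp measurable_fst).comp measurable_fst)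
  · exact h.continuous_betaHat.measurable.norm.comp measurable_fst

theorem _root_.stdGaussian_map_neg_inner_div_norm {v : EuclideanSpace ℝ (Fin p)} (hv : v ≠ 0) :
    (stdGaussian (EuclideanSpace ℝ (Fin p))).map (fun z => -(inner ℝ z v) / ‖v‖) =
      gaussianReal 0 1 := by
  have hv' : ‖v‖ ≠ 0 := norm_ne_zero_iff.2 hv
  set L : StrongDual ℝ (EuclideanSpace ℝ (Fin p)) := innerSL ℝ (-(‖v‖⁻¹ • v)) with hL
  have e : (fun z : EuclideanSpace ℝ (Fin p) => -(inner ℝ z v) / ‖v‖) = L := by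
    funext z
    simp only [hL, innerSL_apply_apply, inner_neg_left, inner_smul_left, conj_trivial]
    rw [real_inner_comm]
    field_simp
  have hn : ‖L‖ = 1 := by
    rw [hL, innerSL_apply_norm, norm_neg, norm_smul, norm_inv, norm_norm, inv_mul_cancel₀ hv']
  rw [e, IsGaussian.map_eq_gaussianReal, integral_strongDual_stdGaussian,
    variance_dual_stdGaussian, hn]
  simp

variable {ν : Measure (Fin n → ℝ)} [IsProbabilityMeasure ν]

/-- The approximating normal variable is standard normal and independent of the noise, because
the leave-one-out estimator does not depend on the row `xᵢ`. -/
theorem map_rowNormal (h : WhiteAssumption n μ ρ g) (i : Fin n) :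
    ((whiteLaw p ν).prod (gaussianReal 0 1)).map (fun q => (q.1.1, rowNormal ρ g i q)) =
      ν.prod (gaussianReal 0 1) := by
  have hmap : Measurable fun q : ((Fin n → ℝ) × (Fin n → EuclideanSpace ℝ (Fin p))) × ℝ =>
      (q.1.1, rowNormal ρ g i q) :=
    (measurable_fst.comp measurable_fst).prodMk (h.measurable_rowNormal i)
  refine (Measure.prod_eq fun s t hs ht => ?_).symm
  rw [Measure.map_apply hmap (hs.prod ht), Measure.prod_apply (hmap (hs.prod ht)),
    lintegral_whiteLaw_eq_lintegral_update i (measurable_measure_prodMk_left (hmap (hs.prod ht)))]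
  have h1 : ∀ d : (Fin n → ℝ) × (Fin n → EuclideanSpace ℝ (Fin p)),
      ∫⁻ z, gaussianReal 0 1 (Prod.mk (d.1, Function.update d.2 i z) ⁻¹'
        ((fun q => (q.1.1, rowNormal ρ g i q)) ⁻¹' s ×ˢ t))
        ∂(stdGaussian (EuclideanSpace ℝ (Fin p))) =
      (Prod.fst ⁻¹' s).indicator (fun _ => gaussianReal 0 1 t) d := by
    intro d
    by_cases hd : d.1 ∈ s
    · rw [Set.indicator_of_mem (by exact hd)]
      by_cases h0 : rowSection ρ g i d 0 = 0
      · have e : ∀ z : EuclideanSpace ℝ (Fin p),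
            (Prod.mk (d.1, Function.update d.2 i z) ⁻¹'
              ((fun q => (q.1.1, rowNormal ρ g i q)) ⁻¹' s ×ˢ t)) = t := by
          intro z
          ext η
          simp [rowNormal, rowSection_update, h0, hd]
        simp only [e, lintegral_const, measure_univ, mul_one]
      · have e : ∀ z : EuclideanSpace ℝ (Fin p),
            gaussianReal 0 1 (Prod.mk (d.1, Function.update d.2 i z) ⁻¹'
              ((fun q => (q.1.1, rowNormal ρ g i q)) ⁻¹' s ×ˢ t)) =
            ((fun z => -(inner ℝ z (rowSection ρ g i d 0)) / ‖rowSection ρ g i d 0‖) ⁻¹'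
              t).indicator 1 z := by
          intro z
          by_cases hz : -(inner ℝ z (rowSection ρ g i d 0)) / ‖rowSection ρ g i d 0‖ ∈ t
          · rw [Set.indicator_of_mem (by exact hz), Pi.one_apply]
            have : (Prod.mk (d.1, Function.update d.2 i z) ⁻¹'
              ((fun q => (q.1.1, rowNormal ρ g i q)) ⁻¹' s ×ˢ t)) = Set.univ := by
              ext η
              simpa [rowNormal, rowSection_update, h0, hd] using hz
            rw [this, measure_univ]
          · rw [Set.indicator_of_notMem (by exact hz)]
            have : (Prod.mk (d.1, Function.update d.2 i z) ⁻¹'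
              ((fun q => (q.1.1, rowNormal ρ g i q)) ⁻¹' s ×ˢ t)) = ∅ := by
              ext η
              simpa [rowNormal, rowSection_update, h0, hd] using hz
            rw [this, measure_empty]
        have hmz : Measurable fun z : EuclideanSpace ℝ (Fin p) =>
            -(inner ℝ z (rowSection ρ g i d 0)) / ‖rowSection ρ g i d 0‖ := by fun_prop
        simp only [e]
        rw [lintegral_indicator_one (hmz ht), ← Measure.map_apply hmz ht,
          stdGaussian_map_neg_inner_div_norm h0]
    · rw [Set.indicator_of_notMem (by exact hd)]
      have e : ∀ z : EuclideanSpace ℝ (Fin p),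
          (Prod.mk (d.1, Function.update d.2 i z) ⁻¹'
            ((fun q => (q.1.1, rowNormal ρ g i q)) ⁻¹' s ×ˢ t)) = ∅ := by
        intro z
        ext η
        simp [hd]
      simp only [e, measure_empty, lintegral_zero]
  rw [lintegral_congr h1, lintegral_indicator_const (measurable_fst hs), mul_comm]
  congr 1
  rw [whiteLaw, ← Measure.map_apply measurable_fst hs]
  simp

theorem map_rowNormal_eq_gaussianReal (h : WhiteAssumption n μ ρ g) (i : Fin n) :
    ((whiteLaw p ν).prod (gaussianReal 0 1)).map (rowNormal ρ g i) = gaussianReal 0 1 := by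
  have hmap : Measurable fun q : ((Fin n → ℝ) × (Fin n → EuclideanSpace ℝ (Fin p))) × ℝ =>
      (q.1.1, rowNormal ρ g i q) :=
    (measurable_fst.comp measurable_fst).prodMk (h.measurable_rowNormal i)
  have h1 := congrArg (Measure.map Prod.snd) (h.map_rowNormal (ν := ν) i)
  rw [Measure.map_map measurable_snd hmap] at h1
  refine Eq.trans h1 ?_
  simp

end WhiteAssumption

end

noncomputable section

/-! ### The order of the remainder -/

theorem stdGaussian_norm_ge_le {p : ℕ} {R : ℝ} (hR : 0 < R) :
    stdGaussian (EuclideanSpace ℝ (Fin p)) {z | R ≤ ‖z‖} ≤ ENNReal.ofReal (p / R ^ 2) := by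
  have h1 := mul_meas_ge_le_integral_of_nonneg
    (Eventually.of_forall fun z : EuclideanSpace ℝ (Fin p) => sq_nonneg ‖z‖)
    integrable_norm_sq_id_stdGaussian (R ^ 2)
  rw [integral_norm_sq_stdGaussian] at h1
  have e : {z : EuclideanSpace ℝ (Fin p) | R ≤ ‖z‖} = {z | R ^ 2 ≤ ‖z‖ ^ 2} := by
    ext z
    exact (pow_le_pow_iff_left₀ hR.le (norm_nonneg z) two_ne_zero).symm
  rw [← ofReal_measureReal, e]
  refine ENNReal.ofReal_le_ofReal ?_
  rw [le_div_iff₀ (by positivity)]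
  linarith

theorem gaussianReal_abs_ge_le {k : ℝ} (hk : 0 < k) :
    gaussianReal 0 1 {x | k ≤ |x|} ≤ ENNReal.ofReal (1 / k ^ 2) := by
  simpa [variance_id_gaussianReal] using
    meas_ge_le_variance_div_sq (memLp_id_gaussianReal (μ := 0) (v := 1) 2) hk

namespace WhiteAssumption

variable {n p : ℕ} {μ : ℝ} {ρ : ℝ → ℝ} {g : EuclideanSpace ℝ (Fin p) → ℝ}
  {ν : Measure (Fin n → ℝ)}

theorem _root_.ae_eval_ne_zero_of_absolutelyContinuous (hν : ν ≪ volume) (i : Fin n) :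
    ∀ᵐ e ∂ν, e i ≠ 0 :=
  hν.ae_le (Measure.ae_eval_ne (fun _ => volume) i 0)

theorem ae_whiteLaw_exists_isDerivativeOperator (h : WhiteAssumption n μ ρ g) (hν : ν ≪ volume) :
    ∀ᵐ d ∂(whiteLaw p ν), ∃ A, IsDerivativeOperator μ ρ g d A :=
  (whiteLaw_absolutelyContinuous hν).ae_le h.ae_exists_isDerivativeOperator

theorem ae_whiteLaw_psi_ne_zero (h : WhiteAssumption n μ ρ g) (hν : ν ≪ volume) (i : Fin n) :
    ∀ᵐ d ∂(whiteLaw p ν), deriv ρ (d.1 i) ≠ 0 := by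
  have h1 := Measure.quasiMeasurePreserving_fst (μ := ν)
    (ν := Measure.pi fun _ : Fin n => stdGaussian (EuclideanSpace ℝ (Fin p)))
    |>.ae (ae_eval_ne_zero_of_absolutelyContinuous hν i)
  filter_upwards [h1] with d hd
  exact fun h0 => hd (h.psi_eq_zero_iff.1 h0)

variable [IsProbabilityMeasure ν]

theorem rowDivergence_update {i : Fin n}
    {d : (Fin n → ℝ) × (Fin n → EuclideanSpace ℝ (Fin p))} {z : EuclideanSpace ℝ (Fin p)}
    (hd : DifferentiableAt ℝ (betaHat ρ g) (d.1, Function.update d.2 i z)) :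
    rowDivergence ρ g i (d.1, Function.update d.2 i z) =
      gaussianDivergence (rowIncrement ρ g i d) z := by
  have h1 : fderiv ℝ (rowIncrement ρ g i d) z = fderiv ℝ (rowSection ρ g i d) z :=
    fderiv_sub_const _
  simp only [rowDivergence, gaussianDivergence, h1, fderiv_rowSection hd, rowSection_update,
    Function.update_self]
  rfl

theorem whiteLaw_rowDivergence_ge_le (h : WhiteAssumption n μ ρ g) (hν : ν ≪ volume) (i : Fin n)
    {R T : ℝ} (hR : 0 < R) (hT : 0 < T) :
    whiteLaw p ν {d | ‖d.2 i‖ < R ∧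
      T * (|deriv ρ (d.1 i)| + ‖rowSection ρ g i d 0‖) ≤ |rowDivergence ρ g i d|} ≤
    ENNReal.ofReal (((n * μ)⁻¹) ^ 2 * (2 * (4 * R ^ 2 + 3 * p + 12 +
      96 * ((n * μ)⁻¹) ^ 2 * R ^ 4) + 24 * R ^ 2) / T ^ 2) := by
  have hm : MeasurableSet {d : (Fin n → ℝ) × (Fin n → EuclideanSpace ℝ (Fin p)) | ‖d.2 i‖ < R ∧
      T * (|deriv ρ (d.1 i)| + ‖rowSection ρ g i d 0‖) ≤ |rowDivergence ρ g i d|} := by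
    have m1 : Measurable fun d : (Fin n → ℝ) × (Fin n → EuclideanSpace ℝ (Fin p)) => ‖d.2 i‖ :=
      ((measurable_pi_apply i).comp measurable_snd).norm
    have m2 : Measurable fun d : (Fin n → ℝ) × (Fin n → EuclideanSpace ℝ (Fin p)) =>
        |deriv ρ (d.1 i)| :=
      h.lipschitzWith_psi.continuous.abs.measurable.comp
        ((measurable_pi_apply i).comp measurable_fst)
    have m3 : Measurable fun d => |rowDivergence ρ g i d| :=
      measurable_norm.comp (h.measurable_rowDivergence i)
    exact (measurableSet_lt m1 measurable_const).inter
      (measurableSet_le (measurable_const.mul (m2.add (h.measurable_leaveOneOut i).norm)) m3)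
  rw [whiteLaw_apply_eq_lintegral_update i hm]
  have h1 : ∀ᵐ d ∂(whiteLaw p ν), stdGaussian (EuclideanSpace ℝ (Fin p))
      {z | (d.1, Function.update d.2 i z) ∈ {d : (Fin n → ℝ) × (Fin n → EuclideanSpace ℝ (Fin p)) |
        ‖d.2 i‖ < R ∧ T * (|deriv ρ (d.1 i)| + ‖rowSection ρ g i d 0‖) ≤
          |rowDivergence ρ g i d|}} ≤
      ENNReal.ofReal (((n * μ)⁻¹) ^ 2 * (2 * (4 * R ^ 2 + 3 * p + 12 +
        96 * ((n * μ)⁻¹) ^ 2 * R ^ 4) + 24 * R ^ 2) / T ^ 2) := by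
    filter_upwards [h.ae_whiteLaw_psi_ne_zero hν i,
      ae_ae_update_of_ae_whiteLaw i (h.ae_whiteLaw_exists_isDerivativeOperator hν)] with d hd hA
    have hs : 0 < |deriv ρ (d.1 i)| + ‖rowSection ρ g i d 0‖ := by
      have := abs_pos.2 hd
      positivity
    refine le_trans (measure_mono_ae ?_)
      (h.measure_gaussianDivergence_rowIncrement_ge_le i d hR hT hs hA)
    filter_upwards [hA] with z hz hz'
    obtain ⟨A, hz⟩ := hz
    have h2 : ‖z‖ < R ∧ T * (|deriv ρ (d.1 i)| + ‖rowSection ρ g i d 0‖) ≤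
        |rowDivergence ρ g i (d.1, Function.update d.2 i z)| := by
      have h3 : ‖Function.update d.2 i z i‖ < R ∧ T * (|deriv ρ (d.1 i)| +
        ‖rowSection ρ g i (d.1, Function.update d.2 i z) 0‖) ≤
          |rowDivergence ρ g i (d.1, Function.update d.2 i z)| := hz'
      rwa [rowSection_update, Function.update_self] at h3
    rw [rowDivergence_update hz.differentiableAt] at h2
    exact h2
  refine (lintegral_mono_ae h1).trans ?_
  simp

/-- A bound on the tail of the relative error, with the truncation levels `R` for `‖xᵢ‖`, `k` for
the normal variable and `T` for the Gaussian divergence. -/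
theorem relativeError_ge_le (h : WhiteAssumption n μ ρ g) (hν : ν ≪ volume) (i : Fin n)
    {R k T a : ℝ} (hR : 0 < R) (hk : 0 < k) (hT : 0 < T)
    (ha : (k * ((n * μ)⁻¹ * (1 + k) * R) + T) * (1 + (n * μ)⁻¹ * R + (n * μ)⁻¹ * R ^ 2) +
        (n * μ)⁻¹ * R < a) :
    (whiteLaw p ν).prod (gaussianReal 0 1) {q | a ≤ |relativeError ρ g i q|} ≤
      ENNReal.ofReal (p / R ^ 2) + ENNReal.ofReal (1 / k ^ 2) +
      ENNReal.ofReal (((n * μ)⁻¹) ^ 2 * (2 * (4 * R ^ 2 + 3 * p + 12 +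
        96 * ((n * μ)⁻¹) ^ 2 * R ^ 4) + 24 * R ^ 2) / T ^ 2) := by
  set Q := (whiteLaw p ν).prod (gaussianReal 0 1) with hQ
  have hfst : Measure.map Prod.fst Q = whiteLaw p ν := by simp [hQ]
  have e1 : Q {q | R ≤ ‖q.1.2 i‖} ≤ ENNReal.ofReal (p / R ^ 2) := by
    have hm : MeasurableSet {z : EuclideanSpace ℝ (Fin p) | R ≤ ‖z‖} :=
      measurableSet_le measurable_const measurable_norm
    have hm' : MeasurableSet {d : (Fin n → ℝ) × (Fin n → EuclideanSpace ℝ (Fin p)) |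
        d.2 i ∈ {z | R ≤ ‖z‖}} := ((measurable_pi_apply i).comp measurable_snd) hm
    have h1 := whiteLaw_row_apply (ν := ν) i hm
    rw [← hfst, Measure.map_apply measurable_fst hm'] at h1
    exact h1.le.trans (stdGaussian_norm_ge_le hR)
  have e2 : Q {q | k ≤ |rowNormal ρ g i q|} ≤ ENNReal.ofReal (1 / k ^ 2) := by
    have hm : MeasurableSet {x : ℝ | k ≤ |x|} := measurableSet_le measurable_const measurable_norm
    have h1 := h.map_rowNormal_eq_gaussianReal (ν := ν) i
    have h2 := gaussianReal_abs_ge_le hk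
    rw [← h1, Measure.map_apply (h.measurable_rowNormal i) hm] at h2
    exact h2
  have e3 := h.whiteLaw_rowDivergence_ge_le hν i hR hT
  rw [← hfst] at e3
  replace e3 := (Measure.le_map_apply measurable_fst.aemeasurable _).trans e3
  have hg : ∀ᵐ q ∂Q, (∃ A, IsDerivativeOperator μ ρ g q.1 A) ∧ deriv ρ (q.1.1 i) ≠ 0 := by
    have h1 := (h.ae_whiteLaw_exists_isDerivativeOperator hν).and (h.ae_whiteLaw_psi_ne_zero hν i)
    exact Measure.quasiMeasurePreserving_fst.ae h1
  refine le_trans (measure_mono_ae ?_) ((measure_union_le _ _).trans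
    (add_le_add ((measure_union_le _ _).trans (add_le_add e1 e2)) e3))
  filter_upwards [hg] with q hq hq'
  obtain ⟨⟨A, hA⟩, hψ⟩ := hq
  -- Off the three exceptional events, the deterministic bound on the error applies.
  by_contra hcon
  have hc : q ∉ ({q | R ≤ ‖q.1.2 i‖} ∪ {q | k ≤ |rowNormal ρ g i q|}) ∪
      Prod.fst ⁻¹' {d : (Fin n → ℝ) × (Fin n → EuclideanSpace ℝ (Fin p)) | ‖d.2 i‖ < R ∧
        T * (|deriv ρ (d.1 i)| + ‖rowSection ρ g i d 0‖) ≤ |rowDivergence ρ g i d|} := hcon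
  simp only [Set.mem_union, Set.mem_ofPred_eq, Set.mem_preimage, not_or, not_le, not_and] at hc
  obtain ⟨⟨c1, c2⟩, c3⟩ := hc
  have h1 := h.abs_whiteError_le i hA hT.le c1.le c2.le (c3 c1).le
  have hq2 : a ≤ |relativeError ρ g i q| := hq'
  have hpos : 0 < |deriv ρ (q.1.1 i)| + ‖betaHat ρ g q.1‖ := by
    have := abs_pos.2 hψ
    positivity
  rw [relativeError, abs_div, abs_of_pos hpos, le_div_iff₀ hpos] at hq2
  have h3 := hq2.trans h1
  have h4 := le_of_mul_le_mul_right h3 hpos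
  linarith

/-- The relative error is `O_P(n^{-1/4})`, uniformly in all objects of the problem. -/
theorem exists_relativeError_boundedInProbability {γ μ : ℝ} (hγ : 0 < γ) (hμ : 0 < μ) :
    ∃ K : ℝ → ℝ, ∀ (n p : ℕ) (ρ : ℝ → ℝ) (g : EuclideanSpace ℝ (Fin p) → ℝ)
      (ν : Measure (Fin n → ℝ)) [IsProbabilityMeasure ν], WhiteAssumption n μ ρ g →
      ν ≪ volume → (p : ℝ) / n ≤ γ → ∀ i, BoundedInProbability
        ((whiteLaw p ν).prod (gaussianReal 0 1)) (relativeError ρ g i)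
          ((n : ℝ) ^ (-(1 / 4) : ℝ)) K := by
  suffices H : ∀ δ : ℝ, 0 < δ → ∃ K : ℝ, ∀ (n p : ℕ) (ρ : ℝ → ℝ) (g : EuclideanSpace ℝ (Fin p) → ℝ)
      (ν : Measure (Fin n → ℝ)) [IsProbabilityMeasure ν], WhiteAssumption n μ ρ g →
      ν ≪ volume → (p : ℝ) / n ≤ γ → ∀ i, (whiteLaw p ν).prod (gaussianReal 0 1)
        {q | K * (n : ℝ) ^ (-(1 / 4) : ℝ) ≤ |relativeError ρ g i q|} ≤ ENNReal.ofReal δ by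
    choose! K hK using H
    exact ⟨K, fun n p ρ g ν _ h hν hp i δ hδ => hK δ hδ n p ρ g ν h hν hp i⟩
  intro δ hδ
  -- Each of the three exceptional events gets probability at most `δ / 3`.
  set c := 3 * γ / δ with hc
  set k := √(3 / δ) with hk
  set C := (32 * c + 6 * γ + 24 + 192 * (c / μ) ^ 2) / μ ^ 2 with hC
  set t := √(3 * C / δ) with ht
  set b := √c / μ with hb
  have hc0 : 0 < c := by positivity
  have hk0 : 0 < k := by positivity
  have hC0 : 0 < C := by positivity
  have ht0 : 0 < t := by positivity
  have hb0 : 0 < b := by positivity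
  set K₀ := (k * (1 + k) * b + t) * (1 + b + c / μ) + b with hK₀
  refine ⟨K₀ + 1, fun n p ρ g ν _ h hν hp i => ?_⟩
  have hn : (0 : ℝ) < n := by exact_mod_cast h.n_pos
  have hn1 : (1 : ℝ) ≤ n := by exact_mod_cast h.n_pos
  set s := (√(n : ℝ))⁻¹ with hs
  have hs0 : 0 < s := by positivity
  have hs2 : s ^ 2 = (n : ℝ)⁻¹ := by rw [hs, inv_pow, Real.sq_sqrt hn.le]
  have hs1 : s ≤ 1 := inv_le_one_of_one_le₀ (Real.one_le_sqrt.2 hn1)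
  set R := √c * √(n : ℝ) with hR
  have hR0 : 0 < R := by positivity
  have hR2 : R ^ 2 = c * n := by rw [hR, mul_pow, Real.sq_sqrt hc0.le, Real.sq_sqrt hn.le]
  have hsn : s * √(n : ℝ) = 1 := inv_mul_cancel₀ (by positivity)
  have hmR : (n * μ)⁻¹ * R = b * s := by
    rw [mul_inv, ← hs2, hR, hb]
    calc s ^ 2 * μ⁻¹ * (√c * √(n : ℝ)) = s * (√c * μ⁻¹) * (s * √(n : ℝ)) := by ring
      _ = _ := by rw [hsn]; ring
  have hmR2 : (n * μ)⁻¹ * R ^ 2 = c / μ := by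
    rw [hR2]
    field_simp
  have hsq : s ≤ (n : ℝ) ^ (-(1 / 4) : ℝ) := by
    rw [hs, Real.sqrt_eq_rpow, ← Real.rpow_neg hn.le]
    exact Real.rpow_le_rpow_of_exponent_le hn1 (by norm_num)
  have hq0 : 0 < (n : ℝ) ^ (-(1 / 4) : ℝ) := Real.rpow_pos_of_pos hn _
  have hlt : (k * ((n * μ)⁻¹ * (1 + k) * R) + t * s) * (1 + (n * μ)⁻¹ * R + (n * μ)⁻¹ * R ^ 2) +
        (n * μ)⁻¹ * R < (K₀ + 1) * (n : ℝ) ^ (-(1 / 4) : ℝ) := by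
    have e1 : (n * μ)⁻¹ * (1 + k) * R = (1 + k) * (b * s) := by rw [← hmR]; ring
    rw [e1, hmR, hmR2]
    calc _ = s * ((k * (1 + k) * b + t) * (1 + b * s + c / μ) + b) := by ring
      _ ≤ s * ((k * (1 + k) * b + t) * (1 + b * 1 + c / μ) + b) := by gcongr
      _ = K₀ * s := by rw [hK₀]; ring
      _ ≤ K₀ * (n : ℝ) ^ (-(1 / 4) : ℝ) := by
        have : 0 < K₀ := by positivity
        gcongr
      _ < _ := by linarith
  refine (h.relativeError_ge_le hν i hR0 hk0 (T := t * s) (by positivity) hlt).trans ?_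
  have b1 : (p : ℝ) / R ^ 2 ≤ δ / 3 := by
    rw [hR2]
    calc (p : ℝ) / (c * n) = (p / n) / c := by field_simp
      _ ≤ γ / c := by gcongr
      _ = δ / 3 := by rw [hc]; field_simp
  have b2 : 1 / k ^ 2 = δ / 3 := by
    rw [hk, Real.sq_sqrt (by positivity)]
    field_simp
  have b3 : ((n * μ)⁻¹) ^ 2 * (2 * (4 * R ^ 2 + 3 * p + 12 +
        96 * ((n * μ)⁻¹) ^ 2 * R ^ 4) + 24 * R ^ 2) / (t * s) ^ 2 ≤ δ / 3 := by
    have hpn : (p : ℝ) ≤ γ * n := (div_le_iff₀ hn).1 hp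
    have e1 : ((n * μ)⁻¹) ^ 2 * R ^ 4 = (c / μ) ^ 2 := by rw [← hmR2]; ring
    have e2 : 2 * (4 * R ^ 2 + 3 * p + 12 + 96 * ((n * μ)⁻¹) ^ 2 * R ^ 4) + 24 * R ^ 2 =
        32 * (c * n) + 6 * p + 24 + 192 * (c / μ) ^ 2 := by
      rw [← e1, ← hR2]; ring
    have e3 : 32 * (c * n) + 6 * p + 24 + 192 * (c / μ) ^ 2 ≤
        (32 * c + 6 * γ + 24 + 192 * (c / μ) ^ 2) * n := by
      have : 192 * (c / μ) ^ 2 ≤ 192 * (c / μ) ^ 2 * n :=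
        le_mul_of_one_le_right (by positivity) hn1
      linarith
    have e4 : (t * s) ^ 2 = 3 * C / δ / n := by
      rw [mul_pow, hs2, ht, Real.sq_sqrt (by positivity)]
      rfl
    rw [e2, e4, div_le_iff₀ (by positivity)]
    calc _ ≤ ((n * μ)⁻¹) ^ 2 * ((32 * c + 6 * γ + 24 + 192 * (c / μ) ^ 2) * n) := by gcongr
      _ = C / n := by rw [hC]; field_simp
      _ = _ := by field_simp
  rw [b2, ← ENNReal.ofReal_add (by positivity) (by positivity), ← ENNReal.ofReal_add
    (by positivity) (by positivity)]
  exact ENNReal.ofReal_le_ofReal (by linarith)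

end WhiteAssumption

end

noncomputable section

/-! ### Square roots of covariance matrices -/

namespace Matrix.PosDef

variable {p : ℕ} {S : Matrix (Fin p) (Fin p) ℝ}

theorem isUnit_det_sqrt (hS : S.PosDef) : IsUnit (CFC.sqrt S).det := by
  have h0 : 0 ≤ S := Matrix.nonneg_iff_posSemidef.2 hS.posSemidef
  rw [← Matrix.isUnit_iff_isUnit_det, CFC.isUnit_sqrt_iff S h0]
  exact hS.isUnit

theorem sqrt_inv_apply (hS : S.PosDef) (x : EuclideanSpace ℝ (Fin p)) :
    Matrix.toEuclideanCLM (𝕜 := ℝ) (CFC.sqrt S) (Matrix.toEuclideanCLM (𝕜 := ℝ) (CFC.sqrt S)⁻¹ x) =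
      x := by
  rw [← mul_apply_eq_comp, ← map_mul, Matrix.mul_nonsing_inv _ hS.isUnit_det_sqrt,
    map_one, one_apply_eq_self]

theorem inv_sqrt_apply (hS : S.PosDef) (x : EuclideanSpace ℝ (Fin p)) :
    Matrix.toEuclideanCLM (𝕜 := ℝ) (CFC.sqrt S)⁻¹ (Matrix.toEuclideanCLM (𝕜 := ℝ) (CFC.sqrt S) x) =
      x := by
  rw [← mul_apply_eq_comp, ← map_mul, Matrix.nonsing_inv_mul _ hS.isUnit_det_sqrt,
    map_one, one_apply_eq_self]

theorem _root_.Matrix.IsHermitian.inner_toEuclideanCLM_comm {M : Matrix (Fin p) (Fin p) ℝ}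
    (hM : M.IsHermitian) (x y : EuclideanSpace ℝ (Fin p)) :
    (inner ℝ (Matrix.toEuclideanCLM (𝕜 := ℝ) M x) y : ℝ) =
      inner ℝ x (Matrix.toEuclideanCLM (𝕜 := ℝ) M y) := by
  have h1 : ContinuousLinearMap.adjoint (Matrix.toEuclideanCLM (𝕜 := ℝ) M) =
      Matrix.toEuclideanCLM (𝕜 := ℝ) M := by
    rw [← ContinuousLinearMap.star_eq_adjoint, ← map_star, Matrix.star_eq_conjTranspose, hM.eq]
  conv_lhs => rw [← h1]
  exact ContinuousLinearMap.adjoint_inner_left _ _ _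

theorem isHermitian_sqrt (S : Matrix (Fin p) (Fin p) ℝ) : (CFC.sqrt S).IsHermitian :=
  (Matrix.nonneg_iff_posSemidef.1 (CFC.sqrt_nonneg S)).isHermitian

theorem norm_sqrt_apply_sq (hS : S.PosDef) (b : EuclideanSpace ℝ (Fin p)) :
    ‖Matrix.toEuclideanCLM (𝕜 := ℝ) (CFC.sqrt S) b‖ ^ 2 = b ⬝ᵥ S *ᵥ b := by
  have h0 : 0 ≤ S := Matrix.nonneg_iff_posSemidef.2 hS.posSemidef
  rw [← real_inner_self_eq_norm_sq, (isHermitian_sqrt S).inner_toEuclideanCLM_comm,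
    ← mul_apply_eq_comp, ← map_mul, CFC.sqrt_mul_sqrt_self S h0,
    Matrix.inner_toEuclideanCLM]

theorem map_inv_sqrt_multivariateGaussian (hS : S.PosDef) :
    (multivariateGaussian 0 S).map (Matrix.toEuclideanCLM (𝕜 := ℝ) (CFC.sqrt S)⁻¹) =
      stdGaussian (EuclideanSpace ℝ (Fin p)) := by
  rw [multivariateGaussian, Measure.map_map (by fun_prop) (by fun_prop)]
  have e : (Matrix.toEuclideanCLM (𝕜 := ℝ) (CFC.sqrt S)⁻¹) ∘
      (fun x : EuclideanSpace ℝ (Fin p) => 0 + Matrix.toEuclideanCLM (𝕜 := ℝ) (CFC.sqrt S) x) =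
      id := by
    funext x
    simp only [Function.comp_apply, zero_add, id_eq]
    exact hS.inv_sqrt_apply x
  rw [e, Measure.map_id]

end Matrix.PosDef

/-! ### Reduction to standard Gaussian rows and vanishing signal -/

namespace RegressionProblem

variable {n p : ℕ} (R : RegressionProblem.{u} n p)

/-- The penalty as a function of the whitened error `θ = Σ^{1/2} (b - β*)`. -/
def whitePenalty (θ : EuclideanSpace ℝ (Fin p)) : ℝ :=
  R.g (R.betaStar + Matrix.toEuclideanCLM (𝕜 := ℝ) (CFC.sqrt R.S)⁻¹ θ)

/-- The whitening of the data: `(y, X) ↦ (y - X β*, X Σ^{-1/2})`. -/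
def whitening : ((Fin n → ℝ) × (Fin n → EuclideanSpace ℝ (Fin p))) →L[ℝ]
    ((Fin n → ℝ) × (Fin n → EuclideanSpace ℝ (Fin p))) :=
  (ContinuousLinearMap.pi fun i =>
    (ContinuousLinearMap.proj (φ := fun _ : Fin n => ℝ) i).comp
        (ContinuousLinearMap.fst ℝ (Fin n → ℝ) (Fin n → EuclideanSpace ℝ (Fin p))) -
      (innerSL ℝ R.betaStar).comp
        ((ContinuousLinearMap.proj (φ := fun _ : Fin n => EuclideanSpace ℝ (Fin p)) i).comp
          (ContinuousLinearMap.snd ℝ (Fin n → ℝ) (Fin n → EuclideanSpace ℝ (Fin p))))).prod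
  (ContinuousLinearMap.pi fun i => (Matrix.toEuclideanCLM (𝕜 := ℝ) (CFC.sqrt R.S)⁻¹).comp
    ((ContinuousLinearMap.proj (φ := fun _ : Fin n => EuclideanSpace ℝ (Fin p)) i).comp
      (ContinuousLinearMap.snd ℝ (Fin n → ℝ) (Fin n → EuclideanSpace ℝ (Fin p)))))

/-- The whitened data: the noise, and the rows `Σ^{-1/2} xᵢ`. -/
def whiteData (ω : R.Ω) : (Fin n → ℝ) × (Fin n → EuclideanSpace ℝ (Fin p)) :=
  (R.ε ω, fun i => Matrix.toEuclideanCLM (𝕜 := ℝ) (CFC.sqrt R.S)⁻¹ (R.X ω i))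

theorem whitening_fst (d : (Fin n → ℝ) × (Fin n → EuclideanSpace ℝ (Fin p))) (i : Fin n) :
    (R.whitening d).1 i = d.1 i - inner ℝ (d.2 i) R.betaStar := by
  rw [real_inner_comm]
  rfl

theorem whitening_snd (d : (Fin n → ℝ) × (Fin n → EuclideanSpace ℝ (Fin p))) (i : Fin n) :
    (R.whitening d).2 i = Matrix.toEuclideanCLM (𝕜 := ℝ) (CFC.sqrt R.S)⁻¹ (d.2 i) := rfl

theorem whitening_data (ω : R.Ω) : R.whitening (R.data ω) = R.whiteData ω := by
  refine Prod.ext (funext fun i => ?_) rfl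
  rw [whitening_fst]
  simp [data, whiteData]

variable {R} {γ μ : ℝ}

namespace MainAssumption

open WhiteAssumption (scoreDeriv_sub scoreDeriv_single_left scoreDeriv_single_right)

theorem whiteAssumption (h : R.MainAssumption γ μ) (hμ : 0 < μ) :
    WhiteAssumption n μ R.ρ R.whitePenalty where
  n_pos := h.n_pos
  mu_pos := hμ
  convexOn_loss := h.convexOn_loss
  loss_minimizer := h.loss_minimizer
  contDiff_loss := h.contDiff_loss
  lipschitzWith_psi := h.lipschitzWith_psi
  stronglyConvex := by
    rw [strongConvexOn_iff_convex]
    set q := Matrix.toEuclideanCLM (𝕜 := ℝ) (CFC.sqrt R.S)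
    set qi := Matrix.toEuclideanCLM (𝕜 := ℝ) (CFC.sqrt R.S)⁻¹
    have h1 := h.stronglyConvex.comp_affineMap
      ((AffineMap.const ℝ (EuclideanSpace ℝ (Fin p)) R.betaStar) + qi.toLinearMap.toAffineMap)
    have h2 : ConvexOn ℝ Set.univ fun θ : EuclideanSpace ℝ (Fin p) =>
        (innerSL ℝ (μ • q R.betaStar)) θ + μ / 2 * ‖q R.betaStar‖ ^ 2 :=
      ((innerSL ℝ (μ • q R.betaStar)).toLinearMap.convexOn convex_univ).add_const _
    refine (h1.add h2).congr fun θ _ => ?_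
    have e : q (R.betaStar + qi θ) = q R.betaStar + θ := by
      rw [map_add, h.posDef.sqrt_inv_apply]
    have e2 : ‖q R.betaStar + θ‖ ^ 2 =
        ‖q R.betaStar‖ ^ 2 + 2 * inner ℝ (q R.betaStar) θ + ‖θ‖ ^ 2 := norm_add_sq_real _ _
    simp only [Function.comp_apply, Pi.add_apply, AffineMap.coe_add, AffineMap.coe_const,
      Function.const_apply, LinearMap.coe_toAffineMap, ContinuousLinearMap.coe_coe,
      ← h.posDef.norm_sqrt_apply_sq, innerSL_apply_apply, inner_smul_left, conj_trivial,
      whitePenalty]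
    change R.g (R.betaStar + qi θ) - μ / 2 * ‖q (R.betaStar + qi θ)‖ ^ 2 + _ = _
    rw [e, e2]
    ring

theorem mObjective_whitening
    (d : (Fin n → ℝ) × (Fin n → EuclideanSpace ℝ (Fin p))) (θ : EuclideanSpace ℝ (Fin p)) :
    mObjective R.ρ R.whitePenalty (R.whitening d) θ = mObjective R.ρ R.g d
      (R.betaStar + Matrix.toEuclideanCLM (𝕜 := ℝ) (CFC.sqrt R.S)⁻¹ θ) := by
  have hH : ((CFC.sqrt R.S)⁻¹).IsHermitian := (Matrix.PosDef.isHermitian_sqrt R.S).inv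
  simp only [mObjective, whitePenalty, whitening_fst, whitening_snd, inner_add_right,
    hH.inner_toEuclideanCLM_comm, sub_sub]

theorem betaHat_eq (h : R.MainAssumption γ μ) (hμ : 0 < μ)
    (d : (Fin n → ℝ) × (Fin n → EuclideanSpace ℝ (Fin p))) :
    betaHat R.ρ R.g d = R.betaStar + Matrix.toEuclideanCLM (𝕜 := ℝ) (CFC.sqrt R.S)⁻¹
      (betaHat R.ρ R.whitePenalty (R.whitening d)) := by
  have hw := h.whiteAssumption hμ
  set q := Matrix.toEuclideanCLM (𝕜 := ℝ) (CFC.sqrt R.S)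
  set qi := Matrix.toEuclideanCLM (𝕜 := ℝ) (CFC.sqrt R.S)⁻¹
  have hsurj : ∀ b, b = R.betaStar + qi (q (b - R.betaStar)) := fun b => by
    rw [h.posDef.inv_sqrt_apply]
    abel
  have hex : ∃ b, IsMinOn (mObjective R.ρ R.g d) Set.univ b := by
    refine ⟨R.betaStar + qi (betaHat R.ρ R.whitePenalty (R.whitening d)), fun b _ => ?_⟩
    have h1 := hw.isMinOn_betaHat (R.whitening d) (Set.mem_univ (q (b - R.betaStar)))
    have h2 : mObjective R.ρ R.whitePenalty (R.whitening d)
        (betaHat R.ρ R.whitePenalty (R.whitening d)) ≤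
        mObjective R.ρ R.whitePenalty (R.whitening d) (q (b - R.betaStar)) := h1
    rw [mObjective_whitening, mObjective_whitening, ← hsurj b] at h2
    exact h2
  have hmin : IsMinOn (mObjective R.ρ R.g d) Set.univ (betaHat R.ρ R.g d) :=
    Classical.epsilon_spec hex
  have h3 : betaHat R.ρ R.whitePenalty (R.whitening d) = q (betaHat R.ρ R.g d - R.betaStar) := by
    refine hw.eq_betaHat_of_isMinOn fun θ _ => ?_
    change mObjective R.ρ R.whitePenalty (R.whitening d) (q (betaHat R.ρ R.g d - R.betaStar)) ≤
      mObjective R.ρ R.whitePenalty (R.whitening d) θ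
    rw [mObjective_whitening, mObjective_whitening, ← hsurj]
    exact hmin (Set.mem_univ _)
  rw [h3]
  exact hsurj _

theorem mResidual_eq (h : R.MainAssumption γ μ) (hμ : 0 < μ)
    (d : (Fin n → ℝ) × (Fin n → EuclideanSpace ℝ (Fin p))) (i : Fin n) :
    mResidual R.ρ R.g d i = mResidual R.ρ R.whitePenalty (R.whitening d) i := by
  have hH : ((CFC.sqrt R.S)⁻¹).IsHermitian := (Matrix.PosDef.isHermitian_sqrt R.S).inv
  rw [mResidual, mResidual, h.betaHat_eq hμ, whitening_fst, whitening_snd, inner_add_right,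
    hH.inner_toEuclideanCLM_comm, sub_sub]

theorem err_eq (h : R.MainAssumption γ μ) (hμ : 0 < μ) (ω : R.Ω) :
    R.err ω = ‖betaHat R.ρ R.whitePenalty (R.whiteData ω)‖ := by
  rw [err, normS, h.betaHat_eq hμ, add_sub_cancel_left, h.posDef.sqrt_inv_apply, whitening_data]

theorem hasFDerivAt_betaHat (h : R.MainAssumption γ μ) (hμ : 0 < μ)
    {d : (Fin n → ℝ) × (Fin n → EuclideanSpace ℝ (Fin p))}
    (hd : DifferentiableAt ℝ (betaHat R.ρ R.whitePenalty) (R.whitening d)) :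
    HasFDerivAt (betaHat R.ρ R.g)
      ((Matrix.toEuclideanCLM (𝕜 := ℝ) (CFC.sqrt R.S)⁻¹).comp
        ((fderiv ℝ (betaHat R.ρ R.whitePenalty) (R.whitening d)).comp R.whitening)) d := by
  have e : betaHat (n := n) R.ρ R.g = fun d => R.betaStar +
      Matrix.toEuclideanCLM (𝕜 := ℝ) (CFC.sqrt R.S)⁻¹
        (betaHat R.ρ R.whitePenalty (R.whitening d)) := funext (h.betaHat_eq hμ)
  rw [e]
  refine HasFDerivAt.const_add _ ?_
  exact (ContinuousLinearMap.hasFDerivAt _).comp d (hd.hasFDerivAt.comp d R.whitening.hasFDerivAt)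

theorem whitening_single_left (i : Fin n) :
    R.whitening (Pi.single i 1, 0) = (Pi.single i 1, 0) := by
  refine Prod.ext (funext fun l => ?_) (funext fun l => ?_)
  · rw [whitening_fst]
    simp
  · rw [whitening_snd]
    simp

theorem whitening_single_right (i : Fin n) (v : EuclideanSpace ℝ (Fin p)) :
    R.whitening (0, Pi.single i v) = (0, Pi.single i
      (Matrix.toEuclideanCLM (𝕜 := ℝ) (CFC.sqrt R.S)⁻¹ v)) -
      (Pi.single i (inner ℝ v R.betaStar), 0) := by
  refine Prod.ext (funext fun l => ?_) (funext fun l => ?_)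
  · rw [whitening_fst]
    rcases eq_or_ne l i with rfl | hl
    · simp
    · simp [hl]
  · rw [whitening_snd]
    rcases eq_or_ne l i with rfl | hl
    · simp
    · simp [hl]

/-- The derivative operator of the whitened problem gives the matrix `Â`. -/
theorem isDerivativeMatrix (h : R.MainAssumption γ μ) (hμ : 0 < μ)
    {d : (Fin n → ℝ) × (Fin n → EuclideanSpace ℝ (Fin p))} {B : Matrix (Fin p) (Fin p) ℝ}
    (hB : WhiteAssumption.IsDerivativeOperator μ R.ρ R.whitePenalty (R.whitening d)
      (Matrix.toEuclideanCLM (𝕜 := ℝ) B)) :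
    IsDerivativeMatrix μ R.ρ R.g R.S d ((CFC.sqrt R.S)⁻¹ * B * (CFC.sqrt R.S)⁻¹) := by
  have hH : ((CFC.sqrt R.S)⁻¹).IsHermitian := (Matrix.PosDef.isHermitian_sqrt R.S).inv
  have hdet := h.posDef.isUnit_det_sqrt
  have hD := h.hasFDerivAt_betaHat hμ hB.differentiableAt
  refine ⟨hD.differentiableAt, fun i => ?_, ?_, fun i => ?_, fun i j => ?_⟩
  · rw [h.mResidual_eq hμ]
    exact hB.differentiableAt_psi i
  · have e : CFC.sqrt R.S * ((CFC.sqrt R.S)⁻¹ * B * (CFC.sqrt R.S)⁻¹) * CFC.sqrt R.S = B := by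
      rw [Matrix.mul_assoc _⁻¹, Matrix.mul_nonsing_inv_cancel_left _ _ hdet,
        Matrix.nonsing_inv_mul_cancel_right _ _ hdet]
    rw [e]
    exact hB.norm_le
  · rw [hD.fderiv]
    simp only [ContinuousLinearMap.comp_apply, whitening_single_left, hB.fderiv_eq,
      scoreDeriv_single_left, h.mResidual_eq hμ, map_mul, mul_apply_eq_comp, map_smul,
      mul_one, whitening_snd]
  · have hj : (inner ℝ (EuclideanSpace.single j (1 : ℝ)) (betaHat R.ρ R.g d) : ℝ) =
        betaHat R.ρ R.g d j := by simp [EuclideanSpace.inner_single_left]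
    rw [hD.fderiv, ← hj, h.betaHat_eq hμ, inner_add_right, ← hH.inner_toEuclideanCLM_comm]
    simp only [ContinuousLinearMap.comp_apply, whitening_single_right, hB.fderiv_eq, scoreDeriv_sub,
      scoreDeriv_single_left, scoreDeriv_single_right, h.mResidual_eq hμ, map_mul,
      mul_apply_eq_comp, map_smul, map_sub, whitening_snd]
    module

/-- The matrix `Â` is unique where some `ψ(rᵢ)` does not vanish, because its columns can be read off
the derivatives in `xᵢ` and `yᵢ`. -/
theorem _root_.IsDerivativeMatrix.unique {ρ : ℝ → ℝ} {g : EuclideanSpace ℝ (Fin p) → ℝ}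
    {S A A' : Matrix (Fin p) (Fin p) ℝ} {d : (Fin n → ℝ) × (Fin n → EuclideanSpace ℝ (Fin p))}
    (hA : IsDerivativeMatrix μ ρ g S d A) (hA' : IsDerivativeMatrix μ ρ g S d A') {i : Fin n}
    (hi : deriv ρ (mResidual ρ g d i) ≠ 0) : A = A' := by
  have key : ∀ {M : Matrix (Fin p) (Fin p) ℝ}, IsDerivativeMatrix μ ρ g S d M → ∀ j,
      deriv ρ (mResidual ρ g d i) •
        Matrix.toEuclideanCLM (𝕜 := ℝ) M (EuclideanSpace.single j 1) =
      fderiv ℝ (betaHat (n := n) ρ g) d (0, Pi.single i (EuclideanSpace.single j 1)) +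
        betaHat ρ g d j • fderiv ℝ (betaHat (n := n) ρ g) d (Pi.single i 1, 0) := by
    intro M hM j
    rw [hM.deriv_x, hM.deriv_y]
    module
  refine (Matrix.toEuclideanCLM (𝕜 := ℝ)).injective ?_
  refine ContinuousLinearMap.coe_injective ((EuclideanSpace.basisFun (Fin p) ℝ).toBasis.ext
    fun j => ?_)
  simp only [OrthonormalBasis.coe_toBasis, EuclideanSpace.basisFun_apply,
    ContinuousLinearMap.coe_coe]
  exact smul_right_injective _ hi ((key hA j).trans (key hA' j).symm)

theorem exists_isDerivativeOperator_matrix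
    {ρ : ℝ → ℝ} {g : EuclideanSpace ℝ (Fin p) → ℝ}
    {d : (Fin n → ℝ) × (Fin n → EuclideanSpace ℝ (Fin p))}
    (hA : ∃ A, WhiteAssumption.IsDerivativeOperator μ ρ g d A) :
    ∃ B, WhiteAssumption.IsDerivativeOperator μ ρ g d (Matrix.toEuclideanCLM (𝕜 := ℝ) B) := by
  obtain ⟨A, hA⟩ := hA
  refine ⟨(Matrix.toEuclideanCLM (𝕜 := ℝ)).symm A, ?_⟩
  rwa [StarAlgEquiv.apply_symm_apply]

theorem isDerivativeMatrix_A (h : R.MainAssumption γ μ) (hμ : 0 < μ) {ω : R.Ω}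
    (hA : ∃ A, WhiteAssumption.IsDerivativeOperator μ R.ρ R.whitePenalty (R.whiteData ω) A) :
    IsDerivativeMatrix μ R.ρ R.g R.S (R.data ω) (R.A μ ω) := by
  obtain ⟨B, hB⟩ := exists_isDerivativeOperator_matrix hA
  rw [← whitening_data] at hB
  exact Classical.epsilon_spec (p := fun A => IsDerivativeMatrix μ R.ρ R.g R.S (R.data ω) A)
    ⟨_, h.isDerivativeMatrix hμ hB⟩

theorem adjustedResidual_eq (h : R.MainAssumption γ μ) (hμ : 0 < μ) {ω : R.Ω}
    (hA : ∃ A, WhiteAssumption.IsDerivativeOperator μ R.ρ R.whitePenalty (R.whiteData ω) A)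
    (i : Fin n) :
    R.adjustedResidual μ i ω =
      WhiteAssumption.whiteAdjusted R.ρ R.whitePenalty i (R.whiteData ω) := by
  have h1 := h.isDerivativeMatrix_A hμ hA
  obtain ⟨B, hB⟩ := exists_isDerivativeOperator_matrix hA
  rw [← whitening_data] at hB ⊢
  have h2 : R.A μ ω = (CFC.sqrt R.S)⁻¹ * B * (CFC.sqrt R.S)⁻¹ := by
    refine h1.unique (h.isDerivativeMatrix hμ hB) (i := i) ?_
    rw [h.mResidual_eq hμ]
    exact hB.psi_ne_zero i
  have hdet := h.posDef.isUnit_det_sqrt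
  have h0 : 0 ≤ R.S := Matrix.nonneg_iff_posSemidef.2 h.posDef.posSemidef
  have h3 : (R.S * R.A μ ω).trace = B.trace := by
    rw [h2]
    nth_rw 1 [← CFC.sqrt_mul_sqrt_self R.S h0]
    rw [Matrix.mul_assoc _⁻¹, Matrix.mul_assoc (CFC.sqrt R.S),
      Matrix.mul_nonsing_inv_cancel_left _ _ hdet, Matrix.trace_mul_comm,
      Matrix.nonsing_inv_mul_cancel_right _ _ hdet]
  rw [WhiteAssumption.whiteAdjusted_eq hB, adjustedResidual, h3, h.mResidual_eq hμ, psi]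
  congr 2
  simp [Matrix.trace, Matrix.ofLp_toEuclideanCLM]

theorem measurable_whiteData (h : R.MainAssumption γ μ) : Measurable R.whiteData := by
  refine h.measurable_ε.prodMk (measurable_pi_lambda _ fun i => ?_)
  exact (ContinuousLinearMap.measurable _).comp ((measurable_pi_apply i).comp h.measurable_X)

/-- The law of the whitened data. -/
theorem map_whiteData (h : R.MainAssumption γ μ) :
    R.P.map R.whiteData = whiteLaw p (R.P.map R.ε) := by
  set qi := Matrix.toEuclideanCLM (𝕜 := ℝ) (CFC.sqrt R.S)⁻¹
  have hX : ∀ i, AEMeasurable (fun ω => R.X ω i) R.P := fun i =>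
    ((measurable_pi_apply i).comp h.measurable_X).aemeasurable
  have hm : Measurable fun x : Fin n → EuclideanSpace ℝ (Fin p) => fun i => qi (x i) :=
    measurable_pi_lambda _ fun i => qi.measurable.comp (measurable_pi_apply i)
  have h1 := (iIndepFun_iff_map_fun_eq_pi_map hX).1 h.iIndepFun_rows
  have h2 : R.P.map (fun ω i => qi (R.X ω i)) =
      Measure.pi fun _ => stdGaussian (EuclideanSpace ℝ (Fin p)) := by
    have e : R.P.map (fun ω i => qi (R.X ω i)) =
        (R.P.map R.X).map (fun x i => qi (x i)) := by
      rw [Measure.map_map hm h.measurable_X]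
      rfl
    have h1' : R.P.map R.X = Measure.pi fun _ => multivariateGaussian 0 R.S := by
      simpa only [h.law_row] using h1
    rw [e, h1', Measure.pi_map_pi fun i => qi.measurable.aemeasurable]
    congr 1
    funext i
    exact h.posDef.map_inv_sqrt_multivariateGaussian
  have h3 := (h.indepFun_noise.comp measurable_id hm)
  have h4 := (indepFun_iff_map_prod_eq_prod_map_map h.measurable_ε.aemeasurable
    (hm.comp h.measurable_X).aemeasurable).1 h3
  rw [whiteLaw, ← h2]
  exact h4

theorem ae_whiteData (h : R.MainAssumption γ μ)
    {P : (Fin n → ℝ) × (Fin n → EuclideanSpace ℝ (Fin p)) → Prop}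
    (hP : ∀ᵐ d ∂(whiteLaw p (R.P.map R.ε)), P d) : ∀ᵐ ω ∂(R.P), P (R.whiteData ω) := by
  rw [← h.map_whiteData] at hP
  exact ae_of_ae_map h.measurable_whiteData.aemeasurable hP

theorem ae_exists_isDerivativeOperator (h : R.MainAssumption γ μ) (hμ : 0 < μ) :
    ∀ᵐ ω ∂(R.P), ∃ A, WhiteAssumption.IsDerivativeOperator μ R.ρ R.whitePenalty (R.whiteData ω) A :=
  h.ae_whiteData ((h.whiteAssumption hμ).ae_whiteLaw_exists_isDerivativeOperator
    h.noise_absolutelyContinuous)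

theorem ae_isDerivativeMatrix (h : R.MainAssumption γ μ) (hμ : 0 < μ) :
    ∀ᵐ ω ∂(R.P), IsDerivativeMatrix μ R.ρ R.g R.S (R.data ω) (R.A μ ω) := by
  filter_upwards [h.ae_exists_isDerivativeOperator hμ] with ω hω
  exact h.isDerivativeMatrix_A hμ hω

end MainAssumption

end RegressionProblem

end

noncomputable section

/-! ### Stochastic boundedness of the estimation error -/

section SecondMoments

variable {n p : ℕ}

theorem memLp_inner_stdGaussian (v : EuclideanSpace ℝ (Fin p)) :
    MemLp (fun z : EuclideanSpace ℝ (Fin p) => (inner ℝ z v : ℝ)) 2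
      (stdGaussian (EuclideanSpace ℝ (Fin p))) :=
  (memLp_two_iff_integrable_sq (by fun_prop)).2 (integrable_inner_sq_stdGaussian v)

theorem integral_inner_stdGaussian (v : EuclideanSpace ℝ (Fin p)) :
    ∫ z, (inner ℝ z v : ℝ) ∂(stdGaussian (EuclideanSpace ℝ (Fin p))) = 0 := by
  have h1 := integral_strongDual_stdGaussian (innerSL ℝ v)
  simpa only [innerSL_apply_apply, real_inner_comm] using h1

variable (n) in
/-- The joint law of `n` independent standard Gaussian rows. -/
abbrev gaussianRows (p : ℕ) : Measure (Fin n → EuclideanSpace ℝ (Fin p)) :=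
  Measure.pi fun _ => stdGaussian (EuclideanSpace ℝ (Fin p))

theorem integrable_sum_mul_inner_sq (a : Fin n → ℝ) (v : EuclideanSpace ℝ (Fin p)) :
    Integrable (fun x => (∑ l, a l * inner ℝ (x l) v) ^ 2) (gaussianRows n p) := by
  have hm : MemLp (fun x : Fin n → EuclideanSpace ℝ (Fin p) => ∑ l, a l * inner ℝ (x l) v) 2
      (gaussianRows n p) :=
    memLp_finsetSum _ fun l _ => ((memLp_inner_stdGaussian v).comp_measurePreserving
      (measurePreserving_eval _ l)).const_mul (a l)
  exact hm.integrable_sq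

theorem integral_sum_mul_inner_sq (a : Fin n → ℝ) (v : EuclideanSpace ℝ (Fin p)) :
    ∫ x, (∑ l, a l * inner ℝ (x l) v) ^ 2 ∂(gaussianRows n p) = (∑ l, a l ^ 2) * ‖v‖ ^ 2 := by
  have hL : ∀ l, MemLp (fun z : EuclideanSpace ℝ (Fin p) => a l * (inner ℝ z v : ℝ)) 2
      (stdGaussian (EuclideanSpace ℝ (Fin p))) := fun l => (memLp_inner_stdGaussian v).const_mul _
  have h1 := variance_sum_pi (μ := fun _ : Fin n => stdGaussian (EuclideanSpace ℝ (Fin p))) hL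
  have hmean : ∫ x, (∑ l, fun x : Fin n → EuclideanSpace ℝ (Fin p) => a l * (inner ℝ (x l) v : ℝ)) x
      ∂(gaussianRows n p) = 0 := by
    simp only [Finset.sum_apply]
    rw [integral_finsetSum]
    · refine Finset.sum_eq_zero fun l _ => ?_
      rw [integral_comp_eval (μ := fun _ : Fin n => stdGaussian (EuclideanSpace ℝ (Fin p)))
        (f := fun z : EuclideanSpace ℝ (Fin p) => a l * (inner ℝ z v : ℝ)) (by fun_prop),
        integral_const_mul, integral_inner_stdGaussian, mul_zero]
    · intro l _
      exact ((hL l).comp_measurePreserving (measurePreserving_eval _ l)).integrable one_le_two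
  have hvar : ∀ l, Var[fun z : EuclideanSpace ℝ (Fin p) => a l * (inner ℝ z v : ℝ);
      stdGaussian (EuclideanSpace ℝ (Fin p))] = a l ^ 2 * ‖v‖ ^ 2 := fun l => by
    rw [variance_const_mul, variance_of_integral_eq_zero (by fun_prop)
      (integral_inner_stdGaussian v), integral_inner_sq_stdGaussian]
  rw [variance_of_integral_eq_zero (by fun_prop) hmean] at h1
  simp only [Finset.sum_apply, hvar] at h1
  rw [h1, Finset.sum_mul]

theorem norm_sum_smul_sq_eq (a : Fin n → ℝ) (x : Fin n → EuclideanSpace ℝ (Fin p)) :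
    ‖∑ l, a l • x l‖ ^ 2 =
      ∑ j, (∑ l, a l * inner ℝ (x l) (EuclideanSpace.single j (1 : ℝ))) ^ 2 := by
  rw [EuclideanSpace.real_norm_sq_eq]
  simp [EuclideanSpace.inner_single_right]

theorem integrable_norm_sum_smul_sq (a : Fin n → ℝ) :
    Integrable (fun x => ‖∑ l, a l • x l‖ ^ 2) (gaussianRows n p) := by
  simp only [norm_sum_smul_sq_eq]
  exact integrable_finsetSum _ fun j _ => integrable_sum_mul_inner_sq a _

theorem integral_norm_sum_smul_sq (a : Fin n → ℝ) :
    ∫ x, ‖∑ l, a l • x l‖ ^ 2 ∂(gaussianRows n p) = (∑ l, a l ^ 2) * p := by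
  simp only [norm_sum_smul_sq_eq]
  rw [integral_finsetSum _ fun j _ => integrable_sum_mul_inner_sq a _]
  have e : ∀ j : Fin p, ‖(EuclideanSpace.single j (1 : ℝ) : EuclideanSpace ℝ (Fin p))‖ = 1 :=
    fun j => by simp
  simp only [integral_sum_mul_inner_sq, e, one_pow, mul_one, Finset.sum_const, Finset.card_univ,
    Fintype.card_fin, nsmul_eq_mul]
  exact mul_comm _ _

theorem gaussianRows_norm_sum_smul_ge_le (a : Fin n → ℝ) {u : ℝ} (hu : 0 < u) :
    gaussianRows n p {x | u ≤ ‖∑ l, a l • x l‖} ≤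
      ENNReal.ofReal ((∑ l, a l ^ 2) * p / u ^ 2) := by
  have h1 := mul_meas_ge_le_integral_of_nonneg (μ := gaussianRows n p)
    (f := fun x => ‖∑ l, a l • x l‖ ^ 2)
    (Eventually.of_forall fun x => sq_nonneg _) (integrable_norm_sum_smul_sq a) (u ^ 2)
  rw [integral_norm_sum_smul_sq] at h1
  have e : {x : Fin n → EuclideanSpace ℝ (Fin p) | u ≤ ‖∑ l, a l • x l‖} =
      {x | u ^ 2 ≤ ‖∑ l, a l • x l‖ ^ 2} := by
    ext x
    exact (pow_le_pow_iff_left₀ hu.le (norm_nonneg _) two_ne_zero).symm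
  rw [← ofReal_measureReal, e]
  refine ENNReal.ofReal_le_ofReal ?_
  rw [le_div_iff₀ (by positivity)]
  linarith

theorem gaussianRows_sum_inner_sq_ge_le (t : EuclideanSpace ℝ (Fin p)) {v : ℝ} (hv : 0 < v) :
    gaussianRows n p {x | v ≤ ∑ l, (inner ℝ (x l) t : ℝ) ^ 2} ≤
      ENNReal.ofReal (n * ‖t‖ ^ 2 / v) := by
  have hint : ∀ l, Integrable (fun x : Fin n → EuclideanSpace ℝ (Fin p) =>
      (inner ℝ (x l) t : ℝ) ^ 2) (gaussianRows n p) := fun l =>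
    (measurePreserving_eval (fun _ : Fin n => stdGaussian (EuclideanSpace ℝ (Fin p)))
      l).integrable_comp_of_integrable (integrable_inner_sq_stdGaussian t)
  have h1 := mul_meas_ge_le_integral_of_nonneg
    (Eventually.of_forall fun x => Finset.sum_nonneg fun l _ => sq_nonneg (inner ℝ (x l) t))
    (integrable_finsetSum Finset.univ fun l _ => hint l) v
  rw [integral_finsetSum _ fun l _ => hint l] at h1
  have h2 : ∀ l, ∫ x, (inner ℝ (x l) t : ℝ) ^ 2 ∂(gaussianRows n p) = ‖t‖ ^ 2 := fun l => by
    rw [integral_comp_eval (μ := fun _ : Fin n => stdGaussian (EuclideanSpace ℝ (Fin p)))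
      (f := fun z : EuclideanSpace ℝ (Fin p) => (inner ℝ z t : ℝ) ^ 2) (by fun_prop),
      integral_inner_sq_stdGaussian]
  simp only [h2, Finset.sum_const, Finset.card_univ, Fintype.card_fin, nsmul_eq_mul] at h1
  rw [← ofReal_measureReal]
  refine ENNReal.ofReal_le_ofReal ?_
  rw [le_div_iff₀ hv]
  linarith

end SecondMoments

namespace WhiteAssumption

variable {n p : ℕ} {μ : ℝ} {ρ : ℝ → ℝ} {g : EuclideanSpace ℝ (Fin p) → ℝ}

/-- The basic inequality: comparison of the optimality condition at `β̂` with the minimizer `-t` of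
the penalty, where `ψ(rₗ)` may be replaced by `ψ(εₗ)` by monotonicity of `ψ`. -/
theorem norm_betaHat_add_sq_le (h : WhiteAssumption n μ ρ g) {M : ℝ}
    (hM : ∀ s, |deriv ρ s| ≤ M) {t : EuclideanSpace ℝ (Fin p)} (ht : ∀ θ, g (-t) ≤ g θ)
    (d : (Fin n → ℝ) × (Fin n → EuclideanSpace ℝ (Fin p))) :
    n * (μ / 2 * ‖betaHat ρ g d + t‖ ^ 2) ≤
      ‖∑ l, deriv ρ (d.1 l) • d.2 l‖ * ‖betaHat ρ g d‖ +
      M * (n + ∑ l, (inner ℝ (d.2 l) t : ℝ) ^ 2) := by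
  have hn : (0 : ℝ) < n := by exact_mod_cast h.n_pos
  set θ := betaHat ρ g d with hθ
  have h1 := h.penalty_ge_of_isMinOn (h.isMinOn_betaHat d) (-t)
  have h2 := ht θ
  have e1 : ‖-t - θ‖ ^ 2 = ‖θ + t‖ ^ 2 := by rw [← norm_neg]; congr 2; abel
  have e2 : ∀ l, (inner ℝ (d.2 l) (-t - θ) : ℝ) = -(inner ℝ (d.2 l) θ + inner ℝ (d.2 l) t) := by
    intro l
    rw [inner_sub_right, inner_neg_right]
    ring
  rw [← hθ, e1] at h1
  simp only [e2] at h1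
  have h3 : ∑ l, deriv ρ (d.1 l - inner ℝ (d.2 l) θ) * (inner ℝ (d.2 l) θ + inner ℝ (d.2 l) t) ≤
      ∑ l, (deriv ρ (d.1 l) * inner ℝ (d.2 l) θ + M * (1 + (inner ℝ (d.2 l) t) ^ 2)) := by
    refine Finset.sum_le_sum fun l _ => ?_
    have a1 := h.psi_sub_mul_nonpos (d.1 l) (inner ℝ (d.2 l) θ)
    have a2 := hM (d.1 l - inner ℝ (d.2 l) θ)
    have a3 : deriv ρ (d.1 l - inner ℝ (d.2 l) θ) * inner ℝ (d.2 l) t ≤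
        M * |(inner ℝ (d.2 l) t : ℝ)| := by
      refine (le_abs_self _).trans ?_
      rw [abs_mul]
      gcongr
    have a4 : |(inner ℝ (d.2 l) t : ℝ)| ≤ 1 + (inner ℝ (d.2 l) t) ^ 2 := by
      rw [← sq_abs (inner ℝ (d.2 l) t)]
      nlinarith [sq_nonneg (|(inner ℝ (d.2 l) t : ℝ)| - 1)]
    have a5 := mul_le_mul_of_nonneg_left a4 ((abs_nonneg _).trans a2)
    linarith
  have h4 : ∑ l, deriv ρ (d.1 l) * (inner ℝ (d.2 l) θ : ℝ) ≤
      ‖∑ l, deriv ρ (d.1 l) • d.2 l‖ * ‖θ‖ := by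
    have e : ∑ l, deriv ρ (d.1 l) * (inner ℝ (d.2 l) θ : ℝ) =
        inner ℝ (∑ l, deriv ρ (d.1 l) • d.2 l) θ := by
      simp [sum_inner, inner_smul_left]
    rw [e]
    exact real_inner_le_norm _ _
  have h5 : n * (μ / 2 * ‖θ + t‖ ^ 2) ≤
      ∑ l, deriv ρ (d.1 l - inner ℝ (d.2 l) θ) * (inner ℝ (d.2 l) θ + inner ℝ (d.2 l) t) := by
    simp only [mul_neg, Finset.sum_neg_distrib] at h1
    set D := ∑ l, deriv ρ (d.1 l - inner ℝ (d.2 l) θ) * (inner ℝ (d.2 l) θ + inner ℝ (d.2 l) t)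
    have h6 : μ / 2 * ‖θ + t‖ ^ 2 ≤ 1 / n * D := by linarith
    calc _ ≤ n * (1 / n * D) := by gcongr
      _ = D := by field_simp
  refine (h5.trans h3).trans ?_
  rw [Finset.sum_add_distrib, ← Finset.mul_sum, Finset.sum_add_distrib]
  simp only [Finset.sum_const, Finset.card_univ, Fintype.card_fin, nsmul_eq_mul, mul_one]
  linarith

variable {ν : Measure (Fin n → ℝ)} [IsProbabilityMeasure ν]

theorem _root_.whiteLaw_le_of_forall {s : Set ((Fin n → ℝ) × (Fin n → EuclideanSpace ℝ (Fin p)))}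
    (hs : MeasurableSet s) {c : ENNReal} (hc : ∀ e, gaussianRows n p (Prod.mk e ⁻¹' s) ≤ c) :
    whiteLaw p ν s ≤ c := by
  rw [whiteLaw, Measure.prod_apply hs]
  refine (lintegral_mono hc).trans ?_
  simp

/-- Under the additional assumption, the estimation error is bounded in probability. -/
theorem exists_norm_betaHat_boundedInProbability {γ μ : ℝ} (hγ : 0 < γ) (M : ℝ) :
    ∃ K : ℝ → ℝ, ∀ (n p : ℕ) (ρ : ℝ → ℝ) (g : EuclideanSpace ℝ (Fin p) → ℝ)
      (ν : Measure (Fin n → ℝ)) [IsProbabilityMeasure ν] (t : EuclideanSpace ℝ (Fin p)),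
      WhiteAssumption n μ ρ g → (p : ℝ) / n ≤ γ → (∀ s, |deriv ρ s| ≤ M) →
      (∀ θ, g (-t) ≤ g θ) → ‖t‖ ^ 2 ≤ M → ∀ i, BoundedInProbability (whiteLaw p ν)
        (fun d => |deriv ρ (d.1 i)| + ‖betaHat ρ g d‖) 1 K := by
  refine ⟨fun δ => M + √M + 2 + 2 * (√(2 * (M ^ 2 * γ + 1) / δ) + (√(2 * (M ^ 2 * γ + 1) / δ) * √M +
    M * (1 + 2 * (M + 1) / δ))) / μ, fun n p ρ g ν _ t h hp hM ht htM i δ hδ => ?_⟩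
  have hμ := h.mu_pos
  have hn : (0 : ℝ) < n := by exact_mod_cast h.n_pos
  have hM0 : 0 ≤ M := (abs_nonneg _).trans (hM 0)
  set u := √(2 * (M ^ 2 * γ + 1) / δ) with hu
  set v := 2 * (M + 1) / δ with hv
  have hu0 : 0 < u := by positivity
  have hv0 : 0 < v := by positivity
  set w := u * √M + M * (1 + v) with hw
  have hw0 : 0 ≤ w := by positivity
  have m1 : Measurable fun d : (Fin n → ℝ) × (Fin n → EuclideanSpace ℝ (Fin p)) =>
      ‖∑ l, deriv ρ (d.1 l) • d.2 l‖ := by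
    have := h.lipschitzWith_psi.continuous
    exact Continuous.measurable (by fun_prop)
  have m2 : Measurable fun d : (Fin n → ℝ) × (Fin n → EuclideanSpace ℝ (Fin p)) =>
      ∑ l, (inner ℝ (d.2 l) t : ℝ) ^ 2 := Continuous.measurable (by fun_prop)
  have e1 : whiteLaw p ν {d | n * u ≤ ‖∑ l, deriv ρ (d.1 l) • d.2 l‖} ≤ ENNReal.ofReal (δ / 2) := by
    refine whiteLaw_le_of_forall (measurableSet_le measurable_const m1) fun e => ?_
    refine (gaussianRows_norm_sum_smul_ge_le (fun l => deriv ρ (e l))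
      (mul_pos hn hu0)).trans (ENNReal.ofReal_le_ofReal ?_)
    have b1 : ∑ l, deriv ρ (e l) ^ 2 ≤ n * M ^ 2 := by
      calc ∑ l, deriv ρ (e l) ^ 2 ≤ ∑ _l : Fin n, M ^ 2 :=
            Finset.sum_le_sum fun l _ => sq_le_sq' (neg_le_of_abs_le (hM _)) (le_of_abs_le (hM _))
        _ = n * M ^ 2 := by simp
    have b2 : (p : ℝ) ≤ γ * n := (div_le_iff₀ hn).1 hp
    have b3 : u ^ 2 = 2 * (M ^ 2 * γ + 1) / δ := Real.sq_sqrt (by positivity)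
    rw [div_le_iff₀ (by positivity), mul_pow, b3]
    calc (∑ l, deriv ρ (e l) ^ 2) * p ≤ n * M ^ 2 * (γ * n) := by gcongr
      _ ≤ n ^ 2 * (M ^ 2 * γ + 1) := by nlinarith [sq_nonneg (n : ℝ)]
      _ = _ := by field_simp
  have e2 : whiteLaw p ν {d | n * v ≤ ∑ l, (inner ℝ (d.2 l) t : ℝ) ^ 2} ≤
      ENNReal.ofReal (δ / 2) := by
    refine whiteLaw_le_of_forall (measurableSet_le measurable_const m2) fun e => ?_
    refine (gaussianRows_sum_inner_sq_ge_le t (mul_pos hn hv0)).trans (ENNReal.ofReal_le_ofReal ?_)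
    rw [div_le_iff₀ (by positivity), hv]
    calc n * ‖t‖ ^ 2 ≤ n * (M + 1) := by gcongr; linarith
      _ = _ := by field_simp
  have e3 := (measure_union_le _ _).trans (add_le_add e1 e2)
  rw [← ENNReal.ofReal_add (by positivity) (by positivity), add_halves] at e3
  refine (measure_mono fun d hd => ?_).trans e3
  -- Off the two exceptional events, the basic inequality is quadratic in `x = ‖β̂ + t‖`.
  by_contra hcon
  simp only [Set.mem_union, Set.mem_ofPred_eq, not_or, not_le] at hcon hd
  obtain ⟨c1, c2⟩ := hcon
  set θ := betaHat ρ g d with hθ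
  have htn : ‖t‖ ≤ √M := Real.le_sqrt_of_sq_le htM
  have hθt : ‖θ‖ ≤ ‖θ + t‖ + √M := by
    have h1 := norm_sub_le (θ + t) t
    rw [add_sub_cancel_right] at h1
    linarith
  have h1 := h.norm_betaHat_add_sq_le hM ht d
  rw [← hθ] at h1
  set x := ‖θ + t‖ with hx
  have hx0 : 0 ≤ x := norm_nonneg _
  have h2 : n * (μ / 2 * x ^ 2) ≤ n * (u * x + w) := by
    calc _ ≤ n * u * (x + √M) + M * (n + n * v) := h1.trans (by gcongr)
      _ = _ := by rw [hw]; ring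
  have h3 := le_of_mul_le_mul_left h2 hn
  have h4 : x ≤ 1 + 2 * (u + w) / μ := by
    rcases le_or_gt x 1 with hx1 | hx1
    · have : 0 ≤ 2 * (u + w) / μ := by positivity
      linarith
    · have h5 : x ≤ 2 * (u + w) / μ := by
        rw [le_div_iff₀ hμ]
        nlinarith
      linarith
  have h5 := hM (d.1 i)
  rw [abs_of_nonneg (by positivity), mul_one] at hd
  linarith

end WhiteAssumption

namespace RegressionProblem.MainAssumption

variable {n p : ℕ} {R : RegressionProblem.{u} n p} {γ μ : ℝ}

theorem measure_whiteData_mem_le (h : R.MainAssumption γ μ)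
    {s : Set ((Fin n → ℝ) × (Fin n → EuclideanSpace ℝ (Fin p)))} :
    R.P {ω | R.whiteData ω ∈ s} ≤ whiteLaw p (R.P.map R.ε) s := by
  rw [← h.map_whiteData]
  exact Measure.le_map_apply h.measurable_whiteData.aemeasurable _

end RegressionProblem.MainAssumption

namespace RegressionProblem

theorem exists_err_boundedInProbability {γ μ : ℝ} (hγ : 0 < γ) (hμ : 0 < μ) (M : ℝ) :
    ∃ K : ℝ → ℝ, ∀ (n p : ℕ) (R : RegressionProblem.{u} n p), R.MainAssumption γ μ →
      R.AdditionalAssumption M → ∀ i : Fin n,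
        BoundedInProbability R.P (fun ω => |R.psi (R.ε ω i)| + R.err ω) 1 K := by
  obtain ⟨K, hK⟩ := WhiteAssumption.exists_norm_betaHat_boundedInProbability (μ := μ) hγ M
  refine ⟨K, fun n p R h h' i δ hδ => ?_⟩
  have := Measure.isProbabilityMeasure_map (μ := R.P) h.measurable_ε.aemeasurable
  have h1 := hK n p R.ρ R.whitePenalty (R.P.map R.ε)
    (Matrix.toEuclideanCLM (𝕜 := ℝ) (CFC.sqrt R.S) R.betaStar) (h.whiteAssumption hμ) h.p_le
    h'.abs_psi_le (fun θ => by
      rw [whitePenalty, map_neg, h.posDef.inv_sqrt_apply, add_neg_cancel]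
      exact h'.penalty_minimizer _) h'.signal_le i δ hδ
  simp only [h.err_eq hμ]
  exact h.measure_whiteData_mem_le.trans h1

end RegressionProblem

end

noncomputable section

/-! ### The normal approximation of the adjusted residuals -/

namespace RegressionProblem

open WhiteAssumption (rowNormal relativeError whiteError)

variable {n p : ℕ} (R : RegressionProblem.{u} n p) {γ μ : ℝ}

/-- The approximating standard normal variable of the `i`-th adjusted residual. -/
def approxNormal (i : Fin n) (ω : R.Ω × ℝ) : ℝ :=
  rowNormal R.ρ R.whitePenalty i (R.whiteData ω.1, ω.2)

/-- The error of the normal approximation of the `i`-th adjusted residual, relative to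
`|ψ(εᵢ)| + ‖Σ^{1/2} (β̂ - β*)‖`. -/
def approxError (i : Fin n) (ω : R.Ω × ℝ) : ℝ :=
  relativeError R.ρ R.whitePenalty i (R.whiteData ω.1, ω.2)

variable {R}

namespace MainAssumption

theorem measurable_whiteData_prodMap (h : R.MainAssumption γ μ) :
    Measurable fun ω : R.Ω × ℝ => (R.whiteData ω.1, ω.2) :=
  (h.measurable_whiteData.comp measurable_fst).prodMk measurable_snd

theorem map_extP (h : R.MainAssumption γ μ) :
    R.extP.map (fun ω => (R.whiteData ω.1, ω.2)) =
      (whiteLaw p (R.P.map R.ε)).prod (gaussianReal 0 1) := by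
  rw [← h.map_whiteData]
  have h1 := Measure.map_prod_map R.P (gaussianReal 0 1) h.measurable_whiteData measurable_id
  rw [Measure.map_id] at h1
  exact h1.symm

theorem measurable_approxNormal (h : R.MainAssumption γ μ) (hμ : 0 < μ) (i : Fin n) :
    Measurable (R.approxNormal i) :=
  ((h.whiteAssumption hμ).measurable_rowNormal i).comp h.measurable_whiteData_prodMap

theorem measurable_approxError (h : R.MainAssumption γ μ) (hμ : 0 < μ) (i : Fin n) :
    Measurable (R.approxError i) :=
  ((h.whiteAssumption hμ).measurable_relativeError i).comp h.measurable_whiteData_prodMap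

/-- The approximating normal variable is standard normal and independent of the noise. -/
theorem map_noise_approxNormal (h : R.MainAssumption γ μ) (hμ : 0 < μ) (i : Fin n) :
    R.extP.map (fun ω => (R.ε ω.1, R.approxNormal i ω)) =
      (R.P.map R.ε).prod (gaussianReal 0 1) := by
  have := Measure.isProbabilityMeasure_map (μ := R.P) h.measurable_ε.aemeasurable
  have hw := h.whiteAssumption hμ
  have h1 := hw.map_rowNormal (ν := R.P.map R.ε) i
  have hmap : Measurable fun q : ((Fin n → ℝ) × (Fin n → EuclideanSpace ℝ (Fin p))) × ℝ =>
      (q.1.1, rowNormal R.ρ R.whitePenalty i q) :=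
    (measurable_fst.comp measurable_fst).prodMk (hw.measurable_rowNormal i)
  rw [← h.map_extP, Measure.map_map hmap h.measurable_whiteData_prodMap] at h1
  exact h1

theorem map_approxNormal (h : R.MainAssumption γ μ) (hμ : 0 < μ) (i : Fin n) :
    R.extP.map (R.approxNormal i) = gaussianReal 0 1 := by
  have := Measure.isProbabilityMeasure_map (μ := R.P) h.measurable_ε.aemeasurable
  have h1 := (h.whiteAssumption hμ).map_rowNormal_eq_gaussianReal (ν := R.P.map R.ε) i
  rw [← h.map_extP, Measure.map_map ((h.whiteAssumption hμ).measurable_rowNormal i)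
    h.measurable_whiteData_prodMap] at h1
  exact h1

theorem map_noise_eval_approxNormal (h : R.MainAssumption γ μ) (hμ : 0 < μ) (i : Fin n) :
    R.extP.map (fun ω => (R.ε ω.1 i, R.approxNormal i ω)) =
      (R.P.map fun ω => R.ε ω i).prod (gaussianReal 0 1) := by
  have hε : Measurable fun ω : R.Ω × ℝ => R.ε ω.1 := h.measurable_ε.comp measurable_fst
  have h1 := congrArg (Measure.map (Prod.map (fun e : Fin n → ℝ => e i) id))
    (h.map_noise_approxNormal hμ i)
  have hm : Measurable (Prod.map (fun e : Fin n → ℝ => e i) (id : ℝ → ℝ)) :=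
    (measurable_pi_apply i).prodMap measurable_id
  have := Measure.isProbabilityMeasure_map (μ := R.P) h.measurable_ε.aemeasurable
  rw [Measure.map_map hm (hε.prodMk (h.measurable_approxNormal hμ i)),
    ← Measure.map_prod_map _ _ (measurable_pi_apply i) measurable_id, Measure.map_id,
    Measure.map_map (measurable_pi_apply i) h.measurable_ε] at h1
  exact h1

/-- The decomposition of the adjusted residual. -/
theorem ae_adjustedResidual_eq (h : R.MainAssumption γ μ) (hμ : 0 < μ) (i : Fin n) :
    ∀ᵐ ω ∂(R.extP), R.adjustedResidual μ i ω.1 = R.ε ω.1 i + R.err ω.1 * R.approxNormal i ω +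
      R.approxError i ω * (|R.psi (R.ε ω.1 i)| + R.err ω.1) := by
  have h1 := h.ae_whiteData ((h.whiteAssumption hμ).ae_whiteLaw_psi_ne_zero
    h.noise_absolutelyContinuous i)
  filter_upwards [Measure.quasiMeasurePreserving_fst.ae
    (h1.and (h.ae_exists_isDerivativeOperator hμ))] with ω hω
  obtain ⟨hψ, hA⟩ := hω
  have hpos : 0 < |deriv R.ρ (R.ε ω.1 i)| + R.err ω.1 :=
    add_pos_of_pos_of_nonneg (abs_pos.2 hψ) (norm_nonneg _)
  have e : R.approxError i ω * (|R.psi (R.ε ω.1 i)| + R.err ω.1) =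
      R.adjustedResidual μ i ω.1 - (R.ε ω.1 i + R.err ω.1 * R.approxNormal i ω) := by
    rw [h.adjustedResidual_eq hμ hA, h.err_eq hμ]
    rw [h.err_eq hμ] at hpos
    exact div_mul_cancel₀ _ hpos.ne'
  rw [e]
  ring

end MainAssumption

theorem exists_approxError_boundedInProbability {γ μ : ℝ} (hγ : 0 < γ) (hμ : 0 < μ) :
    ∃ K : ℝ → ℝ, ∀ (n p : ℕ) (R : RegressionProblem.{u} n p), R.MainAssumption γ μ →
      ∀ i : Fin n,
        BoundedInProbability R.extP (R.approxError i) ((n : ℝ) ^ (-(1 / 4) : ℝ)) K := by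
  obtain ⟨K, hK⟩ := WhiteAssumption.exists_relativeError_boundedInProbability hγ hμ
  refine ⟨K, fun n p R h i δ hδ => ?_⟩
  have := Measure.isProbabilityMeasure_map (μ := R.P) h.measurable_ε.aemeasurable
  have h1 := hK n p R.ρ R.whitePenalty (R.P.map R.ε) (h.whiteAssumption hμ)
    h.noise_absolutelyContinuous h.p_le i δ hδ
  rw [← h.map_extP] at h1
  exact (Measure.le_map_apply h.measurable_whiteData_prodMap.aemeasurable _).trans h1

end RegressionProblem

/-! ### Convergence in distribution of the perturbed pairs -/

/-- Random variables on varying probability spaces that differ from variables with a fixed law by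
a remainder which tends to zero in probability converge in distribution to that law. -/
theorem tendstoInDistribution_of_map_eq {E : Type*} [NormedAddCommGroup E]
    [SecondCountableTopology E] [MeasurableSpace E] [BorelSpace E] {Ω : ℕ → Type u}
    {m : ∀ k, MeasurableSpace (Ω k)} {P : ∀ k, Measure (Ω k)} [∀ k, IsProbabilityMeasure (P k)]
    {X Y : ∀ k, Ω k → E} {π : Measure E} [IsProbabilityMeasure π]
    (hX : ∀ k, AEMeasurable (X k) (P k)) (hY : ∀ k, AEMeasurable (Y k) (P k))
    (hXπ : ∀ k, (P k).map (X k) = π)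
    (hXY : ∀ ε, 0 < ε → Tendsto (fun k => (P k) {ω | ε ≤ ‖Y k ω - X k ω‖}) atTop (𝓝 0)) :
    TendstoInDistribution Y atTop (id : E → E) P π := by
  refine ⟨hY, aemeasurable_id, ?_⟩
  refine tendsto_iff_forall_lipschitz_integral_tendsto.2 ?_
  rintro F ⟨C, hC⟩ ⟨L, hL⟩
  change Tendsto (fun k => ∫ x, F x ∂((P k).map (Y k))) atTop (𝓝 (∫ x, F x ∂(π.map id)))
  have hFm : Measurable F := hL.continuous.measurable
  have hC0 : 0 ≤ C := dist_nonneg.trans (hC 0 0)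
  have hbound : ∀ x, ‖F x‖ ≤ ‖F 0‖ + C := fun x => by
    have h1 := hC x 0
    have h2 := norm_sub_norm_le (F x) (F 0)
    rw [dist_eq_norm] at h1
    linarith
  rw [Measure.map_id, Metric.tendsto_nhds]
  intro η hη
  set ε := η / (2 * (L + 1)) with hε
  have hε0 : 0 < ε := by positivity
  have h1 : Tendsto (fun k => L * ε + C * (P k).real {ω | ε ≤ ‖Y k ω - X k ω‖}) atTop
      (𝓝 (L * ε + C * 0)) := by
    refine tendsto_const_nhds.add (Tendsto.const_mul _ ?_)
    have := (ENNReal.tendsto_toReal ENNReal.zero_ne_top).comp (hXY ε hε0)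
    exact this
  have hlt : L * ε + C * 0 < η := by
    have : L * ε ≤ η / 2 := by
      rw [hε, mul_div_assoc', div_le_div_iff₀ (by positivity) two_pos]
      nlinarith [L.coe_nonneg]
    linarith
  filter_upwards [h1.eventually_lt_const hlt] with k hk
  refine lt_of_le_of_lt ?_ hk
  have hYi : Integrable (fun ω => F (Y k ω)) (P k) :=
    Integrable.of_bound (hFm.comp_aemeasurable (hY k)).aestronglyMeasurable _
      (ae_of_all _ fun ω => hbound _)
  have hXi : Integrable (fun ω => F (X k ω)) (P k) :=
    Integrable.of_bound (hFm.comp_aemeasurable (hX k)).aestronglyMeasurable _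
      (ae_of_all _ fun ω => hbound _)
  have hset : NullMeasurableSet {ω | ε ≤ ‖Y k ω - X k ω‖} (P k) :=
    nullMeasurableSet_le aemeasurable_const ((hY k).sub (hX k)).norm
  rw [← hXπ k, integral_map (hY k) hFm.aestronglyMeasurable,
    integral_map (hX k) hFm.aestronglyMeasurable, dist_eq_norm, ← integral_sub hYi hXi]
  have hI : Integrable ({ω | ε ≤ ‖Y k ω - X k ω‖}.indicator (1 : Ω k → ℝ)) (P k) :=
    (integrable_const (1 : ℝ)).indicator₀ hset
  have hg : Integrable (fun ω => L * ε + C * {ω | ε ≤ ‖Y k ω - X k ω‖}.indicator 1 ω) (P k) :=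
    (integrable_const _).add (hI.const_mul C)
  calc ‖∫ ω, (F (Y k ω) - F (X k ω)) ∂(P k)‖
      ≤ ∫ ω, (L * ε + C * {ω | ε ≤ ‖Y k ω - X k ω‖}.indicator 1 ω) ∂(P k) := by
        refine norm_integral_le_of_norm_le hg (ae_of_all _ fun ω => ?_)
        rw [← dist_eq_norm]
        by_cases hω : ε ≤ ‖Y k ω - X k ω‖
        · rw [Set.indicator_of_mem (by exact hω), Pi.one_apply, mul_one]
          have := hC (Y k ω) (X k ω)
          have : 0 ≤ L * ε := by positivity
          linarith
        · rw [Set.indicator_of_notMem (by exact hω), mul_zero, add_zero]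
          refine (hL.dist_le_mul _ _).trans ?_
          rw [dist_eq_norm]
          gcongr
          exact (not_le.1 hω).le
    _ = _ := by
        rw [integral_add (integrable_const _) (hI.const_mul C), integral_const_mul C,
          integral_indicator₀ hset]
        simp

namespace RegressionProblem

/-- The remainder of the representation in terms of perturbed pairs tends to zero in probability:
`ψ(εᵢ)` is dominated by `εᵢ`, whose law is tight. -/
theorem tendsto_measure_perturbation_ge {γ μ : ℝ} (hγ : 0 < γ) (hμ : 0 < μ) {n p : ℕ → ℕ}
    {R : ∀ k, RegressionProblem.{u} (n k) (p k)} (i : ∀ k, Fin (n k)) {F : Measure ℝ}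
    [IsProbabilityMeasure F] (hn : Tendsto n atTop atTop) (h : ∀ k, (R k).MainAssumption γ μ)
    (hF : ∀ k, (R k).P.map (fun ω => (R k).ε ω (i k)) = F) {ε : ℝ} (hε : 0 < ε) :
    Tendsto (fun k => (R k).extP {ω | ε ≤
      |(R k).approxError (i k) ω| * (|(R k).psi ((R k).ε ω.1 (i k))| + 1)}) atTop (𝓝 0) := by
  obtain ⟨K, hK⟩ := exists_approxError_boundedInProbability.{u} hγ hμ
  rw [ENNReal.tendsto_nhds_zero]
  intro δ hδ
  obtain ⟨δ', hδ'0, hδ'⟩ : ∃ δ' : ℝ, 0 < δ' ∧ ENNReal.ofReal δ' ≤ δ / 2 := by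
    have h2 : (0 : ENNReal) < min (δ / 2) 1 := lt_min (ENNReal.half_pos hδ.ne') one_pos
    have h3 : min (δ / 2) 1 ≠ ⊤ := ne_top_of_le_ne_top ENNReal.one_ne_top (min_le_right _ _)
    exact ⟨_, ENNReal.toReal_pos h2.ne' h3, by
      rw [ENNReal.ofReal_toReal h3]; exact min_le_left _ _⟩
  obtain ⟨B, hB0, hB⟩ : ∃ B : ℝ, 0 < B ∧ F {x | B < |x|} ≤ δ / 2 := by
    have h1 := isTightMeasureSet_iff_tendsto_measure_norm_gt.1
      (isTightMeasureSet_singleton (μ := F))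
    simp only [Set.mem_singleton_iff, iSup_iSup_eq_left] at h1
    have h2 := (ENNReal.tendsto_nhds_zero.1 h1 (δ / 2) (ENNReal.half_pos hδ.ne')).and
      (eventually_gt_atTop 0)
    obtain ⟨B, hB, hB0⟩ := h2.exists
    exact ⟨B, hB0, hB⟩
  have hlim : Tendsto (fun k => K δ' * (n k : ℝ) ^ (-(1 / 4) : ℝ)) atTop (𝓝 (K δ' * 0)) := by
    refine Tendsto.const_mul _ ?_
    exact (tendsto_rpow_neg_atTop (by norm_num : (0 : ℝ) < 1 / 4)).comp
      (tendsto_natCast_atTop_atTop.comp hn)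
  have hlt : K δ' * 0 < ε / (B + 1) := by
    rw [mul_zero]
    positivity
  filter_upwards [hlim.eventually_lt_const hlt] with k hk
  have e1 := (hK (n k) (p k) (R k) (h k) (i k) δ' hδ'0).trans hδ'
  have e2 : (R k).extP {ω | B < |(R k).ε ω.1 (i k)|} ≤ δ / 2 := by
    have hm : Measurable fun ω => (R k).ε ω (i k) :=
      (measurable_pi_apply (i k)).comp (h k).measurable_ε
    rw [← hF k] at hB
    have h1 := (Measure.le_map_apply hm.aemeasurable _).trans hB
    have hfst : Measure.map Prod.fst (R k).extP = (R k).P := by simp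
    rw [← hfst] at h1
    exact (Measure.le_map_apply measurable_fst.aemeasurable _).trans h1
  refine (measure_mono fun ω hω => ?_).trans ((measure_union_le _ _).trans
    ((add_le_add e1 e2).trans (ENNReal.add_halves δ).le))
  by_contra hcon
  simp only [Set.mem_union, Set.mem_ofPred_eq, not_or, not_le, not_lt] at hcon hω
  obtain ⟨c1, c2⟩ := hcon
  have c3 : |(R k).psi ((R k).ε ω.1 (i k))| ≤ |(R k).ε ω.1 (i k)| :=
    ((h k).whiteAssumption hμ).abs_psi_le _
  have c4 : |(R k).approxError (i k) ω| < ε / (B + 1) := c1.trans hk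
  rw [lt_div_iff₀ (by positivity)] at c4
  have c5 : |(R k).approxError (i k) ω| * (|(R k).psi ((R k).ε ω.1 (i k))| + 1) ≤
      |(R k).approxError (i k) ω| * (B + 1) := by
    gcongr
    exact c3.trans c2
  linarith

end RegressionProblem

end

theorem mainTheorem4 (γ μ : ℝ) (hγ : 0 < γ) (hμ : 0 < μ) :
    -- the bound with the remainder `O_P(n^{-1/4})`, uniformly over all problems
    (∃ K : ℝ → ℝ, ∀ (n p : ℕ) (R : RegressionProblem.{u} n p), R.MainAssumption γ μ →
      (∀ᵐ ω ∂(R.P), IsDerivativeMatrix μ R.ρ R.g R.S (R.data ω) (R.A μ ω)) ∧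
      ∀ i : Fin n, ∃ Z W : R.Ω × ℝ → ℝ,
        AEMeasurable Z R.extP ∧ AEMeasurable W R.extP ∧
        R.extP.map Z = gaussianReal 0 1 ∧
        (∀ᵐ ω ∂(R.extP),
          |R.adjustedResidual μ i ω.1 - (R.ε ω.1 i + R.err ω.1 * Z ω)| ≤
            W ω * (|R.psi (R.ε ω.1 i)| + R.err ω.1)) ∧
        BoundedInProbability R.extP W ((n : ℝ) ^ (-(1 / 4) : ℝ)) K) ∧
    -- the representation with asymptotically independent `ε̃ᵢ`, `Z̃ᵢ`
    (∀ (n p : ℕ → ℕ) (R : ∀ k, RegressionProblem.{u} (n k) (p k)) (i : ∀ k, Fin (n k))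
      (F : Measure ℝ) [IsProbabilityMeasure F],
      Tendsto n atTop atTop →
      (∀ k, (R k).MainAssumption γ μ) →
      (∀ k, (R k).P.map (fun ω => (R k).ε ω (i k)) = F) →
      ∃ εt Zt : ∀ k, (R k).Ω × ℝ → ℝ,
        (∀ k, ∀ᵐ ω ∂((R k).extP),
          (R k).adjustedResidual μ (i k) ω.1 = εt k ω + (R k).err ω.1 * Zt k ω) ∧
        TendstoInDistribution (fun k ω => (εt k ω, Zt k ω)) atTop (id : ℝ × ℝ → ℝ × ℝ)
          (fun k => (R k).extP) (F.prod (gaussianReal 0 1))) ∧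
    -- stochastic boundedness of the factor in the bound, under the additional assumption
    (∀ M : ℝ, ∃ K : ℝ → ℝ, ∀ (n p : ℕ) (R : RegressionProblem.{u} n p), R.MainAssumption γ μ →
      R.AdditionalAssumption M →
      ∀ i : Fin n,
        BoundedInProbability R.P (fun ω => |R.psi (R.ε ω i)| + R.err ω) 1 K) := by
  refine ⟨?_, fun n p R i F _ hn h hF => ?_,
    RegressionProblem.exists_err_boundedInProbability hγ hμ⟩
  · obtain ⟨K, hK⟩ := RegressionProblem.exists_approxError_boundedInProbability.{u} hγ hμ
    refine ⟨K, fun n p R h => ⟨h.ae_isDerivativeMatrix hμ, fun i => ?_⟩⟩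
    refine ⟨R.approxNormal i, fun ω => |R.approxError i ω|,
      (h.measurable_approxNormal hμ i).aemeasurable,
      (h.measurable_approxError hμ i).norm.aemeasurable, h.map_approxNormal hμ i, ?_, ?_⟩
    · filter_upwards [h.ae_adjustedResidual_eq hμ i] with ω hω
      have hpos : 0 ≤ |R.psi (R.ε ω.1 i)| + R.err ω.1 :=
        add_nonneg (abs_nonneg _) (norm_nonneg _)
      rw [hω, add_sub_cancel_left, abs_mul, abs_of_nonneg hpos]
    · intro δ hδ
      simp only [abs_abs]
      exact hK n p R h i δ hδ
  · -- The error is split between the two variables in the proportion of `|ψ(εᵢ)|` to the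
    -- estimation error.
    have hε : ∀ k, Measurable fun ω : (R k).Ω × ℝ => (R k).ε ω.1 (i k) := fun k =>
      ((measurable_pi_apply (i k)).comp (h k).measurable_ε).comp measurable_fst
    have hψ : ∀ k, Measurable fun ω : (R k).Ω × ℝ => |(R k).psi ((R k).ε ω.1 (i k))| := fun k =>
      (h k).lipschitzWith_psi.continuous.abs.measurable.comp (hε k)
    have hZ := fun k => (h k).measurable_approxNormal hμ (i k)
    have hW := fun k => (h k).measurable_approxError hμ (i k)
    refine ⟨fun k ω => (R k).ε ω.1 (i k) +
        (R k).approxError (i k) ω * |(R k).psi ((R k).ε ω.1 (i k))|,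
      fun k ω => (R k).approxNormal (i k) ω + (R k).approxError (i k) ω, fun k => ?_, ?_⟩
    · filter_upwards [(h k).ae_adjustedResidual_eq hμ (i k)] with ω hω
      rw [hω]
      ring
    · refine tendstoInDistribution_of_map_eq
        (X := fun k ω => ((R k).ε ω.1 (i k), (R k).approxNormal (i k) ω))
        (fun k => ((hε k).prodMk (hZ k)).aemeasurable)
        (fun k => (((hε k).add ((hW k).mul (hψ k))).prodMk ((hZ k).add (hW k))).aemeasurable)
        (fun k => ?_) fun η hη => ?_
      · rw [(h k).map_noise_eval_approxNormal hμ, hF k]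
      · refine tendsto_of_tendsto_of_tendsto_of_le_of_le tendsto_const_nhds
          (RegressionProblem.tendsto_measure_perturbation_ge hγ hμ i hn h hF hη)
          (fun _ => zero_le) fun k => measure_mono fun ω hω => ?_
        rw [Set.mem_ofPred_eq] at hω ⊢
        refine hω.trans ?_
        rw [Prod.mk_sub_mk, add_sub_cancel_left, add_sub_cancel_left, Prod.norm_mk,
          Real.norm_eq_abs, Real.norm_eq_abs, abs_mul, abs_abs]
        refine max_le ?_ ?_
        · gcongr
          linarith
        · refine le_mul_of_one_le_right (abs_nonneg _) ?_
          have := abs_nonneg ((R k).psi ((R k).ε ω.1 (i k)))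
          linarith
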